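/- An (undirected) dynamic network consists of a finite simple graph $G=(V,E)$, a capacity $c(e)\in\mathbb{N}$ and a transit time $\tau(e)\in\mathbb{N}^+$ for every edge $e\in E$, and a supply $\sigma(v)\in\mathbb{N}$ for every vertex $v$ (with $\sigma(v)=0$ if $v$ is not a source). A position is a triple $(uv,a,b)$ with $uv\in E$, $a,b\in\mathbb{N}$ and $a+b=\tau(uv)$, namely the point of the edge $uv$ at travel time $a$ from $u$ and $b$ from $v$. Supply moves in discrete time: per time step at most $c(e)$ indivisible units enter an edge $e$ in a given direction (with no piece of an edge traversed in both directions in the same step), a unit crosses $e$ in $\tau(e)$ steps, and units may wait at vertices. Sinks are positions, and units may stop at any sink. $k$-Sink Location (decision version): given a dynamic network with supplies, $k\in\mathbb{N}$ and a deadline $T\in\mathbb{N}$, do there exist positions $x_1,\dots,x_k$ to which the whole supply can be routed in time at most $T$? The parameter is $k$. For $t\ge 1$, $W[t]$ is the class of parameterized problems that are fpt-reducible to a problem of the following form, for a fixed first-order formula $\varphi(X)\in\Pi_t$ over a finite relational vocabulary with a relation variable $X$: given a finite structure $\mathcal{A}$ and $k\in\mathbb{N}$ (the parameter), is there a relation $S$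 on $\mathcal{A}$ with exactly $k$ elements such that $\mathcal{A}\models\varphi(S)$? An fpt-reduction is a many-one reduction computable by a Turing machine in time $f(\kappa)\cdot n^{O(1)}$, where $\kappa$ is the parameter and $n$ the length of the input and $f$ is computable, such that the new parameter is at most $g(\kappa)$ for some computable $g$. **Theorem.** $k$-Sink Location on undirected dynamic networks, parameterized by $k$, is $W[2]$-hard, and hence $W[1]$-hard, under fpt-reductions. Both remain true when the inputs are restricted to networks in which every edge has unit transit time and unit capacity. -/

import Mathlib

/-! ### Words -/

/-- A finite sequence of natural numbers as a word over the three letters `some false`, `some true`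
(binary digits) and `none` (end of a number); every number is written in binary. -/
def encodeNats (l : List ℕ) : List (Option Bool) :=
  l.flatMap fun m => (Computability.encodeNat m).map some ++ [none]

/-- A natural number in unary, as a sequence of numbers: `m` ones followed by a zero. -/
def unaryNats (m : ℕ) : List ℕ := List.replicate m 1 ++ [0]

theorem map_some_append_none_inj {a b : List Bool} {x y : List (Option Bool)}
    (h : a.map some ++ none :: x = b.map some ++ none :: y) : a = b ∧ x = y := by
  induction a generalizing b with
  | nil => cases b <;> simp_all
  | cons c a ih =>
    cases b with
    | nil => simp at h
    | cons d b =>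
      simp only [List.map_cons, List.cons_append, List.cons.injEq, Option.some.injEq] at h
      obtain ⟨h1, h2⟩ := ih h.2
      exact ⟨by rw [h.1, h1], h2⟩

theorem encodeNats_injective : Function.Injective encodeNats := by
  intro l
  induction l with
  | nil =>
    intro l' h
    cases l' with
    | nil => rfl
    | cons => simp [encodeNats] at h
  | cons m l ih =>
    intro l' h
    cases l' with
    | nil => simp [encodeNats] at h
    | cons m' l' =>
      simp only [encodeNats, List.flatMap_cons, List.append_assoc, List.singleton_append] at h
      obtain ⟨h1, h2⟩ := map_some_append_none_inj h
      have h3 := congrArg Computability.decodeNat h1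
      simp only [Computability.decode_encodeNat] at h3
      rw [h3, ih h2]

theorem unaryNats_append_inj {a b : ℕ} {x y : List ℕ}
    (h : unaryNats a ++ x = unaryNats b ++ y) : a = b ∧ x = y := by
  induction a generalizing b with
  | zero => cases b <;> simp_all [unaryNats, List.replicate_succ]
  | succ a ih =>
    cases b with
    | zero => simp [unaryNats, List.replicate_succ] at h
    | succ b =>
      simp only [unaryNats, List.replicate_succ, List.cons_append, List.cons.injEq,
        true_and] at h
      obtain ⟨h1, h2⟩ := ih h
      exact ⟨by rw [h1], h2⟩

theorem flatMap_inj_of_length {α β : Type} {f g : α → List β} (hlen : ∀ a, (f a).length = (g a).length)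
    {l : List α} (h : l.flatMap f = l.flatMap g) : ∀ a ∈ l, f a = g a := by
  induction l with
  | nil => simp
  | cons b l ih =>
    simp only [List.flatMap_cons] at h
    obtain ⟨h1, h2⟩ := List.append_inj h (hlen b)
    simpa [h1] using ih h2

/-! ### Parameterized problems and fpt-reductions -/

/-- A parameterized decision problem: its instances, written as words over a finite alphabet, the
parameter of each instance, and the set of yes-instances. -/
structure ParamProblem where
  Inst : Type
  Letter : Type
  finite_letter : Finite Letter
  encode : Inst → List Letter
  encode_injective : Function.Injective encode
  param : Inst → ℕ
  Yes : Inst → Prop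

/-- The restriction of a problem to the instances that satisfy `S`. -/
def ParamProblem.restrict (P : ParamProblem) (S : P.Inst → Prop) : ParamProblem where
  Inst := {x : P.Inst // S x}
  Letter := P.Letter
  finite_letter := P.finite_letter
  encode x := P.encode x.1
  encode_injective _ _ h := Subtype.ext (P.encode_injective h)
  param x := P.param x.1
  Yes x := P.Yes x.1

/-- `f` is computed by a (multi-stack) Turing machine within `F (param x) * p (length of x)` steps on
every instance `x`, for some computable `F` and some polynomial `p`. -/
def FPTComputable (P Q : ParamProblem) (f : P.Inst → Q.Inst) : Prop :=
  ∃ (M : Turing.TM2ComputableAux P.Letter Q.Letter) (F : ℕ → ℕ) (p : Polynomial ℕ),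
    Computable F ∧
    ∀ x : P.Inst, Nonempty (Turing.TM2OutputsInTime M.tm
      ((P.encode x).map M.inputAlphabet.symm)
      (some ((Q.encode (f x)).map M.outputAlphabet.symm))
      (F (P.param x) * p.eval (P.encode x).length))

/-- There is an fpt-reduction (parameterized many-one reduction) from `P` to `Q`. -/
def FPTReducible (P Q : ParamProblem) : Prop :=
  ∃ f : P.Inst → Q.Inst,
    (∀ x, P.Yes x ↔ Q.Yes (f x)) ∧
    FPTComputable P Q f ∧
    ∃ g : ℕ → ℕ, Computable g ∧ ∀ x, Q.param (f x) ≤ g (P.param x)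

/-- `P` is hard for the class `C` under fpt-reductions. -/
def IsHardFor (C : Set ParamProblem) (P : ParamProblem) : Prop :=
  ∀ Q ∈ C, FPTReducible Q P

/-! ### The W-hierarchy

`W[t]` is the closure under fpt-reductions of the weighted Fagin-definability problems
of the first-order formulas `φ(X)` in the class `Π_t`, where `X` is a relation variable. -/

/-- The relation symbols of a finite relational vocabulary with arities `ar`, together with
a relation variable of arity `s`. -/
inductive WDRel {r : ℕ} (s : ℕ) (ar : Fin r → ℕ) : ℕ → Type
  | var : WDRel s ar s
  | sym (i : Fin r) : WDRel s ar (ar i)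

/-- The first-order language with these relation symbols. -/
def wdLanguage {r : ℕ} (s : ℕ) (ar : Fin r → ℕ) : FirstOrder.Language.{0, 0} where
  Functions := fun _ => Empty
  Relations := WDRel s ar

/-- `QuantPrefix true t φ` says that `φ` is in `Π_t`, and `QuantPrefix false t φ` that it is in `Σ_t`:
`Π_0 = Σ_0` are the quantifier-free formulas, `Π_(t+1)` are the formulas `∀ x₁ … ∀ xₘ ψ` with `ψ` in
`Σ_t`, and `Σ_(t+1)` the formulas `∃ x₁ … ∃ xₘ ψ` with `ψ` in `Π_t` (`m ≥ 0`). -/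
inductive QuantPrefix {L : FirstOrder.Language.{0, 0}} :
    Bool → ℕ → ∀ {m : ℕ}, L.BoundedFormula Empty m → Prop
  | qf {b : Bool} {m : ℕ} {φ : L.BoundedFormula Empty m} (h : φ.IsQF) : QuantPrefix b 0 φ
  | switch {b : Bool} {t m : ℕ} {φ : L.BoundedFormula Empty m} (h : QuantPrefix (!b) t φ) :
      QuantPrefix b (t + 1) φ
  | all {t m : ℕ} {φ : L.BoundedFormula Empty (m + 1)} (h : QuantPrefix true (t + 1) φ) :
      QuantPrefix true (t + 1) φ.all
  | ex {t m : ℕ} {φ : L.BoundedFormula Empty (m + 1)} (h : QuantPrefix false (t + 1) φ) :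
      QuantPrefix false (t + 1) φ.ex

/-- A finite structure with the nonempty universe `{0, …, n - 1}` over the vocabulary with arities
`ar`, and a natural number `k`. -/
@[ext] structure WDInstance {r : ℕ} (ar : Fin r → ℕ) where
  n : ℕ
  n_pos : 0 < n
  rel : (i : Fin r) → (Fin (ar i) → Fin n) → Bool
  k : ℕ

/-- The structure of an instance, with `S` as the value of the relation variable. -/
abbrev WDInstance.toStructure {r : ℕ} {ar : Fin r → ℕ} (A : WDInstance ar) (s : ℕ)
    (S : Finset (Fin s → Fin A.n)) : (wdLanguage s ar).Structure (Fin A.n) where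
  funMap := fun f => Empty.elim f
  RelMap := fun R => match R with
    | WDRel.var => fun x => x ∈ S
    | WDRel.sym i => fun x => A.rel i x = true

/-- The numbers `n` and `k` (in unary) and the truth tables of the relations. -/
def WDInstance.nats {r : ℕ} {ar : Fin r → ℕ} (A : WDInstance ar) : List ℕ :=
  unaryNats A.n ++ (unaryNats A.k ++ (List.finRange r).flatMap fun i =>
    List.ofFn fun j : Fin (A.n ^ ar i) => (A.rel i (finFunctionFinEquiv.symm j)).toNat)

theorem WDInstance.nats_injective {r : ℕ} {ar : Fin r → ℕ} :
    Function.Injective (WDInstance.nats (ar := ar)) := by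
  rintro ⟨n, hn, R, k⟩ ⟨n', hn', R', k'⟩ h
  obtain ⟨h1, h2⟩ := unaryNats_append_inj h
  obtain ⟨h3, h4⟩ := unaryNats_append_inj h2
  dsimp only at h1 h3
  subst h1 h3
  have h5 := flatMap_inj_of_length (by simp) h4
  have h6 : R = R' := by
    funext i x
    have h7 := congrFun (List.ofFn_injective (h5 i (List.mem_finRange i))) (finFunctionFinEquiv x)
    simp only [Equiv.symm_apply_apply] at h7
    revert h7
    cases R i x <;> cases R' i x <;> simp
  subst h6
  rfl

/-- The weighted Fagin-definability problem of `φ(X)`: given a finite structure `A` and `k`, with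
parameter `k`, is there a relation `S` on `A` with exactly `k` elements such that `A ⊨ φ(S)`? -/
def weightedDefinability {r s : ℕ} {ar : Fin r → ℕ} (φ : (wdLanguage s ar).Sentence) :
    ParamProblem where
  Inst := WDInstance ar
  Letter := Option Bool
  finite_letter := inferInstance
  encode A := encodeNats A.nats
  encode_injective := encodeNats_injective.comp WDInstance.nats_injective
  param A := A.k
  Yes A := ∃ S : Finset (Fin s → Fin A.n), S.card = A.k ∧
    @FirstOrder.Language.Sentence.Realize _ (Fin A.n) (A.toStructure s S) φ

/-- The class `W[t]`. -/
def WClass (t : ℕ) : Set ParamProblem :=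
  {Q | ∃ (r s : ℕ) (ar : Fin r → ℕ) (φ : (wdLanguage s ar).Sentence),
    QuantPrefix true t φ ∧ FPTReducible Q (weightedDefinability φ)}

/-! ### Dynamic networks and sink location -/

/-- An undirected dynamic network with vertex set `{0, …, n - 1}`: a graph with a capacity and a
positive transit time on every edge. Both functions are zero outside the edge set. The supply is a
natural number for every vertex, zero at the vertices that are not sources. -/
structure DynamicNetwork where
  n : ℕ
  graph : SimpleGraph (Fin n)
  cap : Sym2 (Fin n) → ℕ
  time : Sym2 (Fin n) → ℕ
  adj_iff : ∀ u v, graph.Adj u v ↔ 0 < time s(u, v)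
  cap_eq_zero : ∀ u v, ¬ graph.Adj u v → cap s(u, v) = 0
  supply : Fin n → ℕ

namespace DynamicNetwork

/-- A position `(uv, du, dv)` on an edge `uv`, at travel time `du` from `u` and `dv` from `v`.
The endpoints of the edge are the positions with `du = 0` and with `dv = 0`. -/
structure Position (N : DynamicNetwork) where
  u : Fin N.n
  v : Fin N.n
  adj : N.graph.Adj u v
  du : ℕ
  dv : ℕ
  add_eq : du + dv = N.time s(u, v)

/-- Some sink of `X` is the point of the edge `vw` at travel time `d` from `v`. -/
def SinkOnEdge (N : DynamicNetwork) {k : ℕ} (X : Fin k → N.Position) (v w : Fin N.n) (d : ℕ) : Prop :=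
  ∃ j, ((X j).u = v ∧ (X j).v = w ∧ (X j).du = d) ∨ ((X j).v = v ∧ (X j).u = w ∧ (X j).dv = d)

/-- Some sink of `X` is the vertex `v`. -/
def SinkAt (N : DynamicNetwork) {k : ℕ} (X : Fin k → N.Position) (v : Fin N.n) : Prop :=
  ∃ w, N.SinkOnEdge X v w 0

/-- A routing of all the supply to the sinks `X` in time at most `T` (a flow over discrete time,
with unlimited waiting at the vertices).
`flow v w d t` is the number of units that travel, between time `t` and time `t + 1`, along the edge
`vw` in the direction of `w`, from the point at travel time `d` from `v` to the point at travel time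
`d + 1` from `v`. `stock v t` is the number of units present at the vertex `v` at time `t`, counting
those that arrive and those that depart at that time. -/
structure Routing (N : DynamicNetwork) {k : ℕ} (X : Fin k → N.Position) (T : ℕ) where
  flow : Fin N.n → Fin N.n → ℕ → ℕ → ℕ
  stock : Fin N.n → ℕ → ℕ
  /-- Units travel on edges only, and not after time `T`. -/
  support : ∀ v w d t, flow v w d t ≠ 0 → N.graph.Adj v w ∧ d < N.time s(v, w) ∧ t < T
  capacity : ∀ v w d t, flow v w d t ≤ N.cap s(v, w)
  /-- No piece of an edge is traversed in both directions at the same time. -/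
  one_way : ∀ v w d e t, d + e + 1 = N.time s(v, w) → flow v w d t = 0 ∨ flow w v e t = 0
  /-- Inside an edge, units that reach a sink may stop there; -/
  inner_le : ∀ v w d t, d + 1 < N.time s(v, w) → flow v w (d + 1) (t + 1) ≤ flow v w d t
  /-- all others travel on, -/
  inner_eq : ∀ v w d t, d + 1 < N.time s(v, w) → ¬ N.SinkOnEdge X v w (d + 1) →
    flow v w (d + 1) (t + 1) = flow v w d t
  /-- and nothing is inside an edge at the beginning. -/
  inner_zero : ∀ v w d, flow v w (d + 1) 0 = 0
  stock_zero : ∀ v, stock v 0 = N.supply v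
  departures_le : ∀ v t, ∑ w, flow v w 0 t ≤ stock v t
  conservation : ∀ v t, stock v (t + 1) + ∑ w, flow v w 0 t =
    stock v t + ∑ w, flow w v (N.time s(w, v) - 1) t
  /-- At time `T` everything is at the sinks. -/
  finished : ∀ v, ¬ N.SinkAt X v → stock v T = 0

/-- All edges have unit transit time and unit capacity. -/
def IsUnit (N : DynamicNetwork) : Prop :=
  ∀ u v, N.graph.Adj u v → N.time s(u, v) = 1 ∧ N.cap s(u, v) = 1

end DynamicNetwork

/-- An instance of the decision version of sink location: a network with supplies, the number `k` of
sinks and a deadline `T`. -/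
structure SinkInstance where
  net : DynamicNetwork
  k : ℕ
  T : ℕ

/-- The numbers `n` and `k` (in unary), the deadline, the supplies, and the matrix of
the capacities and transit times (both zero for a pair that is not an edge). -/
def SinkInstance.nats (I : SinkInstance) : List ℕ :=
  unaryNats I.net.n ++ (unaryNats I.k ++ (I.T :: (List.ofFn I.net.supply ++
    (List.finRange I.net.n).flatMap fun u => (List.finRange I.net.n).flatMap fun v =>
      [I.net.cap s(u, v), I.net.time s(u, v)])))

theorem SinkInstance.nats_injective : Function.Injective SinkInstance.nats := by
  rintro ⟨⟨n, G, c, τ, hG, hc, σ⟩, k, T⟩ ⟨⟨n', G', c', τ', hG', hc', σ'⟩, k', T'⟩ h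
  obtain ⟨h1, h2⟩ := unaryNats_append_inj h
  obtain ⟨h3, h4⟩ := unaryNats_append_inj h2
  dsimp only at h1 h3
  subst h1 h3
  simp only [List.cons.injEq] at h4
  obtain ⟨h5, h6⟩ := h4
  obtain ⟨h7, h8⟩ := List.append_inj h6 (by simp)
  have h9 : σ = σ' := List.ofFn_injective h7
  have h10 := flatMap_inj_of_length (by simp) h8
  have h11 : ∀ u v, c s(u, v) = c' s(u, v) ∧ τ s(u, v) = τ' s(u, v) := by
    intro u v
    have h12 := flatMap_inj_of_length (by simp) (h10 u (List.mem_finRange u)) v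
      (List.mem_finRange v)
    simpa using h12
  have h13 : c = c' := by
    funext e; induction e with | _ u v => exact (h11 u v).1
  have h14 : τ = τ' := by
    funext e; induction e with | _ u v => exact (h11 u v).2
  subst h5 h9 h13 h14
  have h15 : G = G' := by
    ext u v; rw [hG, hG']
  subst h15
  rfl

/-- Sink location, parameterized by `k`: are there `k` positions to which
all the supply can be routed in time at most `T`? -/
def sinkLocation : ParamProblem where
  Inst := SinkInstance
  Letter := Option Bool
  finite_letter := inferInstance
  encode I := encodeNats I.nats
  encode_injective := encodeNats_injective.comp SinkInstance.nats_injective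
  param I := I.k
  Yes I := ∃ X : Fin I.k → I.net.Position, Nonempty (I.net.Routing X I.T)

/-- Sink location on networks with unit transit times and unit capacities. -/
def unitSinkLocation : ParamProblem :=
  sinkLocation.restrict fun I : SinkInstance => I.net.IsUnit

/-!
The core is a reduction from weighted definability for a `Π₂`-formula `∀ x ∃ y ψ(x, y, X)` to
dominating set in a graph, in the form of sink location. It takes polynomial time, and the new
parameter is a function of the old one.

*Selecting a set by few candidates.* There are too many sets `X` with `k` elements for a polynomial
list, so the set is selected in parts. Its elements, increasingly ordered and supplemented by a
value on either side, have the ranks `0, …, k + 1`. A candidate assigns values to a bounded number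
`D` of these ranks. The ranks that it mentions form its group, and there are `(k + 2) ^ D` groups.
One candidate from every group, pairwise compatible, make up a set (`exists_set_of_candidates`). A
non-member of the set is recognized by the two consecutive ranks between whose values it lies. So if
`D` is at least twice the number of atoms `X(…)` in `ψ`, then for every `x` and `y` a single
selected candidate determines whether `ψ` holds (`exists_candidates_of_set`). The formula thus
becomes a hitting set problem (`QuantPrefix.exists_candSatisfies`): select `(k + 2) ^ D` candidates
such that every constraint is satisfied by one of them, where the constraints say that the selection
contains a candidate from every group, that its members are compatible, and that every `x` has a `y`
for which a selected candidate ensures `ψ`.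

*Sinks as a dominating set.* With unit transit times, capacities and supplies and the deadline `1`,
every vertex without a sink has to send its unit to a neighbour with a sink. So sinks exist if and
only if there is a dominating set of the given size
(`DynamicNetwork.IsUnit.exists_dominating_of_routing`,
`DynamicNetwork.IsUnit.exists_routing_of_dominating`). The graph is a clique of all the candidates,
together with more copies of every constraint than there are sinks, each of them adjacent to the
candidates that satisfy it (`yes_constraintInstance`).

*Computability.* The bits of the encoded network are given by arithmetic expressions with bounded
sums over the letters of the input word. Such expressions can be evaluated by a small imperative
language on stacks, in unary and in polynomial time (`Ex.exists_runs_prog`,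
`Ex.exists_machine_bits`), and this language is compiled to stack machines (`Prog.Exec.stepsTo`).
They can be run after the machine of an fpt-reduction (`FPTReducible.trans_of_polyTime`).

Hardness for `W[1]` follows from `Π₁ ⊆ Π₂`, and hardness without the restriction to unit networks
from the fact that the restricted instances are written in the same way.
-/

/-! ### Composition of stack machines -/

namespace Turing

open StateTransition

section Composition

variable {K₁ K₂ : Type} {Γ₁ : K₁ → Type} {Γ₂ : K₂ → Type} {Λ₁ Λ₂ σ₁ σ₂ : Type}

/-- The machine with step function `f` gets from `a` to `b` in exactly `t` steps. -/
def StepsTo {α : Type} (f : α → Option α) (t : ℕ) (a b : α) : Prop :=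
  (flip bind f)^[t] (some a) = some b

theorem StepsTo.congr {α : Type} {f : α → Option α} {t : ℕ} {a a' b b' : α} (h : StepsTo f t a b)
    (ha : a = a') (hb : b = b') : StepsTo f t a' b' := ha ▸ hb ▸ h

theorem StepsTo.single {α : Type} {f : α → Option α} {a b : α} (h : f a = some b) :
    StepsTo f 1 a b := h

theorem StepsTo.trans {α : Type} {f : α → Option α} {s t : ℕ} {a b c : α}
    (h₁ : StepsTo f s a b) (h₂ : StepsTo f t b c) : StepsTo f (s + t) a c := by
  unfold StepsTo at *
  rw [add_comm, Function.iterate_add_apply, h₁, h₂]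

theorem StepsTo.head {α : Type} {f : α → Option α} {t : ℕ} {a b c : α}
    (h₁ : f a = some b) (h₂ : StepsTo f t b c) : StepsTo f (t + 1) a c := by
  rw [add_comm]; exact (StepsTo.single h₁).trans h₂

theorem iterate_flip_bind_none {α : Type} (f : α → Option α) (t : ℕ) :
    (flip bind f)^[t] none = none := by
  induction t with
  | zero => rfl
  | succ t ih => rw [Function.iterate_succ_apply]; exact ih

theorem StepsTo.succ_iff {α : Type} {f : α → Option α} {t : ℕ} {a c : α} :
    StepsTo f (t + 1) a c ↔ ∃ b, f a = some b ∧ StepsTo f t b c := by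
  unfold StepsTo
  rw [Function.iterate_succ_apply]
  change (flip bind f)^[t] (f a) = some c ↔ _
  cases h : f a with
  | none => rw [iterate_flip_bind_none]; simp
  | some b => simp

/-- A simulation of `f` by `g`, step by step. -/
theorem StepsTo.map {α β : Type} {f : α → Option α} {g : β → Option β} (φ : α → β)
    (h : ∀ a b, f a = some b → g (φ a) = some (φ b)) {t : ℕ} {a b : α} (hab : StepsTo f t a b) :
    StepsTo g t (φ a) (φ b) := by
  induction t generalizing a with
  | zero =>
    have : a = b := by simpa [StepsTo] using hab
    subst this; rfl
  | succ t ih =>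
    obtain ⟨c, h1, h2⟩ := StepsTo.succ_iff.1 hab
    exact StepsTo.head (h _ _ h1) (ih h2)

/-- The most symbols that a statement can push. -/
def TM2.Stmt.pushes {K : Type} {Γ : K → Type} {Λ σ : Type} : TM2.Stmt Γ Λ σ → ℕ
  | .push _ _ q => q.pushes + 1
  | .peek _ _ q => q.pushes
  | .pop _ _ q => q.pushes
  | .load _ q => q.pushes
  | .branch _ q₁ q₂ => max q₁.pushes q₂.pushes
  | .goto _ => 0
  | .halt => 0

theorem TM2.length_stepAux_le {K : Type} [DecidableEq K] {Γ : K → Type} {Λ σ : Type}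
    (q : TM2.Stmt Γ Λ σ) (v : σ) (S : ∀ k, List (Γ k)) (k : K) :
    ((TM2.stepAux q v S).stk k).length ≤ (S k).length + q.pushes := by
  have upd : ∀ (k' : K) (l : List (Γ k')) (c : ℕ), l.length ≤ (S k').length + c →
      (Function.update S k' l k).length ≤ (S k).length + c := by
    intro k' l c h
    by_cases hk : k = k'
    · subst hk; simpa using h
    · simp [Function.update_of_ne hk]
  induction q generalizing v S with
  | push k' f q ih =>
    refine (ih v _ ?_).trans ?_
    · intro k'' l c h
      by_cases hk : k = k''
      · subst hk; simpa using h
      · simp [Function.update_of_ne hk]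
    · have := upd k' (f v :: S k') 1 (by simp)
      simp only [Stmt.pushes]; omega
  | peek k' f q ih => exact ih _ S upd
  | pop k' f q ih =>
    refine (ih _ _ ?_).trans ?_
    · intro k'' l c h
      by_cases hk : k = k''
      · subst hk; simpa using h
      · simp [Function.update_of_ne hk]
    · have := upd k' (S k').tail 0 (by simp)
      simp only [Stmt.pushes]; omega
  | load a q ih => exact ih _ S upd
  | branch f q₁ q₂ ih₁ ih₂ =>
    simp only [TM2.stepAux, Stmt.pushes]
    cases f v
    · exact (ih₂ v S upd).trans (by simp)
    · exact (ih₁ v S upd).trans (by simp)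
  | goto => simp [TM2.stepAux]
  | halt => simp [TM2.stepAux]

/-- In every step the stacks grow by a bounded number of symbols. -/
theorem TM2.length_stepsTo_le {K : Type} [DecidableEq K] {Γ : K → Type} {Λ σ : Type}
    (M : Λ → TM2.Stmt Γ Λ σ) (C : ℕ) (hC : ∀ l, (M l).pushes ≤ C) {t : ℕ} {a b : TM2.Cfg Γ Λ σ}
    (h : StepsTo (TM2.step M) t a b) (k : K) :
    (b.stk k).length ≤ (a.stk k).length + C * t := by
  induction t generalizing a with
  | zero =>
    have : a = b := by simpa [StepsTo] using h
    subst this; simp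
  | succ t ih =>
    obtain ⟨c, h1, h2⟩ := StepsTo.succ_iff.1 h
    have := ih h2
    obtain ⟨l, v, S⟩ := a
    cases l with
    | none => simp at h1
    | some l =>
      simp only [TM2.step, Option.some.injEq] at h1
      subst h1
      have h3 := TM2.length_stepAux_le (M l) v S k
      have h4 := hC l
      dsimp only at *
      rw [mul_add]; omega

/-- The labels of the composition of two machines: those of the two machines, and one
for the loop that carries the output of the first machine over to the second. -/
inductive CompLabel (Λ₁ Λ₂ : Type)
  | fst (l : Λ₁)
  | transfer
  | snd (l : Λ₂)
  deriving Fintype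

/-- The stacks of both machines, side by side. -/
def joinStacks (S₁ : ∀ k, List (Γ₁ k)) (S₂ : ∀ k, List (Γ₂ k)) :
    ∀ k : K₁ ⊕ K₂, List (Sum.elim Γ₁ Γ₂ k)
  | .inl k => S₁ k
  | .inr k => S₂ k

theorem joinStacks_nil :
    joinStacks (fun k => ([] : List (Γ₁ k))) (fun k => ([] : List (Γ₂ k))) = fun _ => [] := by
  funext k; cases k <;> rfl

theorem update_joinStacks_inl [DecidableEq K₁] [DecidableEq K₂] (S₁ : ∀ k, List (Γ₁ k))
    (S₂ : ∀ k, List (Γ₂ k)) (k : K₁) (x : List (Γ₁ k)) :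
    Function.update (joinStacks S₁ S₂) (Sum.inl k) x = joinStacks (Function.update S₁ k x) S₂ := by
  funext j
  rcases j with j | j
  · by_cases h : j = k
    · subst h
      exact (Function.update_self (β := fun k => List (Sum.elim Γ₁ Γ₂ k)) (Sum.inl j) x
        (joinStacks S₁ S₂)).trans
        (Function.update_self (β := fun k => List (Γ₁ k)) (f := S₁) _ x).symm
    · exact (Function.update_of_ne (β := fun k => List (Sum.elim Γ₁ Γ₂ k))
        (f := joinStacks S₁ S₂) (a := Sum.inl j) (a' := Sum.inl k) (by simpa using h) x).trans
        (Function.update_of_ne (β := fun k => List (Γ₁ k)) (f := S₁) h x).symm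
  · exact Function.update_of_ne (β := fun k => List (Sum.elim Γ₁ Γ₂ k))
      (f := joinStacks S₁ S₂) (a := Sum.inr j) (a' := Sum.inl k) (by simp) x

theorem update_joinStacks_inr [DecidableEq K₁] [DecidableEq K₂] (S₁ : ∀ k, List (Γ₁ k))
    (S₂ : ∀ k, List (Γ₂ k)) (k : K₂) (x : List (Γ₂ k)) :
    Function.update (joinStacks S₁ S₂) (Sum.inr k) x = joinStacks S₁ (Function.update S₂ k x) := by
  funext j
  rcases j with j | j
  · exact Function.update_of_ne (β := fun k => List (Sum.elim Γ₁ Γ₂ k))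
      (f := joinStacks S₁ S₂) (a := Sum.inl j) (a' := Sum.inr k) (by simp) x
  · by_cases h : j = k
    · subst h
      exact (Function.update_self (β := fun k => List (Sum.elim Γ₁ Γ₂ k)) (Sum.inr j) x
        (joinStacks S₁ S₂)).trans
        (Function.update_self (β := fun k => List (Γ₂ k)) (f := S₂) _ x).symm
    · exact (Function.update_of_ne (β := fun k => List (Sum.elim Γ₁ Γ₂ k))
        (f := joinStacks S₁ S₂) (a := Sum.inr j) (a' := Sum.inr k) (by simpa using h) x).trans
        (Function.update_of_ne (β := fun k => List (Γ₂ k)) (f := S₂) h x).symm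

/-- A statement of the first machine, as one of the composition. Instead of halting it
starts the transfer. -/
def liftFst (τ : Type) : TM2.Stmt Γ₁ Λ₁ σ₁ →
    TM2.Stmt (Sum.elim Γ₁ Γ₂) (CompLabel Λ₁ Λ₂) (σ₁ × τ)
  | .push k f q => .push (Sum.inl k) (fun v => f v.1) (liftFst τ q)
  | .peek k f q => .peek (Sum.inl k) (fun v x => (f v.1 x, v.2)) (liftFst τ q)
  | .pop k f q => .pop (Sum.inl k) (fun v x => (f v.1 x, v.2)) (liftFst τ q)
  | .load f q => .load (fun v => (f v.1, v.2)) (liftFst τ q)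
  | .branch f q₁ q₂ => .branch (fun v => f v.1) (liftFst τ q₁) (liftFst τ q₂)
  | .goto f => .goto fun v => .fst (f v.1)
  | .halt => .goto fun _ => .transfer

/-- A configuration of the first machine, as one of the composition. -/
def liftFstCfg {τ : Type} (y : τ) (S₂ : ∀ k, List (Γ₂ k)) (c : TM2.Cfg Γ₁ Λ₁ σ₁) :
    TM2.Cfg (Sum.elim Γ₁ Γ₂) (CompLabel Λ₁ Λ₂) (σ₁ × τ) :=
  ⟨some (c.l.elim .transfer .fst), (c.var, y), joinStacks c.stk S₂⟩

theorem stepAux_liftFst [DecidableEq K₁] [DecidableEq K₂] {τ : Type} (y : τ)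
    (S₂ : ∀ k, List (Γ₂ k)) (q : TM2.Stmt Γ₁ Λ₁ σ₁) (v : σ₁) (S : ∀ k, List (Γ₁ k)) :
    TM2.stepAux (liftFst (Γ₂ := Γ₂) (Λ₂ := Λ₂) τ q) (v, y) (joinStacks S S₂) =
      liftFstCfg y S₂ (TM2.stepAux q v S) := by
  induction q generalizing v S with
  | push k f q ih =>
    simp only [liftFst, TM2.stepAux]
    rw [← ih, ← update_joinStacks_inl]; rfl
  | peek k f q ih => simp only [liftFst, TM2.stepAux]; rw [← ih]; rfl
  | pop k f q ih =>
    simp only [liftFst, TM2.stepAux]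
    rw [← ih, ← update_joinStacks_inl]; rfl
  | load f q ih => simp only [liftFst, TM2.stepAux]; rw [← ih]
  | branch f q₁ q₂ ih₁ ih₂ =>
    simp only [liftFst, TM2.stepAux]
    cases f v
    · exact ih₂ v S
    · exact ih₁ v S
  | goto f => rfl
  | halt => rfl

/-- A statement of the second machine, as one of the composition. -/
def liftSnd : TM2.Stmt Γ₂ Λ₂ σ₂ → (ρ τ : Type) →
    TM2.Stmt (Sum.elim Γ₁ Γ₂) (CompLabel Λ₁ Λ₂) (ρ × σ₂ × τ)
  | .push k f q, ρ, τ => .push (Sum.inr k) (fun v => f v.2.1) (liftSnd q ρ τ)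
  | .peek k f q, ρ, τ => .peek (Sum.inr k) (fun v x => (v.1, f v.2.1 x, v.2.2)) (liftSnd q ρ τ)
  | .pop k f q, ρ, τ => .pop (Sum.inr k) (fun v x => (v.1, f v.2.1 x, v.2.2)) (liftSnd q ρ τ)
  | .load f q, ρ, τ => .load (fun v => (v.1, f v.2.1, v.2.2)) (liftSnd q ρ τ)
  | .branch f q₁ q₂, ρ, τ => .branch (fun v => f v.2.1) (liftSnd q₁ ρ τ) (liftSnd q₂ ρ τ)
  | .goto f, _, _ => .goto fun v => .snd (f v.2.1)
  | .halt, _, _ => .halt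

/-- A configuration of the second machine, as one of the composition. -/
def liftSndCfg {ρ τ : Type} (x : ρ) (y : τ) (S₁ : ∀ k, List (Γ₁ k)) (c : TM2.Cfg Γ₂ Λ₂ σ₂) :
    TM2.Cfg (Sum.elim Γ₁ Γ₂) (CompLabel Λ₁ Λ₂) (ρ × σ₂ × τ) :=
  ⟨c.l.map .snd, (x, c.var, y), joinStacks S₁ c.stk⟩

theorem stepAux_liftSnd [DecidableEq K₁] [DecidableEq K₂] {ρ τ : Type} (x : ρ) (y : τ)
    (S₁ : ∀ k, List (Γ₁ k)) (q : TM2.Stmt Γ₂ Λ₂ σ₂) (v : σ₂) (S : ∀ k, List (Γ₂ k)) :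
    TM2.stepAux (liftSnd (Γ₁ := Γ₁) (Λ₁ := Λ₁) q ρ τ) (x, v, y) (joinStacks S₁ S) =
      liftSndCfg x y S₁ (TM2.stepAux q v S) := by
  induction q generalizing v S with
  | push k f q ih =>
    simp only [liftSnd, TM2.stepAux]
    rw [← ih, ← update_joinStacks_inr]; rfl
  | peek k f q ih => simp only [liftSnd, TM2.stepAux]; rw [← ih]; rfl
  | pop k f q ih =>
    simp only [liftSnd, TM2.stepAux]
    rw [← ih, ← update_joinStacks_inr]; rfl
  | load f q ih => simp only [liftSnd, TM2.stepAux]; rw [← ih]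
  | branch f q₁ q₂ ih₁ ih₂ =>
    simp only [liftSnd, TM2.stepAux]
    cases f v
    · exact ih₂ v S
    · exact ih₁ v S
  | goto f => rfl
  | halt => rfl

/-- One letter is moved from the output stack of the first machine to the input stack of the second,
which is started when there are none left. -/
def transferStmt {B : Type} [Inhabited B] (k₁ : K₁) (k₂ : K₂) (e₁ : Γ₁ k₁ ≃ B) (e₂ : Γ₂ k₂ ≃ B)
    (main : Λ₂) : TM2.Stmt (Sum.elim Γ₁ Γ₂) (CompLabel Λ₁ Λ₂) (σ₁ × σ₂ × Option B) :=
  .pop (Sum.inl k₁) (fun v x => (v.1, v.2.1, x.map e₁)) <|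
  .branch (fun v => v.2.2.isSome)
    (.push (Sum.inr k₂) (fun v => e₂.symm (v.2.2.getD default)) <|
      .load (fun v => (v.1, v.2.1, none)) <| .goto fun _ => .transfer)
    (.goto fun _ => .snd main)

theorem stepAux_transferStmt_nil {B : Type} [Inhabited B] [DecidableEq K₁] [DecidableEq K₂]
    (k₁ : K₁) (k₂ : K₂) (e₁ : Γ₁ k₁ ≃ B) (e₂ : Γ₂ k₂ ≃ B) (main : Λ₂) (x : σ₁) (y : σ₂)
    (S₁ : ∀ k, List (Γ₁ k)) (S₂ : ∀ k, List (Γ₂ k)) (h : S₁ k₁ = []) :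
    TM2.stepAux (transferStmt (Λ₁ := Λ₁) k₁ k₂ e₁ e₂ main) (x, y, none) (joinStacks S₁ S₂) =
      ⟨some (CompLabel.snd main), (x, y, none), joinStacks S₁ S₂⟩ := by
  change cond (Option.map e₁ (S₁ k₁).head?).isSome _
    (⟨some (CompLabel.snd main), (x, y, Option.map e₁ (S₁ k₁).head?),
      Function.update (joinStacks S₁ S₂) (Sum.inl k₁) (S₁ k₁).tail⟩ : TM2.Cfg _ _ _) = _
  rw [update_joinStacks_inl, h]
  have : Function.update S₁ k₁ ([] : List (Γ₁ k₁)).tail = S₁ := by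
    rw [List.tail_nil, ← h]; exact Function.update_eq_self _ _
  rw [this]; rfl

theorem stepAux_transferStmt_cons {B : Type} [Inhabited B] [DecidableEq K₁] [DecidableEq K₂]
    (k₁ : K₁) (k₂ : K₂) (e₁ : Γ₁ k₁ ≃ B) (e₂ : Γ₂ k₂ ≃ B) (main : Λ₂) (x : σ₁) (y : σ₂)
    (S₁ : ∀ k, List (Γ₁ k)) (S₂ : ∀ k, List (Γ₂ k)) (b : B) (l : List (Γ₁ k₁))
    (h : S₁ k₁ = e₁.symm b :: l) :
    TM2.stepAux (transferStmt (Λ₁ := Λ₁) k₁ k₂ e₁ e₂ main) (x, y, none) (joinStacks S₁ S₂) =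
      ⟨some CompLabel.transfer, (x, y, none), joinStacks (Function.update S₁ k₁ l)
        (Function.update S₂ k₂ (e₂.symm b :: S₂ k₂))⟩ := by
  change cond (Option.map e₁ (S₁ k₁).head?).isSome
    (⟨some CompLabel.transfer, (x, y, none),
      Function.update (Function.update (joinStacks S₁ S₂) (Sum.inl k₁) (S₁ k₁).tail)
        (Sum.inr k₂) (e₂.symm ((Option.map e₁ (S₁ k₁).head?).getD default) ::
          Function.update (joinStacks S₁ S₂) (Sum.inl k₁) (S₁ k₁).tail (Sum.inr k₂))⟩ :
            TM2.Cfg _ _ _) _ = _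
  rw [update_joinStacks_inl, h]
  exact (congrArg (fun z => (⟨some CompLabel.transfer, (x, y, none),
      Function.update (joinStacks (Function.update S₁ k₁ l) S₂) (Sum.inr k₂)
        (e₂.symm z :: S₂ k₂)⟩ : TM2.Cfg (Sum.elim Γ₁ Γ₂) (CompLabel Λ₁ Λ₂) (σ₁ × σ₂ × Option B)))
    (e₁.apply_symm_apply b)).trans (congrArg (fun S => (⟨some CompLabel.transfer, (x, y, none), S⟩ :
      TM2.Cfg (Sum.elim Γ₁ Γ₂) (CompLabel Λ₁ Λ₂) (σ₁ × σ₂ × Option B)))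
      (update_joinStacks_inr _ S₂ k₂ (e₂.symm b :: S₂ k₂)))

end Composition

section

variable {A B C : Type} [Inhabited B] [Fintype B]

/-- The machine that runs `M₁`, moves its output to the input stack of `M₂` letter by letter,
thereby reversing it, and then runs `M₂`. -/
def TM2ComputableAux.compReverse (M₁ : TM2ComputableAux A B) (M₂ : TM2ComputableAux B C) :
    TM2ComputableAux A C where
  tm :=
    haveI := M₁.tm.kFin
    haveI := M₂.tm.kFin
    haveI := M₁.tm.ΛFin
    haveI := M₂.tm.ΛFin
    haveI := M₁.tm.σFin
    haveI := M₂.tm.σFin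
    haveI : Fintype (Sum.elim M₁.tm.Γ M₂.tm.Γ (Sum.inl M₁.tm.k₀)) := M₁.tm.Γk₀Fin
    { K := M₁.tm.K ⊕ M₂.tm.K
      k₀ := Sum.inl M₁.tm.k₀
      k₁ := Sum.inr M₂.tm.k₁
      Γ := Sum.elim M₁.tm.Γ M₂.tm.Γ
      Λ := CompLabel M₁.tm.Λ M₂.tm.Λ
      main := .fst M₁.tm.main
      σ := M₁.tm.σ × M₂.tm.σ × Option B
      initialState := (M₁.tm.initialState, M₂.tm.initialState, none)
      m
        | .fst l => liftFst _ (M₁.tm.m l)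
        | .snd l => liftSnd (M₂.tm.m l) _ _
        | .transfer => transferStmt M₁.tm.k₁ M₂.tm.k₀ M₁.outputAlphabet M₂.inputAlphabet
            M₂.tm.main }
  inputAlphabet := M₁.inputAlphabet
  outputAlphabet := M₂.outputAlphabet

theorem stk_initList (tm : FinTM2) (s : List (tm.Γ tm.k₀)) :
    (initList tm s).stk = Function.update (fun _ => []) tm.k₀ s := by
  funext k
  by_cases h : k = tm.k₀
  · subst h; simp [initList]
  · simp [initList, h]

theorem stk_haltList (tm : FinTM2) (s : List (tm.Γ tm.k₁)) :
    (haltList tm s).stk = Function.update (fun _ => []) tm.k₁ s := by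
  funext k
  by_cases h : k = tm.k₁
  · subst h; simp [haltList]
  · simp [haltList, h]

theorem TM2ComputableAux.compReverse_stepsTo (M₁ : TM2ComputableAux A B)
    (M₂ : TM2ComputableAux B C) {a : List A} {b : List B} {c : List C} {t₁ t₂ : ℕ}
    (h₁ : StepsTo M₁.tm.step t₁ (initList M₁.tm (a.map M₁.inputAlphabet.symm))
      (haltList M₁.tm (b.map M₁.outputAlphabet.symm)))
    (h₂ : StepsTo M₂.tm.step t₂ (initList M₂.tm (b.reverse.map M₂.inputAlphabet.symm))
      (haltList M₂.tm (c.map M₂.outputAlphabet.symm))) :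
    StepsTo (M₁.compReverse M₂).tm.step (t₁ + (b.length + 1) + t₂)
      (initList (M₁.compReverse M₂).tm (a.map (M₁.compReverse M₂).inputAlphabet.symm))
      (haltList (M₁.compReverse M₂).tm (c.map (M₁.compReverse M₂).outputAlphabet.symm)) := by
  let := M₁.tm.decidableEqK
  let := M₂.tm.decidableEqK
  have transfer : ∀ (b : List B) (S₂ : List (M₂.tm.Γ M₂.tm.k₀)),
      StepsTo (M₁.compReverse M₂).tm.step (b.length + 1)
        (⟨some .transfer, (M₁.tm.initialState, M₂.tm.initialState, none),
          joinStacks (Function.update (fun _ => []) M₁.tm.k₁ (b.map M₁.outputAlphabet.symm))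
            (Function.update (fun _ => []) M₂.tm.k₀ S₂)⟩ : (M₁.compReverse M₂).tm.Cfg)
        (⟨some (.snd M₂.tm.main), (M₁.tm.initialState, M₂.tm.initialState, none),
          joinStacks (fun _ => [])
            (Function.update (fun _ => []) M₂.tm.k₀
              (b.reverse.map M₂.inputAlphabet.symm ++ S₂))⟩ : (M₁.compReverse M₂).tm.Cfg) := by
    intro b
    induction b with
    | nil =>
      intro S₂
      refine StepsTo.single (congrArg some ?_)
      refine (stepAux_transferStmt_nil M₁.tm.k₁ M₂.tm.k₀ M₁.outputAlphabet M₂.inputAlphabet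
        M₂.tm.main _ _ _ _ (Function.update_self ..)).trans ?_
      exact congrArg (fun S => (⟨some (CompLabel.snd M₂.tm.main),
        (M₁.tm.initialState, M₂.tm.initialState, none), joinStacks S _⟩ :
          TM2.Cfg (Sum.elim M₁.tm.Γ M₂.tm.Γ) (CompLabel M₁.tm.Λ M₂.tm.Λ)
            (M₁.tm.σ × M₂.tm.σ × Option B)))
        (Function.update_eq_self M₁.tm.k₁ (fun k => ([] : List (M₁.tm.Γ k))))
    | cons x b ih =>
      intro S₂
      refine StepsTo.head ?_ (by simpa using ih (M₂.inputAlphabet.symm x :: S₂))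
      refine congrArg some ((stepAux_transferStmt_cons M₁.tm.k₁ M₂.tm.k₀ M₁.outputAlphabet
        M₂.inputAlphabet M₂.tm.main _ _ _ _ x (b.map M₁.outputAlphabet.symm)
        (Function.update_self ..)).trans ?_)
      rw [Function.update_idem, Function.update_idem, Function.update_self]
      rfl
  have fst := h₁.map (g := (M₁.compReverse M₂).tm.step)
    (liftFstCfg (Γ₂ := M₂.tm.Γ) (Λ₂ := M₂.tm.Λ) (M₂.tm.initialState, (none : Option B))
      (fun _ => [])) ?_
  have snd := h₂.map (g := (M₁.compReverse M₂).tm.step)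
    (liftSndCfg (Γ₁ := M₁.tm.Γ) (Λ₁ := M₁.tm.Λ) M₁.tm.initialState (none : Option B)
      (fun _ => [])) ?_
  · have mid := transfer b []
    rw [List.append_nil] at mid
    refine StepsTo.trans (StepsTo.trans (fst.congr ?_ ?_) mid) (snd.congr ?_ ?_)
    · exact congrArg (fun S => (⟨some (CompLabel.fst M₁.tm.main),
        (M₁.tm.initialState, M₂.tm.initialState, none), S⟩ :
          TM2.Cfg (Sum.elim M₁.tm.Γ M₂.tm.Γ) (CompLabel M₁.tm.Λ M₂.tm.Λ)
            (M₁.tm.σ × M₂.tm.σ × Option B)))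
        (((congrArg (fun S => joinStacks S _) (stk_initList M₁.tm _)).trans
          (update_joinStacks_inl _ _ _ _).symm).trans
          ((congrArg (fun S => Function.update S _ _) joinStacks_nil).trans
            (stk_initList (M₁.compReverse M₂).tm _).symm))
    · exact congrArg (fun S => (⟨some CompLabel.transfer,
        (M₁.tm.initialState, M₂.tm.initialState, none), S⟩ :
          TM2.Cfg (Sum.elim M₁.tm.Γ M₂.tm.Γ) (CompLabel M₁.tm.Λ M₂.tm.Λ)
            (M₁.tm.σ × M₂.tm.σ × Option B)))
        (congrArg₂ joinStacks (stk_haltList M₁.tm _)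
          (Function.update_eq_self M₂.tm.k₀ (fun k => ([] : List (M₂.tm.Γ k)))).symm)
    · exact congrArg (fun S => (⟨some (CompLabel.snd M₂.tm.main),
        (M₁.tm.initialState, M₂.tm.initialState, none), S⟩ :
          TM2.Cfg (Sum.elim M₁.tm.Γ M₂.tm.Γ) (CompLabel M₁.tm.Λ M₂.tm.Λ)
            (M₁.tm.σ × M₂.tm.σ × Option B)))
        (congrArg (joinStacks _) (stk_initList M₂.tm _))
    · exact congrArg (fun S => (⟨none,
        (M₁.tm.initialState, M₂.tm.initialState, none), S⟩ :
          TM2.Cfg (Sum.elim M₁.tm.Γ M₂.tm.Γ) (CompLabel M₁.tm.Λ M₂.tm.Λ)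
            (M₁.tm.σ × M₂.tm.σ × Option B)))
        (((congrArg (joinStacks _) (stk_haltList M₂.tm _)).trans
          (update_joinStacks_inr _ _ _ _).symm).trans
          ((congrArg (fun S => Function.update S _ _) joinStacks_nil).trans
            (stk_haltList (M₁.compReverse M₂).tm _).symm))
  · rintro ⟨l, v, S⟩ b h
    cases l with
    | none => cases h
    | some l =>
      cases h
      exact congrArg some (stepAux_liftSnd M₁.tm.initialState (none : Option B) (fun _ => [])
        (M₂.tm.m l) v S)
  · rintro ⟨l, v, S⟩ b h
    cases l with
    | none => cases h
    | some l =>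
      cases h
      exact congrArg some (stepAux_liftFst (M₂.tm.initialState, (none : Option B)) (fun _ => [])
        (M₁.tm.m l) v S)

end

end Turing

open Turing

theorem eval_nat_mono (p : Polynomial ℕ) {a b : ℕ} (h : a ≤ b) : p.eval a ≤ p.eval b := by
  rw [Polynomial.eval_eq_sum_range, Polynomial.eval_eq_sum_range]
  exact Finset.sum_le_sum fun i _ => Nat.mul_le_mul_left _ (Nat.pow_le_pow_left h i)

/-- A factor of the argument can be pulled out of a polynomial, at the cost of a power. -/
theorem eval_nat_mul_le (p : Polynomial ℕ) {a : ℕ} (ha : 1 ≤ a) (b : ℕ) :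
    p.eval (a * b) ≤ a ^ p.natDegree * p.eval b := by
  rw [Polynomial.eval_eq_sum_range, Polynomial.eval_eq_sum_range, Finset.mul_sum]
  refine Finset.sum_le_sum fun i hi => ?_
  rw [mul_pow, mul_left_comm]
  exact Nat.mul_le_mul_right _
    (Nat.pow_le_pow_right ha (Nat.lt_succ_iff.1 (Finset.mem_range.1 hi)))

theorem primrec_pow_const (m : ℕ) : Primrec fun x : ℕ => x ^ m := by
  induction m with
  | zero => simpa using Primrec.const 1
  | succ m ih =>
    simp only [pow_succ]
    exact Primrec.nat_mul.comp ih Primrec.id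

/-- An fpt-reduction can be followed by a many-one reduction that a stack machine computes in
polynomial time, even if that machine expects its input in reversed order. The parameter only has to
grow by a computable monotone function. The intermediate word can be read off from the stacks of the
first machine, so its length is at most linear in the time that was spent on it. -/
theorem FPTReducible.trans_of_polyTime {Q P R : ParamProblem} [Inhabited P.Letter]
    [Fintype P.Letter] (h : FPTReducible Q P) (f : P.Inst → R.Inst)
    (hf : ∀ x, P.Yes x ↔ R.Yes (f x)) (M : TM2ComputableAux P.Letter R.Letter)
    (p : Polynomial ℕ)
    (hM : ∀ x, Nonempty (TM2OutputsInTime M.tm ((P.encode x).reverse.map M.inputAlphabet.symm)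
      (some ((R.encode (f x)).map M.outputAlphabet.symm)) (p.eval (P.encode x).length)))
    (g : ℕ → ℕ) (hg : Computable g) (hmono : Monotone g)
    (hparam : ∀ x, R.param (f x) ≤ g (P.param x)) : FPTReducible Q R := by
  obtain ⟨f₁, hf₁, ⟨M₁, F, p₁, hF, hM₁⟩, g₁, hg₁, hparam₁⟩ := h
  refine ⟨f ∘ f₁, fun x => (hf₁ x).trans (hf _), ?_, g ∘ g₁, hg.comp hg₁,
    fun x => (hparam _).trans (hmono (hparam₁ x))⟩
  let _ := M₁.tm.ΛFin
  obtain ⟨C, hC⟩ : ∃ C, ∀ l, (M₁.tm.m l).pushes ≤ C :=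
    ⟨Finset.univ.sup fun l => (M₁.tm.m l).pushes, fun l =>
      Finset.le_sup (f := fun l => (M₁.tm.m l).pushes) (Finset.mem_univ l)⟩
  -- up to a factor that depends on the parameter only, `Y` bounds the length of the intermediate
  -- word; that factor leaves `p` as a power
  let Y : Polynomial ℕ := Polynomial.C C * p₁ + Polynomial.X + 1
  refine ⟨M₁.compReverse M, fun κ => (F κ + 1) ^ (p.natDegree + 1), p₁ + Y + p.comp Y, ?_, ?_⟩
  · exact ((primrec_pow_const _).comp Primrec.succ).to_comp.comp hF
  intro x
  obtain ⟨⟨⟨t₁, h₁⟩, ht₁⟩⟩ := hM₁ x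
  obtain ⟨⟨⟨t₂, h₂⟩, ht₂⟩⟩ := hM (f₁ x)
  dsimp only at ht₁ ht₂
  refine ⟨⟨⟨_, M₁.compReverse_stepsTo M h₁ h₂⟩, ?_⟩⟩
  set n := (Q.encode x).length
  set b := P.encode (f₁ x)
  set κ := Q.param x
  have hb : b.length ≤ n + C * t₁ := by
    have := TM2.length_stepsTo_le M₁.tm.m C hC h₁ M₁.tm.k₁
    rw [stk_haltList, Function.update_self, List.length_map, stk_initList] at this
    refine this.trans (Nat.add_le_add_right ?_ _)
    by_cases hk : M₁.tm.k₁ = M₁.tm.k₀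
    · rw [hk, Function.update_self, List.length_map]
    · rw [Function.update_of_ne hk]; simp
  have hY : Y.eval n = C * p₁.eval n + n + 1 := by simp [Y]
  set A := F κ + 1
  have hA : 1 ≤ A := Nat.le_add_left ..
  have ht₁' : t₁ ≤ A * p₁.eval n := ht₁.trans (Nat.mul_le_mul_right _ (Nat.le_succ _))
  have hb' : b.length + 1 ≤ A * Y.eval n := by
    rw [hY]
    nlinarith [Nat.mul_le_mul_left C ht₁', Nat.mul_le_mul_right (n + 1) hA]
  have ht₂' : t₂ ≤ A ^ p.natDegree * p.eval (Y.eval n) :=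
    ht₂.trans ((eval_nat_mono p (by omega)).trans (eval_nat_mul_le p hA _))
  have hA1 : A ≤ A ^ (p.natDegree + 1) := Nat.le_self_pow (by omega) A
  have hA2 : A ^ p.natDegree ≤ A ^ (p.natDegree + 1) := Nat.pow_le_pow_right hA (by omega)
  simp only [Polynomial.eval_add, Polynomial.eval_comp, mul_add]
  refine add_le_add (add_le_add ?_ ?_) ?_
  · exact ht₁'.trans (Nat.mul_le_mul_right _ hA1)
  · exact hb'.trans ((Nat.mul_le_mul_right _ hA1).trans
      (by rw [Polynomial.eval_add, Polynomial.eval_add]))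
  · exact ht₂'.trans (Nat.mul_le_mul_right _ hA2)

/-! ### Structured programs on stacks -/

open Turing

/-- Programs that work on stacks of letters `none`, `some false`, `some true`, with one stack for
every natural number. -/
inductive Prog
  /-- Push the letter `a` on the stack `r`. -/
  | push (r : ℕ) (a : Option Bool)
  /-- Remove the top of the stack `r`, if there is one. -/
  | pop (r : ℕ)
  /-- Move the top of the stack `r`, if there is one, to the stack `q`. -/
  | move (r q : ℕ)
  | seq (p p' : Prog)
  /-- Run `p` if the top of the stack `r` is `a`, and otherwise `p'`. -/
  | ifTop (r : ℕ) (a : Option Bool) (p p' : Prog)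
  /-- Repeat `p` as long as the stack `r` is not empty. -/
  | while (r : ℕ) (p : Prog)

namespace Prog

/-- The contents of the stacks. -/
abbrev Stacks := ℕ → List (Option Bool)

/-- `Exec p s t s'`: the program `p` takes the stacks from `s` to `s'` in exactly `t` steps. -/
inductive Exec : Prog → Stacks → ℕ → Stacks → Prop
  | push (r a s) : Exec (push r a) s 1 (Function.update s r (a :: s r))
  | pop (r s) : Exec (pop r) s 1 (Function.update s r (s r).tail)
  | move_nil {r q s} (h : s r = []) : Exec (move r q) s 1 s
  | move_cons {r q s a l} (h : s r = a :: l) : Exec (move r q) s 1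
      (Function.update (Function.update s r l) q (a :: Function.update s r l q))
  | seq {p p' s t s' t' s''} (h : Exec p s t s') (h' : Exec p' s' t' s'') :
      Exec (seq p p') s (t + t') s''
  | ifTop_pos {r a p p' s t s'} (h : (s r).head? = some a) (h' : Exec p s t s') :
      Exec (ifTop r a p p') s (t + 1) s'
  | ifTop_neg {r a p p' s t s'} (h : (s r).head? ≠ some a) (h' : Exec p' s t s') :
      Exec (ifTop r a p p') s (t + 1) s'
  | while_nil {r p s} (h : s r = []) : Exec (.while r p) s 1 s
  | while_step {r p s t s' t' s''} (h : s r ≠ []) (h' : Exec p s t s')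
      (h'' : Exec (.while r p) s' t' s'') : Exec (.while r p) s (t + t' + 1) s''

/-- A strict upper bound for the stacks that a program uses. -/
def width : Prog → ℕ
  | push r _ => r + 1
  | pop r => r + 1
  | move r q => max r q + 1
  | seq p p' => max p.width p'.width
  | ifTop r _ p p' => max (r + 1) (max p.width p'.width)
  | .while r p => max (r + 1) p.width

/-- The labels of the machine that runs a program, except the one at which it exits. -/
def Label : Prog → Type
  | push _ _ => Unit
  | pop _ => Unit
  | move _ _ => Unit
  | seq p p' => p.Label ⊕ p'.Label
  | ifTop _ _ p p' => Option (p.Label ⊕ p'.Label)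
  | .while _ p => Option p.Label

instance fintypeLabel : (p : Prog) → Fintype p.Label
  | push _ _ => inferInstanceAs (Fintype Unit)
  | pop _ => inferInstanceAs (Fintype Unit)
  | move _ _ => inferInstanceAs (Fintype Unit)
  | seq p p' =>
    let _ := fintypeLabel p
    let _ := fintypeLabel p'
    inferInstanceAs (Fintype (p.Label ⊕ p'.Label))
  | ifTop _ _ p p' =>
    let _ := fintypeLabel p
    let _ := fintypeLabel p'
    inferInstanceAs (Fintype (Option (p.Label ⊕ p'.Label)))
  | .while _ p =>
    let _ := fintypeLabel p
    inferInstanceAs (Fintype (Option p.Label))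

/-- The label at which a program starts. -/
def entry : (p : Prog) → p.Label
  | push _ _ => ()
  | pop _ => ()
  | move _ _ => ()
  | seq p _ => Sum.inl p.entry
  | ifTop _ _ _ _ => none
  | .while _ _ => none

/-- The stack of a machine with `n + 1` stacks that stands for `r`. -/
def stackIndex (n r : ℕ) : Fin (n + 1) := Fin.ofNat (n + 1) r

/-- The statements of a machine with `n + 1` stacks that run a program, if its labels are embedded
by `e` into those of the machine, and if it has to exit at the label `x`. The internal state of the
machine is the letter that has been read last; it is reset at the end of every statement. -/
def code (n : ℕ) {Λ : Type} : (p : Prog) → (p.Label → Λ) → Λ → p.Label →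
    TM2.Stmt (fun _ : Fin (n + 1) => Option Bool) Λ (Option (Option Bool))
  | push r a, _, x, _ => .push (stackIndex n r) (fun _ => a) <| .goto fun _ => x
  | pop r, _, x, _ => .pop (stackIndex n r) (fun v _ => v) <| .goto fun _ => x
  | move r q, _, x, _ => .pop (stackIndex n r) (fun _ b => b) <|
      .branch Option.isSome
        (.push (stackIndex n q) (fun v => v.getD none) <| .load (fun _ => none) <| .goto fun _ => x)
        (.goto fun _ => x)
  | seq p p', e, _, .inl l => code n p (e ∘ Sum.inl) (e (.inr p'.entry)) l
  | seq _ p', e, x, .inr l => code n p' (e ∘ Sum.inr) x l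
  | ifTop r a p p', e, _, none => .peek (stackIndex n r) (fun _ b => b) <|
      .branch (fun v => v = some a)
        (.load (fun _ => none) <| .goto fun _ => e (some (.inl p.entry)))
        (.load (fun _ => none) <| .goto fun _ => e (some (.inr p'.entry)))
  | ifTop _ _ p _, e, x, some (.inl l) => code n p (e ∘ some ∘ Sum.inl) x l
  | ifTop _ _ _ p', e, x, some (.inr l) => code n p' (e ∘ some ∘ Sum.inr) x l
  | .while r p, e, x, none => .peek (stackIndex n r) (fun _ b => b) <|
      .branch Option.isSome
        (.load (fun _ => none) <| .goto fun _ => e (some p.entry))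
        (.goto fun _ => x)
  | .while _ p, e, _, some l => code n p (e ∘ some) (e none) l

/-- The first `n + 1` of the stacks. -/
def restrictStacks (n : ℕ) (s : Stacks) : Fin (n + 1) → List (Option Bool) := fun i => s i

theorem restrictStacks_stackIndex {n r : ℕ} (s : Stacks) (h : r < n + 1) :
    restrictStacks n s (stackIndex n r) = s r := by
  simp [restrictStacks, stackIndex, Nat.mod_eq_of_lt h]

theorem update_restrictStacks {n r : ℕ} (s : Stacks) (h : r < n + 1) (l : List (Option Bool)) :
    Function.update (restrictStacks n s) (stackIndex n r) l =
      restrictStacks n (Function.update s r l) := by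
  funext i
  by_cases hi : (i : ℕ) = r
  · have : i = stackIndex n r := Fin.ext (by simp [stackIndex, hi, Nat.mod_eq_of_lt h])
    subst this
    rw [restrictStacks_stackIndex _ h]; simp
  · have : i ≠ stackIndex n r := fun h' => hi (by simp [stackIndex, h', Nat.mod_eq_of_lt h])
    rw [Function.update_of_ne this]
    simp [restrictStacks, Function.update_of_ne hi]

/-- A machine with the code of a program runs the program. -/
theorem Exec.stepsTo {n : ℕ} {Λ : Type}
    (M : Λ → TM2.Stmt (fun _ : Fin (n + 1) => Option Bool) Λ (Option (Option Bool)))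
    {p : Prog} {s s' : Stacks} {t : ℕ} (h : Exec p s t s') (hp : p.width ≤ n + 1)
    (e : p.Label → Λ) (x : Λ) (hM : ∀ l, M (e l) = code n p e x l) :
    StepsTo (TM2.step M) t ⟨some (e p.entry), none, restrictStacks n s⟩
      ⟨some x, none, restrictStacks n s'⟩ := by
  induction h generalizing x with
  | push r a s =>
    simp only [width] at hp
    refine StepsTo.single ?_
    simp only [TM2.step, hM]
    simp [code, restrictStacks_stackIndex, update_restrictStacks, show r < n + 1 by omega]
  | pop r s =>
    simp only [width] at hp
    refine StepsTo.single ?_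
    simp only [TM2.step, hM]
    simp [code, restrictStacks_stackIndex, update_restrictStacks, show r < n + 1 by omega]
  | @move_nil r q s h =>
    simp only [width] at hp
    refine StepsTo.single ?_
    have hr : r < n + 1 := by omega
    have hs : Function.update s r [] = s := by rw [← h, Function.update_eq_self]
    simp only [TM2.step, hM]
    simp [code, restrictStacks_stackIndex _ hr, h, update_restrictStacks _ hr, hs]
  | @move_cons r q s a l h =>
    simp only [width] at hp
    refine StepsTo.single ?_
    have hr : r < n + 1 := by omega
    have hq : q < n + 1 := by omega
    simp only [TM2.step, hM]
    simp [code, restrictStacks_stackIndex _ hr, h,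
      update_restrictStacks _ hr, update_restrictStacks _ hq, restrictStacks_stackIndex _ hq]
  | @seq p p' s t s' t' s'' h h' ih ih' =>
    simp only [width] at hp
    exact (ih (by omega) _ _ fun l => hM (.inl l)).trans (ih' (by omega) _ _ fun l => hM (.inr l))
  | @ifTop_pos r a p p' s t s' h h' ih =>
    simp only [width] at hp
    refine StepsTo.head ?_ (ih (by omega) _ _ fun l => hM (some (.inl l)))
    have hr : r < n + 1 := by omega
    simp only [TM2.step, hM]
    simp [entry, code, restrictStacks_stackIndex _ hr, h]
  | @ifTop_neg r a p p' s t s' h h' ih =>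
    simp only [width] at hp
    refine StepsTo.head ?_ (ih (by omega) _ _ fun l => hM (some (.inr l)))
    have hr : r < n + 1 := by omega
    simp only [TM2.step, hM]
    simp [entry, code, restrictStacks_stackIndex _ hr, h]
  | @while_nil r p s h =>
    simp only [width] at hp
    refine StepsTo.single ?_
    have hr : r < n + 1 := by omega
    simp only [TM2.step, hM]
    simp [entry, code, restrictStacks_stackIndex _ hr, h]
  | @while_step r p s t s' t' s'' h h' h'' ih ih' =>
    have hp' := hp
    simp only [width] at hp
    refine StepsTo.head ?_ ((ih (by omega) _ _ fun l => hM (some l)).trans (ih' hp' _ _ hM))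
    have hr : r < n + 1 := by omega
    obtain ⟨a, l, h⟩ := List.exists_cons_of_ne_nil h
    simp only [TM2.step, hM]
    simp [entry, code, restrictStacks_stackIndex _ hr, h]

/-- The stack machine that runs a program, with input on the stack `0` and output on the stack `1`.
There are two stacks more than necessary, so that the stack `1` exists for every program. -/
def machine (p : Prog) : TM2ComputableAux (Option Bool) (Option Bool) where
  tm :=
    { K := Fin (p.width + 1 + 1)
      k₀ := 0
      k₁ := 1
      Γ := fun _ => Option Bool
      Λ := Option p.Label
      main := some p.entry
      σ := Option (Option Bool)
      initialState := none
      Γk₀Fin := inferInstanceAs (Fintype (Option Bool))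
      m
        | none => .halt
        | some l => code (p.width + 1) p some none l }
  inputAlphabet := Equiv.refl _
  outputAlphabet := Equiv.refl _

theorem Exec.machine_outputs {p : Prog} {w w' : List (Option Bool)} {t : ℕ}
    (h : Exec p (Function.update (fun _ => []) 0 w) t (Function.update (fun _ => []) 1 w')) :
    StepsTo p.machine.tm.step (t + 1)
      (initList p.machine.tm (w.map p.machine.inputAlphabet.symm))
      (haltList p.machine.tm (w'.map p.machine.outputAlphabet.symm)) := by
  have h1 := h.stepsTo p.machine.tm.m (n := p.width + 1) (by omega) some none fun _ => rfl
  have h2 : ∀ (r : ℕ) (l : List (Option Bool)), r < p.width + 1 + 1 →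
      restrictStacks (p.width + 1) (Function.update (fun _ => []) r l) =
        Function.update (fun _ => []) (stackIndex (p.width + 1) r) l := fun r l hr =>
    (update_restrictStacks (fun _ => []) hr l).symm
  rw [h2 0 _ (by omega), h2 1 _ (by omega)] at h1
  refine (h1.trans (t := 1) (StepsTo.single rfl)).congr ?_ ?_
  · refine congrArg (fun S => (⟨some (some p.entry), none, S⟩ :
      TM2.Cfg (fun _ : Fin (p.width + 1 + 1) => Option Bool) (Option p.Label)
        (Option (Option Bool)))) ((stk_initList p.machine.tm _).trans ?_).symm
    exact congrArg (Function.update _ _) (List.map_id w)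
  · refine congrArg (fun S => (⟨none, none, S⟩ :
      TM2.Cfg (fun _ : Fin (p.width + 1 + 1) => Option Bool) (Option p.Label)
        (Option (Option Bool)))) ((stk_haltList p.machine.tm _).trans ?_).symm
    exact congrArg (Function.update _ _) (List.map_id w')

end Prog

/-! ### Arithmetic expressions over a word -/

namespace Prog

/-- The program `p` takes the stacks from `s` to `s'` in at most `T` steps. -/
def Runs (p : Prog) (s s' : Stacks) (T : ℕ) : Prop := ∃ t ≤ T, Exec p s t s'

theorem Runs.mono {p : Prog} {s s' : Stacks} {T T' : ℕ} (h : Runs p s s' T) (hT : T ≤ T') :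
    Runs p s s' T' := by
  obtain ⟨t, ht, h⟩ := h
  exact ⟨t, ht.trans hT, h⟩

theorem Runs.congr {p : Prog} {s s' s'' : Stacks} {T : ℕ} (h : Runs p s s' T) (hs : s' = s'') :
    Runs p s s'' T := hs ▸ h

theorem Runs.seq {p p' : Prog} {s s' s'' : Stacks} {T T' : ℕ} (h : Runs p s s' T)
    (h' : Runs p' s' s'' T') : Runs (.seq p p') s s'' (T + T') := by
  obtain ⟨t, ht, h⟩ := h
  obtain ⟨t', ht', h'⟩ := h'
  exact ⟨_, add_le_add ht ht', h.seq h'⟩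

theorem Runs.push (r : ℕ) (a : Option Bool) (s : Stacks) :
    Runs (.push r a) s (Function.update s r (a :: s r)) 1 := ⟨1, le_rfl, .push ..⟩

theorem Runs.pop (r : ℕ) (s : Stacks) :
    Runs (.pop r) s (Function.update s r (s r).tail) 1 := ⟨1, le_rfl, .pop ..⟩

theorem Runs.while_nil {r : ℕ} {p : Prog} {s : Stacks} (h : s r = []) : Runs (.while r p) s s 1 :=
  ⟨1, le_rfl, .while_nil h⟩

theorem Runs.while_step {r : ℕ} {p : Prog} {s s' s'' : Stacks} {T T' : ℕ} (h : s r ≠ [])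
    (h' : Runs p s s' T) (h'' : Runs (.while r p) s' s'' T') :
    Runs (.while r p) s s'' (T + T' + 1) := by
  obtain ⟨t, ht, h'⟩ := h'
  obtain ⟨t', ht', h''⟩ := h''
  exact ⟨_, by omega, .while_step h h' h''⟩

theorem Runs.move {r q : ℕ} (hrq : r ≠ q) (s : Stacks) :
    Runs (.move r q) s (Function.update (Function.update s r (s r).tail) q
      ((s r).head?.toList ++ s q)) 1 := by
  refine ⟨1, le_rfl, ?_⟩
  cases h : s r with
  | nil =>
    convert Exec.move_nil h using 1
    simp only [List.tail_nil, List.head?_nil, Option.toList_none, List.nil_append]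
    rw [← h, Function.update_eq_self, Function.update_eq_self]
  | cons a l =>
    convert Exec.move_cons h using 1
    simp [Function.update_of_ne hrq.symm]

theorem runs_clear (r : ℕ) (s : Stacks) :
    Runs (.while r (.pop r)) s (Function.update s r []) (2 * (s r).length + 1) := by
  induction h : s r generalizing s with
  | nil =>
    refine (Runs.while_nil h).congr ?_
    rw [← h, Function.update_eq_self]
  | cons a l ih =>
    refine (Runs.while_step (by simp [h]) (Runs.pop r s)
      ((ih _ (by simp [h])).congr (Function.update_idem ..))).mono ?_
    simp only [List.length_cons]; omega

theorem runs_moveAll {r q : ℕ} (hrq : r ≠ q) (s : Stacks) :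
    Runs (.while r (.move r q)) s
      (Function.update (Function.update s r []) q ((s r).reverse ++ s q))
      (2 * (s r).length + 1) := by
  induction h : s r generalizing s with
  | nil =>
    refine (Runs.while_nil h).congr ?_
    funext x
    simp only [Function.update_apply]
    split_ifs <;> simp_all
  | cons a l ih =>
    refine (Runs.while_step (by simp [h]) (Runs.move hrq s)
      ((ih _ (by simp [h, Function.update_of_ne hrq])).congr ?_)).mono ?_
    · funext x
      simp only [Function.update_apply]
      split_ifs <;> simp_all
    · simp only [List.length_cons]; omega

theorem runs_moveAll_count {r q d : ℕ} (hrq : r ≠ q) (hrd : r ≠ d) (hqd : q ≠ d) (s : Stacks) :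
    Runs (.while r (.seq (.move r q) (.push d none))) s
      (Function.update (Function.update (Function.update s r []) q ((s r).reverse ++ s q)) d
        (List.replicate (s r).length none ++ s d))
      (3 * (s r).length + 1) := by
  induction h : s r generalizing s with
  | nil =>
    refine (Runs.while_nil h).congr ?_
    funext x
    simp only [Function.update_apply]
    split_ifs <;> simp_all
  | cons a l ih =>
    refine (Runs.while_step (by simp [h]) ((Runs.move hrq s).seq (Runs.push d none _))
      ((ih _ (by simp [h, Function.update_of_ne hrq, Function.update_of_ne hrd])).congr ?_)).mono ?_
    · funext x
      simp only [Function.update_apply]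
      split_ifs <;> simp_all [List.replicate_succ']
    · simp only [List.length_cons]; omega

theorem runs_subtract {r q : ℕ} (hrq : r ≠ q) (s : Stacks) :
    Runs (.while r (.seq (.pop r) (.pop q))) s
      (Function.update (Function.update s r []) q ((s q).drop (s r).length))
      (3 * (s r).length + 1) := by
  induction h : s r generalizing s with
  | nil =>
    refine (Runs.while_nil h).congr ?_
    funext x
    simp only [Function.update_apply]
    split_ifs <;> simp_all
  | cons a l ih =>
    refine (Runs.while_step (by simp [h]) ((Runs.pop r s).seq (Runs.pop q _))
      ((ih _ (by simp [h, Function.update_of_ne hrq])).congr ?_)).mono ?_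
    · funext x
      simp only [Function.update_apply]
      split_ifs <;> simp_all
    · simp only [List.length_cons]; omega

theorem runs_advance {r q d : ℕ} (hrq : r ≠ q) (hrd : r ≠ d) (hqd : q ≠ d) (s : Stacks) :
    Runs (.while r (.seq (.pop r) (.move q d))) s
      (Function.update (Function.update (Function.update s r []) q ((s q).drop (s r).length)) d
        (((s q).take (s r).length).reverse ++ s d))
      (3 * (s r).length + 1) := by
  induction h : s r generalizing s with
  | nil =>
    refine (Runs.while_nil h).congr ?_
    funext x
    simp only [Function.update_apply]
    split_ifs <;> simp_all
  | cons a l ih =>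
    refine (Runs.while_step (by simp [h]) ((Runs.pop r s).seq (Runs.move hqd _))
      ((ih _ (by simp [h, Function.update_of_ne hrq, Function.update_of_ne hrd])).congr ?_)).mono ?_
    · funext x
      simp only [Function.update_apply]
      split_ifs <;> simp_all
      cases s q <;> simp
    · simp only [List.length_cons]; omega

end Prog

/-- Arithmetic expressions over a word, with de Bruijn indices. Their values are bounded by
polynomials, and so is the time that it takes to evaluate them in unary. -/
inductive Ex
  | var (i : ℕ)
  | one
  | add (a b : Ex)
  /-- Truncated subtraction. -/
  | sub (a b : Ex)
  /-- The sum of `b` over all values less than `a` of a new variable `0`. -/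
  | sum (a b : Ex)
  /-- `1` if the letter of the word at the position `a` is `c`, and otherwise `0`. -/
  | letter (c : Option Bool) (a : Ex)
  /-- The length of the word. -/
  | len

/-- Variable assignments. -/
abbrev Env := ℕ → ℕ

/-- The assignment with a new variable `0` of value `i`. -/
def Env.cons (i : ℕ) (env : Env) : Env
  | 0 => i
  | j + 1 => env j

namespace Ex

open Prog

/-- The value of an expression. -/
def eval (w : List (Option Bool)) : Env → Ex → ℕ
  | env, var i => env i
  | _, one => 1
  | env, add a b => a.eval w env + b.eval w env
  | env, sub a b => a.eval w env - b.eval w env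
  | env, sum a b => ∑ i ∈ Finset.range (a.eval w env), b.eval w (env.cons i)
  | env, letter c a => if w[a.eval w env]? = some c then 1 else 0
  | _, len => w.length

theorem exists_eval_le (e : Ex) : ∃ p : Polynomial ℕ, ∀ w env B, w.length ≤ B → (∀ i, env i ≤ B) →
    e.eval w env ≤ p.eval B := by
  induction e with
  | var i => exact ⟨.X, fun w env B _ h => by simpa [eval] using h i⟩
  | one => exact ⟨1, fun w env B _ h => by simp [eval]⟩
  | add a b iha ihb =>
    obtain ⟨p, hp⟩ := iha
    obtain ⟨q, hq⟩ := ihb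
    exact ⟨p + q, fun w env B hw h => by
      simpa [eval] using add_le_add (hp w env B hw h) (hq w env B hw h)⟩
  | sub a b iha ihb =>
    obtain ⟨p, hp⟩ := iha
    exact ⟨p, fun w env B hw h => (Nat.sub_le ..).trans (hp w env B hw h)⟩
  | sum a b iha ihb =>
    obtain ⟨p, hp⟩ := iha
    obtain ⟨q, hq⟩ := ihb
    refine ⟨p * q.comp (.X + p), fun w env B hw h => ?_⟩
    have ha := hp w env B hw h
    simp only [eval, Polynomial.eval_mul, Polynomial.eval_comp, Polynomial.eval_add,
      Polynomial.eval_X]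
    refine (Finset.sum_le_card_nsmul _ _ (q.eval (B + p.eval B)) fun i hi => ?_).trans ?_
    · refine hq w _ _ (by omega) fun j => ?_
      cases j with
      | zero => have := Finset.mem_range.1 hi; simp only [Env.cons]; omega
      | succ j => have := h j; simp only [Env.cons]; omega
    · simpa using Nat.mul_le_mul_right _ ha
  | letter c a iha => exact ⟨1, fun w env B _ h => by simp only [eval]; split_ifs <;> simp⟩
  | len => exact ⟨.X, fun w env B hw h => by simpa [eval] using hw⟩

/-- A program that adds the value of an expression to the stack `d`, in unary. The word is expected
on the stack `2`, the value of the variable `i` in unary on the stack `v i`, and the stacks from `m`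
on are free. All of them are restored in the end.

For a sum, the stack `m` counts the remaining values of the new variable, whose current value is on
the stack `m + 1`. For a letter, the beginning of the word is put aside on the stack `m + 1`, in
order to look at the next letter; to pop the stack `m` when it is empty means to do nothing. -/
def prog : Ex → (v : ℕ → ℕ) → (d m : ℕ) → Prog
  | var i, v, d, m =>
    .seq (.while (v i) (.move (v i) m)) (.while m (.seq (.move m (v i)) (.push d none)))
  | one, _, d, _ => .push d none
  | add a b, v, d, m => .seq (a.prog v d m) (b.prog v d m)
  | sub a b, v, d, m => .seq (a.prog v m (m + 1)) <| .seq (b.prog v (m + 1) (m + 2)) <|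
      .seq (.while (m + 1) (.seq (.pop (m + 1)) (.pop m))) (.while m (.move m d))
  | sum a b, v, d, m => .seq (a.prog v m (m + 1)) <|
      .seq (.while m (.seq (.pop m) (.seq (b.prog (Env.cons (m + 1) v) d (m + 2))
        (.push (m + 1) none)))) (.while (m + 1) (.pop (m + 1)))
  | letter c a, v, d, m => .seq (a.prog v m (m + 1)) <|
      .seq (.while m (.seq (.pop m) (.move 2 (m + 1)))) <|
      .seq (.ifTop 2 c (.push d none) (.pop m)) (.while (m + 1) (.move (m + 1) 2))
  | len, _, d, m => .seq (.while 2 (.move 2 m)) (.while m (.seq (.move m 2) (.push d none)))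

/-- The situation in which `Ex.prog` can be run. The variables may share stacks. -/
structure Ready (w : List (Option Bool)) (env : Env) (v : ℕ → ℕ) (d m : ℕ) (s : Stacks) : Prop where
  word : s 2 = w
  var : ∀ i, s (v i) = List.replicate (env i) none
  free : ∀ x, m ≤ x → s x = []
  d_lt : d < m
  two_lt : 2 < m
  d_ne : d ≠ 2
  var_lt : ∀ i, v i < m
  var_ne : ∀ i, v i ≠ d

theorem Ready.update {w : List (Option Bool)} {env : Env} {v : ℕ → ℕ} {d m : ℕ} {s : Stacks}
    (h : Ready w env v d m s) (l : List (Option Bool)) :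
    Ready w env v d m (Function.update s d l) where
  word := by rw [Function.update_of_ne h.d_ne.symm, h.word]
  var i := by rw [Function.update_of_ne (h.var_ne i), h.var]
  free x hx := by rw [Function.update_of_ne (by have := h.d_lt; omega), h.free x hx]
  d_lt := h.d_lt
  two_lt := h.two_lt
  d_ne := h.d_ne
  var_lt := h.var_lt
  var_ne := h.var_ne

/-- The result can also go to the first free stack. -/
theorem Ready.shift {w : List (Option Bool)} {env : Env} {v : ℕ → ℕ} {d m : ℕ} {s : Stacks}
    (h : Ready w env v d m s) : Ready w env v m (m + 1) s where
  word := h.word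
  var := h.var
  free x hx := h.free x (by omega)
  d_lt := by omega
  two_lt := by have := h.two_lt; omega
  d_ne := by have := h.two_lt; omega
  var_lt i := by have := h.var_lt i; omega
  var_ne i := by have := h.var_lt i; omega

/-- The stacks after an evaluation with value `n`. -/
abbrev addTo (s : Stacks) (d n : ℕ) : Stacks :=
  Function.update s d (List.replicate n none ++ s d)

/-- The programs are correct and run in polynomial time. -/
theorem exists_runs_prog (e : Ex) : ∃ p : Polynomial ℕ, ∀ w env v d m s B, w.length ≤ B →
    (∀ i, env i ≤ B) → Ready w env v d m s →
    Runs (e.prog v d m) s (addTo s d (e.eval w env)) (p.eval B) := by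
  induction e with
  | var i =>
    refine ⟨5 * .X + 2, fun w env v d m s B hw hB h => ?_⟩
    have h1 := h.var_lt i
    have h2 := h.var_ne i
    have h3 := h.d_lt
    have h4 := h.free m le_rfl
    have h5 := h.var i
    refine (((runs_moveAll (by omega) s).seq
      (runs_moveAll_count (r := m) (q := v i) (d := d) (by omega) (by omega) (by omega) _)).congr
        ?_).mono ?_
    · funext x
      simp only [Function.update_apply, h4, eval]
      grind
    · have := hB i
      simp [h.var i, h4]; omega
  | one =>
    refine ⟨1, fun w env v d m s B hw hB h => ?_⟩
    simpa [eval, prog, addTo] using Runs.push d none s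
  | add a b iha ihb =>
    obtain ⟨p, hp⟩ := iha
    obtain ⟨q, hq⟩ := ihb
    refine ⟨p + q, fun w env v d m s B hw hB h => ?_⟩
    rw [Polynomial.eval_add]
    refine ((hp w env v d m s B hw hB h).seq (hq w env v d m _ B hw hB (h.update _))).congr ?_
    grind [eval, List.replicate_append_replicate]
  | sub a b iha ihb =>
    obtain ⟨p, hp⟩ := iha
    obtain ⟨q, hq⟩ := ihb
    obtain ⟨p', hp'⟩ := exists_eval_le a
    obtain ⟨q', hq'⟩ := exists_eval_le b
    refine ⟨p + q + 3 * q' + 2 * p' + 2, fun w env v d m s B hw hB h => ?_⟩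
    have h1 := h.d_lt
    have h2 := h.free m le_rfl
    have h3 := h.free (m + 1) (by omega)
    have h4 := hp' w env B hw hB
    have h5 := hq' w env B hw hB
    refine (((hp w env v m (m + 1) s B hw hB h.shift).seq
      ((hq w env v (m + 1) (m + 2) _ B hw hB (h.shift.update _).shift).seq
      ((runs_subtract (by omega) _).seq (runs_moveAll (by omega) _)))).congr ?_).mono ?_
    · funext x
      simp only [Function.update_apply, h2, h3, eval]
      grind
    · simp [h2, h3]; omega
  | sum a b iha ihb =>
    obtain ⟨p, hp⟩ := iha
    obtain ⟨q, hq⟩ := ihb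
    obtain ⟨p', hp'⟩ := exists_eval_le a
    refine ⟨p + p' * (q.comp (.X + p') + 3) + 2 * p' + 2, fun w env v d m s B hw hB h => ?_⟩
    have h0 := h.d_lt
    have h2 := h.free m le_rfl
    have h3 := h.free (m + 1) (by omega)
    have h4 := hp' w env B hw hB
    set A := a.eval w env
    -- the stacks when the loop has still to be run `j` times
    let st : ℕ → Stacks := fun j => Function.update (Function.update
      (addTo s d (∑ i ∈ Finset.range (A - j), b.eval w (env.cons i))) m (List.replicate j none))
      (m + 1) (List.replicate (A - j) none)
    have loop : ∀ j ≤ A, Runs (.while m (.seq (.pop m) (.seq (b.prog (Env.cons (m + 1) v) d (m + 2))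
        (.push (m + 1) none)))) (st j) (st 0) (j * (q.eval (B + p'.eval B) + 3) + 1) := by
      intro j
      induction j with
      | zero =>
        intro _
        refine (Runs.while_nil ?_).mono (by simp)
        simp [st]
      | succ j ih =>
        intro hj
        refine (Runs.while_step (s' := st j) (T := 1 + (q.eval (B + p'.eval B) + 1)) ?_
          ((Runs.pop m _).seq (((hq w (env.cons (A - (j + 1))) _ d (m + 2) _ (B + p'.eval B)
            (by omega) ?_ ?_).seq (Runs.push _ _ _)).congr ?_)) (ih (by omega))).mono ?_
        · simp [st, List.replicate_succ]
        · rintro (_ | i)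
          · simp only [Env.cons]; omega
          · have := hB i
            simp only [Env.cons]; omega
        · have := h.two_lt
          constructor
          · have := h.word
            have := h.d_ne
            simp only [st, Function.update_apply]
            grind
          · rintro (_ | i)
            · simp [st, Env.cons]
            · have := h.var_lt i
              have := h.var_ne i
              have := h.var i
              simp only [st, Function.update_apply, Env.cons]
              grind
          · intro x hx
            have := h.free x (by omega)
            simp only [st, Function.update_apply]
            grind
          · omega
          · omega
          · exact h.d_ne
          · rintro (_ | i)
            · simp [Env.cons]
            · have := h.var_lt i
              simp only [Env.cons]; omega
          · rintro (_ | i)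
            · simp only [Env.cons]; omega
            · exact h.var_ne i
        · have h5 : A - j = A - (j + 1) + 1 := by omega
          funext x
          simp only [st, Function.update_apply, h5, Finset.sum_range_succ]
          generalize b.eval w (env.cons (A - (j + 1))) = z
          generalize ∑ i ∈ Finset.range (A - (j + 1)), b.eval w (env.cons i) = y
          generalize A - (j + 1) = k
          have e : List.replicate z none ++ (List.replicate y none ++ s d) =
              List.replicate (y + z) none ++ s d := by
            rw [← List.append_assoc, List.replicate_append_replicate, add_comm]
          clear * - e h0
          grind
        · ring_nf; omega
    have st_last : st A = addTo s m A := by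
      funext x
      simp only [st, Function.update_apply, Nat.sub_self, Finset.range_zero, Finset.sum_empty]
      clear * - h0 h2 h3
      grind
    refine (((hp w env v m (m + 1) s B hw hB h.shift).seq
      (Runs.seq (st_last ▸ loop A le_rfl) (runs_clear (m + 1) (st 0)))).congr ?_).mono ?_
    · have e : eval w env (sum a b) = ∑ i ∈ Finset.range A, b.eval w (env.cons i) := rfl
      rw [e]
      funext x
      simp only [st, Function.update_apply, Nat.sub_zero]
      clear * - h0 h2 h3
      grind
    · have := Nat.mul_le_mul_right (q.eval (B + p'.eval B) + 3) h4
      simp [st]; omega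
  | letter c a iha =>
    obtain ⟨p, hp⟩ := iha
    obtain ⟨p', hp'⟩ := exists_eval_le a
    refine ⟨p + 3 * p' + 2 * .X + 4, fun w env v d m s B hw hB h => ?_⟩
    have h0 := h.d_lt
    have h1 := h.two_lt
    have h2 := h.free m le_rfl
    have h3 := h.free (m + 1) (by omega)
    have h4 := hp' w env B hw hB
    have h5 := h.word
    have h6 := h.d_ne
    set A := a.eval w env
    have test : ∀ s' : Stacks, s' 2 = w.drop A → s' m = [] →
        Runs (.ifTop 2 c (.push d none) (.pop m)) s' (addTo s' d (eval w env (letter c a))) 2 := by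
      intro s' hs hm
      by_cases hc : w[A]? = some c
      · refine ⟨2, le_rfl, .ifTop_pos (t := 1) (by rw [hs, List.head?_drop, hc]) ?_⟩
        simpa [eval, A, hc, addTo] using Exec.push d none s'
      · refine ⟨2, le_rfl, .ifTop_neg (t := 1) (by rwa [hs, List.head?_drop]) ?_⟩
        have := Exec.pop m s'
        rw [hm, List.tail_nil, ← hm, Function.update_eq_self] at this
        simpa [eval, A, hc, addTo] using this
    refine (((hp w env v m (m + 1) s B hw hB h.shift).seq
      ((runs_advance (r := m) (q := 2) (d := m + 1) (by omega) (by omega) (by omega) _).seq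
      ((test _ ?_ ?_).seq (runs_moveAll (r := m + 1) (q := 2) (by omega) _)))).congr ?_).mono ?_
    · simp only [Function.update_apply]
      clear * - h1 h2 h5
      grind
    · simp only [Function.update_apply]
      grind
    · generalize eval w env (letter c a) = z
      have e := List.take_append_drop A w
      funext x
      simp only [Function.update_apply]
      clear * - h0 h1 h2 h3 h5 h6 e
      grind
    · have : (s 2).length ≤ B := by rw [h5]; exact hw
      simp [Function.update_apply, h2, h3, h5]
      grind
  | len =>
    refine ⟨5 * .X + 2, fun w env v d m s B hw hB h => ?_⟩
    have h1 := h.two_lt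
    have h2 := h.d_ne
    have h3 := h.d_lt
    have h4 := h.free m le_rfl
    have h5 := h.word
    refine (((runs_moveAll (by omega) s).seq
      (runs_moveAll_count (r := m) (q := 2) (d := d) (by omega) (by omega) (by omega) _)).congr
        ?_).mono ?_
    · funext x
      simp only [Function.update_apply, h4, eval]
      grind
    · simp [h.word, h4]; omega

end Ex

/-! ### Machines with a definable output -/

theorem encodeNats_cons (m : ℕ) (l : List ℕ) :
    encodeNats (m :: l) = (Computability.encodeNat m).map some ++ none :: encodeNats l := by
  simp [encodeNats]

theorem encodeNats_zero_cons (l : List ℕ) : encodeNats (0 :: l) = none :: encodeNats l :=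
  encodeNats_cons 0 l

theorem encodeNats_one_cons (l : List ℕ) :
    encodeNats (1 :: l) = some true :: none :: encodeNats l :=
  encodeNats_cons 1 l

namespace Ex

open Prog Turing

/-- The bits that an expression `b` defines at the values less than `n` of its variables. -/
def bits (w : List (Option Bool)) (b : Ex) (n : ℕ) : List ℕ :=
  (List.range n).map fun i => if b.eval w (fun _ => i) = 0 then 0 else 1

/-- A program that reads a reversed word and writes the bits that `b` defines, from the last to
the first. The stack `3` counts down the positions and is also the value of the variables. -/
def bitsProg (n b : Ex) : Prog :=
  .seq (.while 0 (.move 0 2)) <| .seq (n.prog (fun _ => 0) 3 4) <|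
  .seq (.while 3 <| .seq (.pop 3) <| .seq (b.prog (fun _ => 3) 4 5) <| .seq (.push 1 none) <|
    .seq (.ifTop 4 none (.push 1 (some true)) (.pop 4)) (.while 4 (.pop 4))) <|
  .while 2 (.pop 2)

theorem exists_runs_bitsProg (n b : Ex) : ∃ p : Polynomial ℕ, ∀ w : List (Option Bool),
    Runs (bitsProg n b) (Function.update (fun _ => []) 0 w.reverse)
      (Function.update (fun _ => []) 1 (encodeNats (bits w b (n.eval w fun _ => 0))))
      (p.eval w.length) := by
  obtain ⟨p, hp⟩ := exists_runs_prog n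
  obtain ⟨q, hq⟩ := exists_runs_prog b
  obtain ⟨p', hp'⟩ := exists_eval_le n
  obtain ⟨q', hq'⟩ := exists_eval_le b
  refine ⟨4 * .X + 3 + p + p' * (q.comp (.X + p') + 2 * q'.comp (.X + p') + 6), fun w => ?_⟩
  set N := n.eval w fun _ => 0
  have hN := hp' w (fun _ => 0) w.length le_rfl (fun _ => Nat.zero_le _)
  -- the stacks when the loop has still to be run `j` times
  let st : ℕ → Stacks := fun j => Function.update (Function.update
    (Function.update (fun _ => []) 2 w)
    1 (encodeNats ((List.range' j (N - j)).map fun i =>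
      if b.eval w (fun _ => i) = 0 then 0 else 1)))
    3 (List.replicate j none)
  set B := w.length + p'.eval w.length
  have loop : ∀ j ≤ N, Runs (.while 3 <| .seq (.pop 3) <| .seq (b.prog (fun _ => 3) 4 5) <|
      .seq (.push 1 none) <| .seq (.ifTop 4 none (.push 1 (some true)) (.pop 4))
      (.while 4 (.pop 4))) (st j) (st 0) (j * (q.eval B + 2 * q'.eval B + 6) + 1) := by
    intro j
    induction j with
    | zero =>
      intro _
      refine (Runs.while_nil ?_).mono (by simp)
      simp [st]
    | succ j ih =>
      intro hj
      have hv := hq' w (fun _ => j) B (by omega) (fun _ => by omega)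
      set z := b.eval w (fun _ => j)
      have test : ∀ s : Stacks, s 4 = List.replicate z none →
          Runs (.ifTop 4 none (.push 1 (some true)) (.pop 4)) s (Function.update s 1
            (if z = 0 then s 1 else some true :: s 1)) 2 := by
        intro s hs
        by_cases hz : z = 0
        · refine ⟨2, le_rfl, .ifTop_neg (t := 1) (by simp [hs, hz]) ?_⟩
          have := Exec.pop 4 s
          rw [hs, hz, List.replicate_zero, List.tail_nil] at this
          convert this using 1
          rw [if_pos hz, Function.update_eq_self, eq_comm, ← Function.update_eq_self 4 s]
          simp [hs, hz]
        · refine ⟨2, le_rfl, .ifTop_pos (t := 1) ?_ ?_⟩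
          · obtain ⟨y, hy⟩ := Nat.exists_eq_succ_of_ne_zero hz
            rw [hs, hy, List.replicate_succ, List.head?_cons]
          rw [if_neg hz]
          exact Exec.push 1 (some true) s
      refine (Runs.while_step (s' := st j) (T := 1 + (q.eval B + (1 + (2 + (2 * z + 1))))) ?_
        ((Runs.pop 3 _).seq ((hq w (fun _ => j) _ 4 5 _ B (by omega) (fun _ => by omega) ?_).seq
          ((Runs.push 1 none _).seq ((test _ ?_).seq (((runs_clear 4 _).congr ?_).mono ?_)))))
        (ih (by omega))).mono ?_
      · simp [st, List.replicate_succ]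
      · constructor
        · simp [st]
        · simp [st]
        · intro x hx
          simp only [st, Function.update_apply]
          grind
        all_goals simp
      · simp [st, z]
      · have h1 : N - j = N - (j + 1) + 1 := by omega
        funext x
        simp only [st, Function.update_apply, h1, List.range'_succ, List.map_cons]
        change _ = if x = 3 then _ else
          if x = 1 then encodeNats ((if z = 0 then 0 else 1) :: _) else _
        generalize List.map (fun i => if b.eval w (fun _ => i) = 0 then 0 else 1)
          (List.range' (j + 1) (N - (j + 1))) = l
        have e : encodeNats ((if z = 0 then 0 else 1) :: l) =
            if z = 0 then none :: encodeNats l else some true :: none :: encodeNats l := by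
          split_ifs
          · exact encodeNats_zero_cons l
          · exact encodeNats_one_cons l
        rw [e]
        clear * -
        grind
      · simp [st, z]
      · rw [add_mul]; omega
  have start : addTo (Function.update
      (Function.update (Function.update (fun _ => []) 0 w.reverse) 0 []) 2
      ((Function.update (fun _ => []) 0 w.reverse 0).reverse ++
        Function.update (fun _ => []) 0 w.reverse 2)) 3 N = st N := by
    funext x
    simp only [st, Function.update_apply, Nat.sub_self, List.range'_zero, List.map_nil]
    have : encodeNats [] = [] := rfl
    grind
  refine ((runs_moveAll (r := 0) (q := 2) (by omega) _).seq
    ((hp w (fun _ => 0) _ 3 4 _ w.length le_rfl (by simp) ?_).seq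
      (Runs.seq (start ▸ loop N le_rfl) (runs_clear 2 _)))).mono ?_ |>.congr ?_
  · constructor
    · simp
    · simp
    · intro x hx
      simp only [Function.update_apply]
      grind
    all_goals simp
  · have := Nat.mul_le_mul_right (q.eval B + 2 * q'.eval B + 6) hN
    simp only [B] at this
    simp [st, B, N]
    omega
  · funext x
    simp only [st, Function.update_apply, bits, List.range_eq_range', Nat.sub_zero]
    grind

/-- A sequence of bits of definable length whose entries are definable can be written in polynomial
time. -/
theorem exists_machine_bits (n b : Ex) : ∃ (M : TM2ComputableAux (Option Bool) (Option Bool))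
    (p : Polynomial ℕ), ∀ w : List (Option Bool), Nonempty (TM2OutputsInTime M.tm
      (w.reverse.map M.inputAlphabet.symm)
      (some ((encodeNats (bits w b (n.eval w fun _ => 0))).map M.outputAlphabet.symm))
      (p.eval w.length)) := by
  obtain ⟨p, hp⟩ := exists_runs_bitsProg n b
  refine ⟨(bitsProg n b).machine, p + 1, fun w => ?_⟩
  obtain ⟨t, ht, h⟩ := hp w
  exact ⟨⟨_, h.machine_outputs⟩, by simpa using ht⟩

end Ex

/-! ### Definable functions and predicates -/

/-- The assignment without the variable `0`. -/
def Env.tail (env : Env) : Env := fun i => env (i + 1)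

theorem Env.tail_cons (i : ℕ) (env : Env) : (Env.cons i env).tail = env := rfl

theorem Env.cons_zero (i : ℕ) (env : Env) : Env.cons i env 0 = i := rfl

/-- A function of a word and of variables that is given by an arithmetic expression. -/
def Def (f : List (Option Bool) → Env → ℕ) : Prop := ∃ e : Ex, ∀ w env, e.eval w env = f w env

/-- A predicate of a word and of variables that says that some arithmetic expression is not zero.
In the closure properties below, the scope of a bound variable is written with this variable as
`env 0` and with the outer variables as `env.tail`. -/
def DefPred (P : List (Option Bool) → Env → Prop) : Prop :=
  ∃ e : Ex, ∀ w env, e.eval w env ≠ 0 ↔ P w env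

/-- Renaming of variables. -/
def Ex.rename : (ℕ → ℕ) → Ex → Ex
  | ξ, .var i => .var (ξ i)
  | _, .one => .one
  | ξ, .add a b => .add (a.rename ξ) (b.rename ξ)
  | ξ, .sub a b => .sub (a.rename ξ) (b.rename ξ)
  | ξ, .sum a b => .sum (a.rename ξ) (b.rename (Env.cons 0 fun i => ξ i + 1))
  | ξ, .letter c a => .letter c (a.rename ξ)
  | _, .len => .len

theorem Ex.eval_rename (w : List (Option Bool)) (e : Ex) (ξ : ℕ → ℕ) (env : Env) :
    (e.rename ξ).eval w env = e.eval w (fun i => env (ξ i)) := by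
  induction e generalizing ξ env with
  | var | one | len => rfl
  | add a b iha ihb | sub a b iha ihb => simp [rename, eval, iha, ihb]
  | letter c a iha => simp [rename, eval, iha]
  | sum a b iha ihb =>
    simp only [rename, eval, iha, ihb]
    refine Finset.sum_congr rfl fun i _ => ?_
    congr 1
    funext j
    cases j <;> rfl

namespace Def

variable {f g : List (Option Bool) → Env → ℕ} {P : List (Option Bool) → Env → Prop}

theorem congr (hf : Def f) (h : ∀ w env, f w env = g w env) : Def g := by
  obtain ⟨a, ha⟩ := hf
  exact ⟨a, fun w env => (ha w env).trans (h w env)⟩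

theorem var (i : ℕ) : Def fun _ env => env i := ⟨.var i, fun _ _ => rfl⟩

theorem length : Def fun w _ => w.length := ⟨.len, fun _ _ => rfl⟩

theorem tail (hf : Def f) : Def fun w env => f w env.tail := by
  obtain ⟨a, ha⟩ := hf
  exact ⟨a.rename (· + 1), fun w env => by rw [Ex.eval_rename]; exact ha w env.tail⟩

theorem add (hf : Def f) (hg : Def g) : Def fun w env => f w env + g w env := by
  obtain ⟨a, ha⟩ := hf
  obtain ⟨b, hb⟩ := hg
  exact ⟨.add a b, fun w env => by simp [Ex.eval, ha, hb]⟩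

theorem sub (hf : Def f) (hg : Def g) : Def fun w env => f w env - g w env := by
  obtain ⟨a, ha⟩ := hf
  obtain ⟨b, hb⟩ := hg
  exact ⟨.sub a b, fun w env => by simp [Ex.eval, ha, hb]⟩

theorem const (m : ℕ) : Def fun _ _ => m := by
  induction m with
  | zero => exact ⟨.sub .one .one, fun _ _ => rfl⟩
  | succ m ih => exact ih.add ⟨.one, fun _ _ => rfl⟩

theorem sum (hf : Def f) {g : List (Option Bool) → Env → ℕ → ℕ}
    (hg : Def fun w env => g w env.tail (env 0)) :
    Def fun w env => ∑ i ∈ Finset.range (f w env), g w env i := by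
  obtain ⟨a, ha⟩ := hf
  obtain ⟨b, hb⟩ := hg
  exact ⟨.sum a b, fun w env => by simp [Ex.eval, ha, hb, Env.tail_cons, Env.cons_zero]⟩

theorem mul (hf : Def f) (hg : Def g) : Def fun w env => f w env * g w env := by
  simpa using hf.sum (g := fun w env _ => g w env) hg.tail

theorem pow (hf : Def f) (m : ℕ) : Def fun w env => f w env ^ m := by
  induction m with
  | zero => simpa using const 1
  | succ m ih => simpa only [pow_succ] using ih.mul hf

theorem indicator (hP : DefPred P) [∀ w env, Decidable (P w env)] :
    Def fun w env => if P w env then 1 else 0 := by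
  obtain ⟨a, ha⟩ := hP
  refine ((const 1).sub ((const 1).sub (g := fun w env => a.eval w env) ⟨a, fun _ _ => rfl⟩)).congr
    fun w env => ?_
  by_cases h : P w env
  · have := (ha w env).2 h
    rw [if_pos h]; omega
  · have := (ha w env).not.2 h
    rw [if_neg h]; omega

theorem count (hf : Def f) {P : List (Option Bool) → Env → ℕ → Prop}
    [∀ w env, DecidablePred (P w env)] (hP : DefPred fun w env => P w env.tail (env 0)) :
    Def fun w env => ((Finset.range (f w env)).filter (P w env)).card := by
  simp only [Finset.card_filter]
  exact hf.sum (g := fun w env i => if P w env i then 1 else 0) (Def.indicator hP)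

theorem finsetSum {ι : Type} (s : Finset ι) {f : ι → List (Option Bool) → Env → ℕ}
    (hf : ∀ i, Def (f i)) : Def fun w env => ∑ i ∈ s, f i w env := by
  classical
  induction s using Finset.induction_on with
  | empty => simpa using const 0
  | insert i s hi ih => simpa [Finset.sum_insert hi] using (hf i).add ih

end Def

namespace DefPred

variable {f g : List (Option Bool) → Env → ℕ} {P Q : List (Option Bool) → Env → Prop}

theorem congr (hP : DefPred P) (h : ∀ w env, P w env ↔ Q w env) : DefPred Q := by
  obtain ⟨a, ha⟩ := hP
  exact ⟨a, fun w env => (ha w env).trans (h w env)⟩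

theorem of_def (hf : Def f) : DefPred fun w env => f w env ≠ 0 := by
  obtain ⟨a, ha⟩ := hf
  exact ⟨a, fun w env => by rw [ha]⟩

theorem lt (hf : Def f) (hg : Def g) : DefPred fun w env => f w env < g w env :=
  (of_def (hg.sub hf)).congr fun w env => by omega

theorem not (hP : DefPred P) : DefPred fun w env => ¬ P w env := by
  classical
  exact (lt (Def.indicator hP) (.const 1)).congr fun w env => by
    by_cases h : P w env <;> simp [h]

theorem and (hP : DefPred P) (hQ : DefPred Q) : DefPred fun w env => P w env ∧ Q w env := by
  classical
  exact (of_def ((Def.indicator hP).mul (Def.indicator hQ))).congr fun w env => by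
    by_cases h : P w env <;> by_cases h' : Q w env <;> simp [h, h']

theorem or (hP : DefPred P) (hQ : DefPred Q) : DefPred fun w env => P w env ∨ Q w env :=
  (hP.not.and hQ.not).not.congr fun w env => by tauto

theorem imp (hP : DefPred P) (hQ : DefPred Q) : DefPred fun w env => P w env → Q w env :=
  (hP.not.or hQ).congr fun w env => by tauto

theorem iff (hP : DefPred P) (hQ : DefPred Q) : DefPred fun w env => P w env ↔ Q w env :=
  ((hP.imp hQ).and (hQ.imp hP)).congr fun w env => by tauto

theorem le (hf : Def f) (hg : Def g) : DefPred fun w env => f w env ≤ g w env :=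
  (lt hg hf).not.congr fun _ _ => not_lt

theorem eq (hf : Def f) (hg : Def g) : DefPred fun w env => f w env = g w env :=
  ((le hf hg).and (le hg hf)).congr fun w env => by omega

theorem ne (hf : Def f) (hg : Def g) : DefPred fun w env => f w env ≠ g w env :=
  (eq hf hg).not

theorem top : DefPred fun _ _ => True := (eq (.const 0) (.const 0)).congr fun _ _ => by simp

theorem bot : DefPred fun _ _ => False := top.not.congr fun _ _ => by simp

theorem exists_lt (hf : Def f) {P : List (Option Bool) → Env → ℕ → Prop}
    (hP : DefPred fun w env => P w env.tail (env 0)) :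
    DefPred fun w env => ∃ i < f w env, P w env i := by
  classical
  refine (of_def (hf.count hP)).congr fun w env => ?_
  simp [Finset.card_eq_zero, Finset.filter_eq_empty_iff]

theorem forall_lt (hf : Def f) {P : List (Option Bool) → Env → ℕ → Prop}
    (hP : DefPred fun w env => P w env.tail (env 0)) :
    DefPred fun w env => ∀ i < f w env, P w env i :=
  (exists_lt hf (P := fun w env i => ¬ P w env i) hP.not).not.congr fun w env => by
    push Not; rfl

/-- The bound of this quantifier is fixed, so that the expressions may depend on `j`. -/
theorem exists_lt_const (d : ℕ) {P : ℕ → List (Option Bool) → Env → Prop}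
    (hP : ∀ j, DefPred (P j)) : DefPred fun w env => ∃ j < d, P j w env := by
  induction d with
  | zero => exact bot.congr fun w env => by simp
  | succ d ih =>
    refine (ih.or (hP d)).congr fun w env => ?_
    simp only [Nat.lt_succ_iff_lt_or_eq, or_and_right, exists_or, exists_eq_left]

theorem forall_lt_const (d : ℕ) {P : ℕ → List (Option Bool) → Env → Prop}
    (hP : ∀ j, DefPred (P j)) : DefPred fun w env => ∀ j < d, P j w env :=
  (exists_lt_const d fun j => (hP j).not).not.congr fun w env => by push Not; rfl

theorem letter (c : Option Bool) (hf : Def f) : DefPred fun w env => w[f w env]? = some c := by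
  obtain ⟨a, ha⟩ := hf
  exact ⟨.letter c a, fun w env => by simp [Ex.eval, ha]⟩

end DefPred

namespace Def

variable {f g : List (Option Bool) → Env → ℕ}

theorem ite {P : List (Option Bool) → Env → Prop} [∀ w env, Decidable (P w env)] (hP : DefPred P)
    (hf : Def f) (hg : Def g) : Def fun w env => if P w env then f w env else g w env := by
  classical
  exact (((Def.indicator hP).mul hf).add ((Def.indicator hP.not).mul hg)).congr fun w env => by
    by_cases h : P w env <;> simp [h]

theorem div (hf : Def f) (hg : Def g) : Def fun w env => f w env / g w env := by
  refine (ite (.eq hg (.const 0)) (.const 0) (hf.count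
    (P := fun w env i => (i + 1) * g w env ≤ f w env)
    (.le (((var 0).add (.const 1)).mul hg.tail) hf.tail))).congr fun w env => ?_
  split_ifs with h
  · simp [h]
  · rw [← Finset.card_range (f w env / g w env)]
    congr 1
    ext i
    have h1 := Nat.le_div_iff_mul_le (x := i + 1) (y := f w env) (Nat.pos_of_ne_zero h)
    have h2 := Nat.div_le_self (f w env) (g w env)
    simp only [Finset.mem_filter, Finset.mem_range, ← h1]
    omega

theorem mod (hf : Def f) (hg : Def g) : Def fun w env => f w env % g w env := by
  simpa only [Nat.mod_def] using hf.sub (hg.mul (hf.div hg))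

end Def

/-! ### Decoding structures -/

/-- The number at the position `j` of the sequence that the word `w` stands for is `1`; this
presupposes that the sequence consists of zeros and ones. -/
def BitAt (w : List (Option Bool)) (j : ℕ) : Prop :=
  ∃ i < w.length, w[i]? = some (some true) ∧ (w.take i).count none = j

theorem bitAt_cons (c : Option Bool) (w : List (Option Bool)) (j : ℕ) :
    BitAt (c :: w) j ↔ (c = some true ∧ j = 0) ∨
      ∃ i < w.length, w[i]? = some (some true) ∧ (c :: w.take i).count none = j := by
  constructor
  · rintro ⟨_ | i, h1, h2, h3⟩
    · left; simpa [eq_comm] using And.intro h2 h3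
    · right; exact ⟨i, by simpa using h1, by simpa using h2, h3⟩
  · rintro (⟨rfl, rfl⟩ | ⟨i, h1, h2, h3⟩)
    · exact ⟨0, by simp, by simp, by simp⟩
    · exact ⟨i + 1, by simpa using h1, by simpa using h2, h3⟩

theorem bitAt_encodeNats {l : List ℕ} (hl : ∀ x ∈ l, x ≤ 1) (j : ℕ) :
    BitAt (encodeNats l) j ↔ l[j]? = some 1 := by
  induction l generalizing j with
  | nil => simp [BitAt, encodeNats]
  | cons m l ih =>
    have hl' : ∀ x ∈ l, x ≤ 1 := fun x hx => hl x (List.mem_cons_of_mem _ hx)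
    have key : (∃ i < (encodeNats l).length, (encodeNats l)[i]? = some (some true) ∧
        (none :: (encodeNats l).take i).count none = j) ↔ ∃ j', j = j' + 1 ∧ l[j']? = some 1 := by
      simp only [← ih hl', BitAt, List.count_cons_self]
      constructor
      · rintro ⟨i, h1, h2, h3⟩; exact ⟨_, h3.symm, i, h1, h2, rfl⟩
      · rintro ⟨j', rfl, i, h1, h2, rfl⟩; exact ⟨i, h1, h2, rfl⟩
    have h01 : m = 0 ∨ m = 1 := by have := hl m List.mem_cons_self; omega
    rcases h01 with rfl | rfl
    · rw [encodeNats_zero_cons, bitAt_cons, key]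
      cases j <;> simp
    · rw [encodeNats_one_cons, bitAt_cons]
      have : ∀ i, (some true :: (none :: encodeNats l).take i).count none =
        ((none :: encodeNats l).take i).count none := fun i => by simp
      have h2 := bitAt_cons none (encodeNats l) j
      rw [key] at h2
      simp only [this]
      change _ ∨ BitAt (none :: encodeNats l) j ↔ _
      rw [h2]
      cases j <;> simp

theorem length_le_length_encodeNats (l : List ℕ) : l.length ≤ (encodeNats l).length := by
  induction l with
  | nil => simp
  | cons m l ih => rw [encodeNats_cons]; simp; omega

theorem DefPred.bitAt {f : List (Option Bool) → Env → ℕ} (hf : Def f) :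
    DefPred fun w env => BitAt w (f w env) := by
  have h : ∀ (w : List (Option Bool)) (i : ℕ), i < w.length → (w.take i).count none =
      ((Finset.range i).filter fun j => w[j]? = some none).card := by
    intro w i hi
    induction i with
    | zero => simp
    | succ i ih =>
      rw [List.take_add_one, List.count_append, ih (by omega), Finset.range_add_one,
        Finset.filter_insert]
      have h1 := List.getElem?_eq_getElem (show i < w.length by omega)
      split_ifs with h2
      · simp [h2]
      · rw [h1] at h2 ⊢
        simp at h2
        simp [h2]
  refine (exists_lt .length (P := fun w env i => w[i]? = some (some true) ∧
    ((Finset.range i).filter fun j => w[j]? = some none).card = f w env) ?_).congr fun w env => ?_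
  · exact (letter _ (.var 0)).and (.eq (.count (.var 0) (P := fun w _ j => w[j]? = some none)
      (letter _ (.var 0))) hf.tail)
  · refine exists_congr fun i => and_congr_right fun hi => ?_
    rw [h w i hi]

open Classical in
/-- The number of consecutive ones from the position `o` on. -/
noncomputable def runLength (w : List (Option Bool)) (o : ℕ) : ℕ :=
  ((Finset.range w.length).filter fun i => ∀ j < i + 1, BitAt w (o + j)).card

theorem runLength_eq {w : List (Option Bool)} {o m : ℕ} (hm : m ≤ w.length)
    (h : ∀ j < m, BitAt w (o + j)) (h' : ¬ BitAt w (o + m)) : runLength w o = m := by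
  rw [← Finset.card_range m, runLength]
  congr 1
  ext i
  simp only [Finset.mem_filter, Finset.mem_range]
  constructor
  · rintro ⟨_, hi⟩
    by_contra hmi
    exact h' (hi m (by omega))
  · exact fun hi => ⟨by omega, fun j hj => h j (by omega)⟩

theorem Def.runLength {f : List (Option Bool) → Env → ℕ} (hf : Def f) :
    Def fun w env => _root_.runLength w (f w env) := by
  classical
  exact (count .length (P := fun w env i => ∀ j < i + 1, BitAt w (f w env + j))
    (.forall_lt ((var 0).add (const 1)) (.bitAt (hf.tail.tail.add (var 0))))).congr
    fun w env => by simp only [_root_.runLength]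

/-- The size of the structure that is encoded in `w`. -/
noncomputable def wordSize (w : List (Option Bool)) : ℕ := runLength w 0

/-- The parameter of the instance that is encoded in `w`. -/
noncomputable def wordParam (w : List (Option Bool)) : ℕ := runLength w (wordSize w + 1)

section

variable {r : ℕ} (ar : Fin r → ℕ)

/-- The entry of the truth table of the relation `i` at the position `j`. The tables follow the
numbers `n` and `k`, each of which is in unary with a zero at the end. -/
def WordRel (w : List (Option Bool)) (i : Fin r) (j : ℕ) : Prop :=
  BitAt w (wordSize w + 1 + (wordParam w + 1) +
    (((List.finRange r).take i).map fun i' => wordSize w ^ ar i').sum + j)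

theorem Def.wordSize : Def fun w _ => wordSize w := .runLength (.const 0)

theorem Def.wordParam : Def fun w _ => wordParam w := .runLength (.add .wordSize (.const 1))

theorem DefPred.wordRel (i : Fin r) {f : List (Option Bool) → Env → ℕ} (hf : Def f) :
    DefPred fun w env => WordRel ar w i (f w env) := by
  refine .bitAt (.add (.add (.add (.add .wordSize (.const 1)) (.add .wordParam (.const 1))) ?_) hf)
  induction (List.finRange r).take i with
  | nil => exact .const 0
  | cons i' l ih => exact .add (.pow .wordSize _) ih

end

theorem getElem?_flatMap {α β : Type} (L : List α) (f : α → List β) (i j : ℕ) (a : α)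
    (hi : L[i]? = some a) (hj : j < (f a).length) :
    (L.flatMap f)[((L.take i).map fun a => (f a).length).sum + j]? = (f a)[j]? := by
  induction L generalizing i with
  | nil => simp at hi
  | cons b L ih =>
    cases i with
    | zero =>
      obtain rfl : b = a := by simpa using hi
      simpa using List.getElem?_append_left hj
    | succ i =>
      simp only [List.flatMap_cons, List.take_succ_cons, List.map_cons, List.sum_cons]
      rw [add_assoc, List.getElem?_append_right (by omega), Nat.add_sub_cancel_left]
      exact ih i (by simpa using hi)

theorem getElem?_unaryNats_append (m : ℕ) (l : List ℕ) :
    (∀ j < m, (unaryNats m ++ l)[j]? = some 1) ∧ (unaryNats m ++ l)[m]? = some 0 ∧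
      ∀ j, (unaryNats m ++ l)[m + 1 + j]? = l[j]? := by
  refine ⟨fun j hj => ?_, ?_, fun j => ?_⟩
  · simp [unaryNats, List.getElem?_append, hj]
  · simp [unaryNats]
  · rw [List.getElem?_append_right (by simp [unaryNats])]
    congr 1
    simp [unaryNats]

section

variable {r : ℕ} {ar : Fin r → ℕ} (A : WDInstance ar)

theorem WDInstance.nats_le_one : ∀ x ∈ A.nats, x ≤ 1 := by
  intro x hx
  simp only [WDInstance.nats, unaryNats, List.mem_append, List.mem_replicate, List.mem_singleton,
    List.mem_flatMap, List.mem_ofFn] at hx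
  rcases hx with (⟨_, rfl⟩ | rfl) | (⟨_, rfl⟩ | rfl) | ⟨i, _, j, rfl⟩
  any_goals omega
  exact Bool.toNat_le _

theorem WDInstance.wordSize_encode : wordSize (encodeNats A.nats) = A.n := by
  obtain ⟨h1, h2, -⟩ := getElem?_unaryNats_append A.n (unaryNats A.k ++ (List.finRange r).flatMap
    fun i => List.ofFn fun j : Fin (A.n ^ ar i) => (A.rel i (finFunctionFinEquiv.symm j)).toNat)
  refine runLength_eq ((Nat.le_trans ?_ (length_le_length_encodeNats _))) (fun j hj => ?_) ?_
  · simp only [nats, unaryNats, List.length_append, List.length_replicate]; omega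
  · rw [bitAt_encodeNats A.nats_le_one, zero_add]
    exact h1 j hj
  · rw [bitAt_encodeNats A.nats_le_one, zero_add]
    exact fun h => by simpa using h2.symm.trans h

theorem WDInstance.wordParam_encode : wordParam (encodeNats A.nats) = A.k := by
  obtain ⟨-, -, h0⟩ := getElem?_unaryNats_append A.n (unaryNats A.k ++ (List.finRange r).flatMap
    fun i => List.ofFn fun j : Fin (A.n ^ ar i) => (A.rel i (finFunctionFinEquiv.symm j)).toNat)
  obtain ⟨h1, h2, -⟩ := getElem?_unaryNats_append A.k ((List.finRange r).flatMap
    fun i => List.ofFn fun j : Fin (A.n ^ ar i) => (A.rel i (finFunctionFinEquiv.symm j)).toNat)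
  rw [wordParam, A.wordSize_encode]
  refine runLength_eq ((Nat.le_trans ?_ (length_le_length_encodeNats _))) (fun j hj => ?_) ?_
  · simp only [nats, unaryNats, List.length_append, List.length_replicate]; omega
  · rw [bitAt_encodeNats A.nats_le_one]
    exact (h0 j).trans (h1 j hj)
  · rw [bitAt_encodeNats A.nats_le_one]
    exact fun h => by simpa using h2.symm.trans ((h0 _).symm.trans h)

theorem WDInstance.wordRel_encode (i : Fin r) (a : Fin (ar i) → Fin A.n) :
    WordRel ar (encodeNats A.nats) i (finFunctionFinEquiv a) ↔ A.rel i a = true := by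
  obtain ⟨-, -, h0⟩ := getElem?_unaryNats_append A.n (unaryNats A.k ++ (List.finRange r).flatMap
    fun i => List.ofFn fun j : Fin (A.n ^ ar i) => (A.rel i (finFunctionFinEquiv.symm j)).toNat)
  obtain ⟨-, -, h1⟩ := getElem?_unaryNats_append A.k ((List.finRange r).flatMap
    fun i => List.ofFn fun j : Fin (A.n ^ ar i) => (A.rel i (finFunctionFinEquiv.symm j)).toNat)
  have h2 := getElem?_flatMap (List.finRange r) (fun i => List.ofFn fun j : Fin (A.n ^ ar i) =>
    (A.rel i (finFunctionFinEquiv.symm j)).toNat) i (finFunctionFinEquiv a) i (by simp)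
    (by rw [List.length_ofFn]; exact (finFunctionFinEquiv a).2)
  rw [WordRel, bitAt_encodeNats A.nats_le_one, A.wordSize_encode, A.wordParam_encode, nats,
    add_assoc, add_assoc, h0, h1]
  simp only [List.length_ofFn] at h2
  rw [h2, List.getElem?_ofFn, dif_pos (finFunctionFinEquiv a).2, Fin.eta, Equiv.symm_apply_apply]
  cases A.rel i a <;> simp

end

/-! ### Formulas on numbers -/

open FirstOrder.Language

section Formulas

variable {r s : ℕ} {ar : Fin r → ℕ}

/-- The number of a tuple over `{0, …, n - 1}`: its entries are the digits in base `n`. -/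
def tupleCode (n : ℕ) {l : ℕ} (f : Fin l → ℕ) : ℕ := ∑ j, f j * n ^ (j : ℕ)

/-- The value of a term, which is a variable, as there are no function symbols. -/
def termVal (e : ℕ → ℕ) {m : ℕ} : (wdLanguage s ar).Term (Empty ⊕ Fin m) → ℕ
  | .var (.inr i) => e i
  | .var (.inl x) => x.elim
  | .func f _ => Empty.elim f

/-- The meaning of a relation symbol, as a predicate on the codes of tuples. -/
def WDRel.Holds (R : Fin r → ℕ → Prop) (X : ℕ → Prop) : {l : ℕ} → WDRel s ar l → ℕ → Prop
  | _, .var, p => X p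
  | _, .sym i, p => R i p

/-- The tuples whose membership in the relation variable an atom depends on. -/
def WDRel.points : {l : ℕ} → WDRel s ar l → ℕ → List ℕ
  | _, .var, p => [p]
  | _, .sym _, _ => []

/-- The truth of a quantifier-free formula, when relations are predicates on the codes of tuples
over `{0, …, n - 1}`. Formulas with quantifiers get a dummy value. -/
def QFSat (R : Fin r → ℕ → Prop) (X : ℕ → Prop) (n : ℕ) (e : ℕ → ℕ) :
    {m : ℕ} → (wdLanguage s ar).BoundedFormula Empty m → Prop
  | _, .falsum => False
  | _, .equal t u => termVal e t = termVal e u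
  | _, .rel S ts => WDRel.Holds R X S (tupleCode n fun j => termVal e (ts j))
  | _, .imp a b => QFSat R X n e a → QFSat R X n e b
  | _, .all _ => False

/-- The codes of the tuples whose membership in the relation variable a quantifier-free formula
depends on. -/
def qfPoints (n : ℕ) (e : ℕ → ℕ) : {m : ℕ} → (wdLanguage s ar).BoundedFormula Empty m → List ℕ
  | _, .falsum => []
  | _, .equal _ _ => []
  | _, .rel S ts => WDRel.points S (tupleCode n fun j => termVal e (ts j))
  | _, .imp a b => qfPoints n e a ++ qfPoints n e b
  | _, .all _ => []

/-- The number of atoms with the relation variable. -/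
def qfCount {m : ℕ} (φ : (wdLanguage s ar).BoundedFormula Empty m) : ℕ :=
  (qfPoints 0 (fun _ => 0) φ).length

theorem length_qfPoints (n : ℕ) (e : ℕ → ℕ) {m : ℕ}
    (φ : (wdLanguage s ar).BoundedFormula Empty m) : (qfPoints n e φ).length = qfCount φ := by
  induction φ with
  | falsum | equal | all => rfl
  | rel S ts => cases S <;> rfl
  | imp a b iha ihb => simp only [qfPoints, qfCount, List.length_append] at *; rw [iha, ihb]

theorem qfSat_congr (R : Fin r → ℕ → Prop) {X X' : ℕ → Prop} (n : ℕ) (e : ℕ → ℕ) {m : ℕ}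
    (φ : (wdLanguage s ar).BoundedFormula Empty m) (h : ∀ p ∈ qfPoints n e φ, X p ↔ X' p) :
    QFSat R X n e φ ↔ QFSat R X' n e φ := by
  induction φ with
  | falsum | equal | all => rfl
  | rel S ts =>
    cases S with
    | var => exact h _ (List.mem_singleton_self _)
    | sym => rfl
  | imp a b iha ihb =>
    exact imp_congr (iha fun p hp => h p (List.mem_append_left _ hp))
      (ihb fun p hp => h p (List.mem_append_right _ hp))

section Definability

variable {E : ℕ → List (Option Bool) → Env → ℕ}

theorem Def.termVal (hE : ∀ i, Def (E i)) {m : ℕ} (t : (wdLanguage s ar).Term (Empty ⊕ Fin m)) :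
    Def fun w env => _root_.termVal (fun i => E i w env) t := by
  match t with
  | .var (.inr i) => exact hE i
  | .var (.inl x) => exact x.elim
  | .func f _ => exact Empty.elim f

theorem Def.tupleCode (hE : ∀ i, Def (E i)) {m l : ℕ}
    (ts : Fin l → (wdLanguage s ar).Term (Empty ⊕ Fin m)) :
    Def fun w env =>
      _root_.tupleCode (_root_.wordSize w) fun j => _root_.termVal (fun i => E i w env) (ts j) :=
  finsetSum _ fun j => (termVal hE (ts j)).mul (.pow .wordSize _)

theorem DefPred.qfSat (hE : ∀ i, Def (E i)) {X : List (Option Bool) → Env → ℕ → Prop}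
    (hX : ∀ f, Def f → DefPred fun w env => X w env (f w env)) {m : ℕ}
    (φ : (wdLanguage s ar).BoundedFormula Empty m) : DefPred fun w env =>
      QFSat (WordRel ar w) (X w env) (wordSize w) (fun i => E i w env) φ := by
  induction φ with
  | falsum => exact bot
  | equal t u => exact .eq (.termVal hE t) (.termVal hE u)
  | rel S ts =>
    cases S with
    | var => exact hX _ (.tupleCode hE ts)
    | sym i => exact .wordRel ar i (.tupleCode hE ts)
  | imp a b iha ihb => exact iha.imp ihb
  | all => exact bot

theorem DefPred.forall_qfPoints (hE : ∀ i, Def (E i)) {X : List (Option Bool) → Env → ℕ → Prop}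
    (hX : ∀ f, Def f → DefPred fun w env => X w env (f w env)) {m : ℕ}
    (φ : (wdLanguage s ar).BoundedFormula Empty m) : DefPred fun w env =>
      ∀ p ∈ qfPoints (wordSize w) (fun i => E i w env) φ, X w env p := by
  induction φ with
  | falsum => exact top.congr fun w env => by simp [qfPoints]
  | equal t u => exact top.congr fun w env => by simp [qfPoints]
  | rel S ts =>
    cases S with
    | var => exact (hX _ (.tupleCode hE ts)).congr fun w env => by simp [qfPoints, WDRel.points]
    | sym i => exact top.congr fun w env => by simp [qfPoints, WDRel.points]
  | imp a b iha ihb =>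
    exact (iha.and ihb).congr fun w env => by
      simp only [qfPoints, List.mem_append, or_imp, forall_and]
  | all => exact top.congr fun w env => by simp [qfPoints]

end Definability

theorem qfSat_iff_realize (A : WDInstance ar) (S : Finset (Fin s → Fin A.n))
    {R : Fin r → ℕ → Prop} {X : ℕ → Prop}
    (hR : ∀ i a, R i (finFunctionFinEquiv a) ↔ A.rel i a = true)
    (hX : ∀ a, X (finFunctionFinEquiv a) ↔ a ∈ S) {e : ℕ → ℕ} {m : ℕ} {xs : Fin m → Fin A.n}
    (he : ∀ i : Fin m, e i = xs i) {φ : (wdLanguage s ar).BoundedFormula Empty m} (hφ : φ.IsQF) :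
    QFSat R X A.n e φ ↔
      @BoundedFormula.Realize _ (Fin A.n) (A.toStructure s S) _ _ φ default xs := by
  let _ := A.toStructure s S
  have ht : ∀ t : (wdLanguage s ar).Term (Empty ⊕ Fin m),
      termVal e t = (t.realize (Sum.elim default xs) : Fin A.n) := by
    intro t
    match t with
    | .var (.inr i) => exact he i
    | .var (.inl x) => exact x.elim
    | .func f _ => exact Empty.elim f
  induction hφ with
  | falsum => rfl
  | of_isAtomic h =>
    cases h with
    | equal t u =>
      change termVal e t = termVal e u ↔
        t.realize (Sum.elim default xs) = u.realize (Sum.elim default xs)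
      rw [ht, ht, Fin.val_inj]
    | rel S' ts =>
      have h1 : (tupleCode A.n fun j => termVal e (ts j)) =
          finFunctionFinEquiv fun j => (ts j).realize (Sum.elim default xs) := by
        rw [finFunctionFinEquiv_apply]
        exact Finset.sum_congr rfl fun j _ => by simp only [ht]
      change WDRel.Holds R X S' _ ↔ _
      rw [h1]
      cases S' with
      | var => exact hX _
      | sym i => exact hR i _
  | imp _ _ iha ihb => exact imp_congr iha ihb

end Formulas

/-! ### The quantifier prefix -/

section Prefix

variable {L : FirstOrder.Language.{0, 0}}

/-- The assignment `ys` extends `xs`. -/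
def Extends {M : Type} {m m' : ℕ} (ys : Fin m' → M) (xs : Fin m → M) : Prop :=
  ∀ (i : ℕ) (h : i < m) (h' : i < m'), ys ⟨i, h'⟩ = xs ⟨i, h⟩

theorem Extends.eq {M : Type} {m : ℕ} {ys xs : Fin m → M} (h : Extends ys xs) : ys = xs :=
  funext fun i => h i i.2 i.2

theorem extends_snoc {M : Type} {m m' : ℕ} (hm : m + 1 ≤ m') (ys : Fin m' → M) (xs : Fin m → M) :
    Extends ys xs ↔ ∃ a, Extends ys (Fin.snoc xs a : Fin (m + 1) → M) := by
  constructor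
  · intro h
    refine ⟨ys ⟨m, hm⟩, fun i hi hi' => ?_⟩
    by_cases him : i < m
    · simpa [Fin.snoc, him, Fin.castLT] using h i him hi'
    · obtain rfl : i = m := by omega
      simp [Fin.snoc]
  · rintro ⟨a, h⟩ i hi hi'
    simpa [Fin.snoc, hi, Fin.castLT] using h i (by omega) hi'

/-- The block of existential quantifiers of a `Σ₁`-formula. -/
theorem QuantPrefix.exists_qf {m : ℕ} {φ : L.BoundedFormula Empty m} (h : QuantPrefix false 1 φ) :
    ∃ (m' : ℕ) (ψ : L.BoundedFormula Empty m'), m ≤ m' ∧ ψ.IsQF ∧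
      ∀ (M : Type) [L.Structure M] (xs : Fin m → M), φ.Realize default xs ↔
        ∃ ys : Fin m' → M, Extends ys xs ∧ ψ.Realize default ys := by
  generalize hb : false = b at h
  generalize ht : 1 = t at h
  induction h with
  | qf => omega
  | @switch b t m φ h =>
    obtain rfl : t = 0 := by omega
    subst hb
    cases h with
    | qf h => exact ⟨m, φ, le_rfl, h, fun M _ xs =>
        ⟨fun hx => ⟨xs, fun _ _ _ => rfl, hx⟩, fun ⟨ys, h1, h2⟩ => h1.eq ▸ h2⟩⟩
  | all => cases hb
  | ex h ih =>
    obtain ⟨m', ψ, hm, hψ, h⟩ := ih hb ht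
    refine ⟨m', ψ, by omega, hψ, fun M _ xs => ?_⟩
    simp only [BoundedFormula.realize_ex, h, extends_snoc hm _ xs]
    tauto

/-- The two blocks of quantifiers of a `Π₂`-formula. -/
theorem QuantPrefix.forall_exists_qf {m : ℕ} {φ : L.BoundedFormula Empty m}
    (h : QuantPrefix true 2 φ) :
    ∃ (m₁ m₂ : ℕ) (ψ : L.BoundedFormula Empty m₂), m ≤ m₁ ∧ m₁ ≤ m₂ ∧ ψ.IsQF ∧
      ∀ (M : Type) [L.Structure M] (xs : Fin m → M), φ.Realize default xs ↔
        ∀ ys : Fin m₁ → M, Extends ys xs →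
          ∃ zs : Fin m₂ → M, Extends zs ys ∧ ψ.Realize default zs := by
  generalize hb : true = b at h
  generalize ht : 2 = t at h
  induction h with
  | qf => omega
  | @switch b t m φ h =>
    obtain rfl : t = 1 := by omega
    subst hb
    obtain ⟨m', ψ, hm, hψ, h⟩ := h.exists_qf
    refine ⟨m, m', ψ, le_rfl, hm, hψ, fun M _ xs => ?_⟩
    rw [h]
    exact ⟨fun hx ys hy => hy.eq ▸ hx, fun hx => hx xs fun _ _ _ => rfl⟩
  | all h ih =>
    obtain ⟨m₁, m₂, ψ, hm, hm', hψ, h⟩ := ih hb ht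
    refine ⟨m₁, m₂, ψ, by omega, hm', hψ, fun M _ xs => ?_⟩
    simp only [BoundedFormula.realize_all, h, extends_snoc hm _ xs]
    exact ⟨fun hx ys ⟨a, ha⟩ => hx a ys ha, fun hx a ys ha => hx ys ⟨a, ha⟩⟩
  | ex => cases hb

/-- A quantifier-free matrix is preceded by an empty block of existential quantifiers. -/
theorem QuantPrefix.two_of_one {m : ℕ} {φ : L.BoundedFormula Empty m} (h : QuantPrefix true 1 φ) :
    QuantPrefix true 2 φ := by
  generalize hb : true = b at h
  generalize ht : 1 = t at h
  induction h with
  | qf => omega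
  | @switch b t m φ h =>
    obtain rfl : t = 0 := by omega
    subst hb
    cases h with
    | qf h => exact .switch (.switch (.qf h))
  | all h ih =>
    obtain rfl := Nat.succ.inj ht
    exact .all (ih rfl rfl)
  | ex => cases hb

end Prefix

/-! ### Digits -/

/-- The digit of `x` at the position `j` in base `b`. -/
def digit (b x j : ℕ) : ℕ := x / b ^ j % b

theorem digit_lt {b : ℕ} (hb : 0 < b) (x j : ℕ) : digit b x j < b := Nat.mod_lt _ hb

theorem digit_succ (b x j : ℕ) : digit b x (j + 1) = digit b (x / b) j := by
  rw [digit, digit, pow_succ', Nat.div_div_eq_div_mul]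

theorem digit_mod_pow (b x : ℕ) {j m : ℕ} (h : j < m) : digit b (x % b ^ m) j = digit b x j := by
  obtain ⟨d, rfl⟩ := Nat.exists_eq_add_of_lt h
  rw [digit, digit, add_assoc, pow_add, Nat.mod_mul_right_div_self]
  exact Nat.mod_mod_of_dvd _ (dvd_pow_self b (by omega))

theorem exists_digit_eq {b : ℕ} (m : ℕ) (f : ℕ → ℕ) (hf : ∀ j < m, f j < b) :
    ∃ x < b ^ m, ∀ j < m, digit b x j = f j := by
  induction m generalizing f with
  | zero => exact ⟨0, by simp, by simp⟩
  | succ m ih =>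
    obtain ⟨x, hx, h⟩ := ih (fun j => f (j + 1)) fun j hj => hf _ (by omega)
    have h0 := hf 0 (by omega)
    refine ⟨f 0 + b * x, ?_, ?_⟩
    · rw [pow_succ']; nlinarith
    · rintro (_ | j) hj
      · simp [digit, Nat.mod_eq_of_lt h0]
      · rw [digit_succ, Nat.add_mul_div_left _ _ (by omega), Nat.div_eq_of_lt h0, zero_add]
        exact h j (by omega)

theorem eq_of_digit_eq {b : ℕ} (m : ℕ) {x y : ℕ} (hx : x < b ^ m) (hy : y < b ^ m)
    (h : ∀ j < m, digit b x j = digit b y j) : x = y := by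
  induction m generalizing x y with
  | zero => simp at hx hy; omega
  | succ m ih =>
    rw [pow_succ'] at hx hy
    have h1 : x / b = y / b := ih (Nat.div_lt_of_lt_mul hx) (Nat.div_lt_of_lt_mul hy) fun j hj => by
      rw [← digit_succ, ← digit_succ]; exact h _ (by omega)
    have h0 := h 0 (by omega)
    simp only [digit, pow_zero, Nat.div_one] at h0
    rw [← Nat.div_add_mod x b, ← Nat.div_add_mod y b, h1, h0]

theorem finFunctionFinEquiv_symm_val {n m : ℕ} (x : Fin (n ^ m)) (i : Fin m) :
    (finFunctionFinEquiv.symm x i : ℕ) = digit n x i := rfl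

theorem tupleCode_lt {n l : ℕ} {f : Fin l → ℕ} (hf : ∀ j, f j < n) : tupleCode n f < n ^ l := by
  have := (finFunctionFinEquiv fun j => (⟨f j, hf j⟩ : Fin n)).2
  rwa [finFunctionFinEquiv_apply] at this

theorem Def.digit {b x : List (Option Bool) → Env → ℕ} (hb : Def b) (hx : Def x) (j : ℕ) :
    Def fun w env => _root_.digit (b w env) (x w env) j :=
  .mod (.div hx (.pow hb j)) hb

section

variable {r s : ℕ} {ar : Fin r → ℕ}

theorem lt_of_mem_qfPoints {n : ℕ} {e : ℕ → ℕ} (he : ∀ i, e i < n) {m : ℕ}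
    (φ : (wdLanguage s ar).BoundedFormula Empty m) {p : ℕ} (hp : p ∈ qfPoints n e φ) :
    p < n ^ s := by
  have ht : ∀ {m : ℕ} (t : (wdLanguage s ar).Term (Empty ⊕ Fin m)), termVal e t < n := by
    intro m t
    match t with
    | .var (.inr i) => exact he i
    | .var (.inl x) => exact x.elim
    | .func f _ => exact Empty.elim f
  induction φ with
  | falsum | equal | all => simp [qfPoints] at hp
  | rel S ts =>
    cases S with
    | var =>
      simp only [qfPoints, WDRel.points, List.mem_singleton] at hp
      subst hp
      exact tupleCode_lt fun j => ht _
    | sym i => simp [qfPoints, WDRel.points] at hp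
  | imp a b iha ihb =>
    rcases List.mem_append.1 hp with hp | hp
    · exact iha hp
    · exact ihb hp

/-- The values of the first variables are the lowest digits. -/
theorem extends_iff_mod {n m m' : ℕ} (hm : m ≤ m') (ys : Fin m' → Fin n) (xs : Fin m → Fin n) :
    Extends ys xs ↔ (finFunctionFinEquiv ys : ℕ) % n ^ m = finFunctionFinEquiv xs := by
  have hx : ∀ i : Fin m, (xs i : ℕ) = digit n (finFunctionFinEquiv xs) i := fun i => by
    rw [← finFunctionFinEquiv_symm_val, Equiv.symm_apply_apply]
  have hy : ∀ i : Fin m', (ys i : ℕ) = digit n (finFunctionFinEquiv ys) i := fun i => by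
    rw [← finFunctionFinEquiv_symm_val, Equiv.symm_apply_apply]
  have hlt := (finFunctionFinEquiv xs).2
  constructor
  · intro h
    refine eq_of_digit_eq m (Nat.mod_lt _ (by omega)) hlt fun j hj => ?_
    rw [digit_mod_pow _ _ hj, ← hx ⟨j, hj⟩, ← hy ⟨j, by omega⟩, h j hj (by omega)]
  · intro h i hi hi'
    ext
    rw [hx, hy, ← h]
    exact (digit_mod_pow _ _ hi).symm

/-- A `Π₂`-sentence in terms of numbers: an assignment to a block of variables is a number, with the
values of the variables as its digits. -/
theorem QuantPrefix.exists_qfSat {φ : (wdLanguage s ar).Sentence} (h : QuantPrefix true 2 φ) :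
    ∃ (m₁ m₂ : ℕ) (ψ : (wdLanguage s ar).BoundedFormula Empty m₂),
      ∀ (A : WDInstance ar) (S : Finset (Fin s → Fin A.n)) (R : Fin r → ℕ → Prop) (X : ℕ → Prop),
        (∀ i a, R i (finFunctionFinEquiv a) ↔ A.rel i a = true) →
        (∀ a, X (finFunctionFinEquiv a) ↔ a ∈ S) →
        (@FirstOrder.Language.Sentence.Realize _ (Fin A.n) (A.toStructure s S) φ ↔
          ∀ u < A.n ^ m₁, ∃ u' < A.n ^ m₂, u' % A.n ^ m₁ = u ∧ QFSat R X A.n (digit A.n u') ψ) := by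
  obtain ⟨m₁, m₂, ψ, -, hm, hψ, h⟩ := h.forall_exists_qf
  refine ⟨m₁, m₂, ψ, fun A S R X hR hX => ?_⟩
  let _ := A.toStructure s S
  have h1 : (@FirstOrder.Language.Sentence.Realize _ (Fin A.n) (A.toStructure s S) φ ↔ _) :=
    h (Fin A.n) default
  rw [h1]
  have h2 : ∀ zs : Fin m₂ → Fin A.n, QFSat R X A.n (digit A.n (finFunctionFinEquiv zs)) ψ ↔
      ψ.Realize default zs := fun zs => qfSat_iff_realize A S hR hX (fun i => by
    rw [← finFunctionFinEquiv_symm_val, Equiv.symm_apply_apply]) hψ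
  constructor
  · intro hx u hu
    obtain ⟨zs, h3, h4⟩ := hx (finFunctionFinEquiv.symm ⟨u, hu⟩) fun i hi => absurd hi (by omega)
    refine ⟨finFunctionFinEquiv zs, (finFunctionFinEquiv zs).2, ?_, (h2 zs).2 h4⟩
    rw [(extends_iff_mod hm zs _).1 h3, Equiv.apply_symm_apply]
  · intro hx ys _
    obtain ⟨u', hu', h3, h4⟩ := hx _ (finFunctionFinEquiv ys).2
    refine ⟨finFunctionFinEquiv.symm ⟨u', hu'⟩, (extends_iff_mod hm _ _).2 ?_, (h2 _).1 ?_⟩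
    · rw [Equiv.apply_symm_apply]; exact h3
    · rw [Equiv.apply_symm_apply]; exact h4

end

/-! ### Describing a set by its gaps -/

/-- The group of a candidate. A set of `k` numbers less than `N` gives an increasing enumeration of
`k + 2` values less than `b = N + 2`: the rank `0` has the value `0`, the rank `k + 1` has the value
`N + 1`, and the ranks in between have as values the elements plus one. A candidate assigns values
to `D` of these ranks. It is a number less than `K ^ D * b ^ D`, where `K = k + 2`: the `D` lowest
digits in base `b` are the values, and the remaining number, its group, has the ranks as digits in
base `K`. The number of groups depends on `k` and `D` only. -/
def candGroup (b D c : ℕ) : ℕ := c / b ^ D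

/-- The rank that a candidate mentions at the position `j`. -/
def candRank (K b D c j : ℕ) : ℕ := digit K (candGroup b D c) j

/-- The value that a candidate assigns to the rank that it mentions at the position `j`. -/
def candValue (b c j : ℕ) : ℕ := digit b c j

/-- The ranks of `c` are less than those of `c'` exactly where the values are. If this holds in both
directions, then equal ranks have equal values. -/
def CandCompat (K b D c c' : ℕ) : Prop :=
  ∀ j < D, ∀ j' < D, candRank K b D c j < candRank K b D c' j' ↔ candValue b c j < candValue b c' j'

/-- Some two consecutive ranks of `c` have values between which `p + 1` lies. -/
def CandCovers (K b D c p : ℕ) : Prop :=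
  ∃ j < D, ∃ j' < D, candRank K b D c j' = candRank K b D c j + 1 ∧
    candValue b c j ≤ p + 1 ∧ p + 1 < candValue b c j'

/-- According to `c`, the number `p` is an element of the set. -/
def CandMember (K b D c p : ℕ) : Prop :=
  ∃ j < D, 1 ≤ candRank K b D c j ∧ candValue b c j = p + 1

/-- A set can be read off from pairwise compatible candidates, one from every group. By
compatibility, the value of a rank does not depend on the candidate that mentions it, and the values
increase. A candidate that covers `p` mentions consecutive ranks around `p`, so that it decides
whether `p` is an element. -/
theorem exists_set_of_candidates {N k D : ℕ} (hD : 0 < D) (sel : ℕ → ℕ)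
    (hgroup : ∀ g < (k + 2) ^ D, candGroup (N + 2) D (sel g) = g)
    (hcompat : ∀ g < (k + 2) ^ D, ∀ g' < (k + 2) ^ D,
      CandCompat (k + 2) (N + 2) D (sel g) (sel g')) :
    ∃ S : Finset ℕ, S ⊆ Finset.range N ∧ S.card = k ∧
      ∀ g < (k + 2) ^ D, ∀ p < N, CandCovers (k + 2) (N + 2) D (sel g) p →
        (CandMember (k + 2) (N + 2) D (sel g) p ↔ p ∈ S) := by
  classical
  -- the value of the rank `i` is read off from the group all of whose digits are `i`
  have hdiag : ∀ i, ∃ g, i < k + 2 → g < (k + 2) ^ D ∧ ∀ j < D, digit (k + 2) g j = i := by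
    intro i
    by_cases hi : i < k + 2
    · obtain ⟨g, hg, h⟩ := exists_digit_eq (b := k + 2) D (fun _ => i) fun _ _ => hi
      exact ⟨g, fun _ => ⟨hg, h⟩⟩
    · exact ⟨0, fun h => absurd h hi⟩
  choose diag hdiag using hdiag
  set v : ℕ → ℕ := fun i => candValue (N + 2) (sel (diag i)) 0
  have hrank : ∀ i < k + 2, candRank (k + 2) (N + 2) D (sel (diag i)) 0 = i := fun i hi => by
    rw [candRank, hgroup _ (hdiag i hi).1, (hdiag i hi).2 0 hD]
  have hv : ∀ g < (k + 2) ^ D, ∀ j < D,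
      candValue (N + 2) (sel g) j = v (candRank (k + 2) (N + 2) D (sel g) j) := by
    intro g hg j hj
    have hi : candRank (k + 2) (N + 2) D (sel g) j < k + 2 := digit_lt (by omega) _ _
    have h1 := hcompat _ hg _ (hdiag _ hi).1 j hj 0 hD
    have h2 := hcompat _ (hdiag _ hi).1 _ hg 0 hD j hj
    rw [hrank _ hi] at h1 h2
    simp only [lt_irrefl, false_iff, not_lt] at h1 h2
    exact le_antisymm h2 h1
  have hmono : ∀ i < k + 2, ∀ i' < k + 2, i < i' ↔ v i < v i' := by
    intro i hi i' hi'
    have h1 := hcompat _ (hdiag i hi).1 _ (hdiag i' hi').1 0 hD 0 hD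
    rwa [hrank _ hi, hrank _ hi'] at h1
  have hvlt : ∀ i, v i < N + 2 := fun i => digit_lt (by omega) _ _
  refine ⟨(Finset.range N).filter fun p => ∃ i, 1 ≤ i ∧ i ≤ k ∧ v i = p + 1,
    Finset.filter_subset _ _, ?_, ?_⟩
  · have h1 : (Finset.range N).filter (fun p => ∃ i, 1 ≤ i ∧ i ≤ k ∧ v i = p + 1) =
        (Finset.Icc 1 k).image fun i => v i - 1 := by
      ext p
      simp only [Finset.mem_filter, Finset.mem_range, Finset.mem_image, Finset.mem_Icc]
      constructor
      · rintro ⟨_, i, h1, h2, h3⟩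
        exact ⟨i, ⟨h1, h2⟩, by omega⟩
      · rintro ⟨i, ⟨h1, h2⟩, h3⟩
        have h4 := (hmono 0 (by omega) i (by omega)).1 (by omega)
        have h5 := (hmono i (by omega) (k + 1) (by omega)).1 (by omega)
        have h6 := hvlt (k + 1)
        exact ⟨by omega, i, h1, h2, by omega⟩
    rw [h1, Finset.card_image_of_injOn, Nat.card_Icc, Nat.add_sub_cancel]
    intro i hi i' hi' h
    simp only [Finset.coe_Icc, Set.mem_Icc] at hi hi'
    have h2 := (hmono 0 (by omega) i (by omega)).1 (by omega)
    have h3 := (hmono 0 (by omega) i' (by omega)).1 (by omega)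
    have h4 := hmono i (by omega) i' (by omega)
    have h5 := hmono i' (by omega) i (by omega)
    dsimp only at h
    omega
  · rintro g hg p hp ⟨j, hj, j', hj', h1, h2, h3⟩
    rw [hv g hg j hj] at h2
    rw [hv g hg j' hj', h1] at h3
    have hlt : candRank (k + 2) (N + 2) D (sel g) j' < k + 2 := digit_lt (by omega) _ _
    rw [h1] at hlt
    set i := candRank (k + 2) (N + 2) D (sel g) j
    simp only [Finset.mem_filter, Finset.mem_range]
    constructor
    · rintro ⟨l, hl, h4, h5⟩
      rw [hv g hg l hl] at h5
      have hlt' : candRank (k + 2) (N + 2) D (sel g) l < k + 2 := digit_lt (by omega) _ _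
      have h6 := (hmono _ hlt' (i + 1) hlt).2 (by omega)
      exact ⟨hp, _, h4, by omega, h5⟩
    · rintro ⟨_, l, h4, h5, h6⟩
      have h7 := (hmono l (by omega) (i + 1) hlt).2 (by omega)
      have h8 := (hmono l (by omega) i (by omega)).not.2 (by omega)
      have h9 : i = l := by omega
      exact ⟨j, hj, by omega, by rw [hv g hg j hj]; change v i = _; rw [h9, h6]⟩

theorem exists_consecutive {k : ℕ} (v : ℕ → ℕ) {y : ℕ} (h0 : v 0 ≤ y) (h1 : y < v (k + 1)) :
    ∃ i ≤ k, v i ≤ y ∧ y < v (i + 1) := by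
  induction k with
  | zero => exact ⟨0, le_rfl, h0, h1⟩
  | succ k ih =>
    by_cases h : y < v (k + 1)
    · obtain ⟨i, hi, h2⟩ := ih h
      exact ⟨i, by omega, h2⟩
    · exact ⟨k + 1, le_rfl, by omega, h1⟩

/-- The increasing enumeration of a set, shifted by one and with a value added on both sides. -/
theorem exists_enumeration {N k : ℕ} {S : Finset ℕ} (hS : S ⊆ Finset.range N) (hk : S.card = k) :
    ∃ v : ℕ → ℕ, v 0 = 0 ∧ v (k + 1) = N + 1 ∧ (∀ i < k + 2, ∀ i' < k + 2, i < i' ↔ v i < v i') ∧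
      ∀ p, p ∈ S ↔ ∃ i, 1 ≤ i ∧ i ≤ k ∧ v i = p + 1 := by
  let f := S.orderEmbOfFin hk
  let v : ℕ → ℕ := fun i => if h : 1 ≤ i ∧ i ≤ k then f ⟨i - 1, by omega⟩ + 1
    else if i = 0 then 0 else N + 1
  have hv : ∀ i (h : 1 ≤ i ∧ i ≤ k), v i = f ⟨i - 1, by omega⟩ + 1 := fun i h => dif_pos h
  have h0 : v 0 = 0 := by simp [v]
  have hlast : v (k + 1) = N + 1 := by simp [v]
  have hN : ∀ i, f i < N := fun i => Finset.mem_range.1 (hS (S.orderEmbOfFin_mem hk i))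
  have hmono : ∀ i i', i' < k + 2 → i < i' → v i < v i' := by
    intro i i' hi' hlt
    by_cases h' : i' ≤ k
    · rw [hv i' ⟨by omega, h'⟩]
      by_cases h : i = 0
      · subst h; omega
      · rw [hv i ⟨by omega, by omega⟩]
        have : f ⟨i - 1, by omega⟩ < f ⟨i' - 1, by omega⟩ := f.strictMono (by simp; omega)
        omega
    · obtain rfl : i' = k + 1 := by omega
      rw [hlast]
      by_cases h : i = 0
      · subst h; omega
      · rw [hv i ⟨by omega, by omega⟩]
        have := hN ⟨i - 1, by omega⟩
        omega
  refine ⟨v, h0, hlast, fun i hi i' hi' => ⟨hmono i i' hi', fun h => ?_⟩, fun p => ?_⟩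
  · by_contra hle
    rcases (not_lt.1 hle).lt_or_eq with h2 | h2
    · have := hmono i' i hi h2; omega
    · subst h2; omega
  · have : p ∈ S ↔ p ∈ Set.range f := by rw [Finset.range_orderEmbOfFin]; simp
    rw [this]
    constructor
    · rintro ⟨i, rfl⟩
      exact ⟨i + 1, by omega, i.2, hv _ ⟨by omega, i.2⟩⟩
    · rintro ⟨i, h1, h2, h3⟩
      rw [hv i ⟨h1, h2⟩] at h3
      exact ⟨_, Nat.succ.inj h3⟩

/-- For every set there are pairwise compatible candidates, one from every group, so that any few
numbers are covered by one of them. -/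
theorem exists_candidates_of_set {N k D : ℕ} {S : Finset ℕ} (hS : S ⊆ Finset.range N)
    (hk : S.card = k) :
    ∃ sel : ℕ → ℕ,
      (∀ g < (k + 2) ^ D, sel g < (k + 2) ^ D * (N + 2) ^ D ∧ candGroup (N + 2) D (sel g) = g) ∧
      (∀ g g', CandCompat (k + 2) (N + 2) D (sel g) (sel g')) ∧
      ∀ pts : List ℕ, 2 * pts.length ≤ D → (∀ p ∈ pts, p < N) → ∃ g < (k + 2) ^ D, ∀ p ∈ pts,
        CandCovers (k + 2) (N + 2) D (sel g) p ∧
          (CandMember (k + 2) (N + 2) D (sel g) p ↔ p ∈ S) := by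
  obtain ⟨v, h0, hlast, hmono, hmem⟩ := exists_enumeration hS hk
  have hvlt : ∀ i < k + 2, v i < N + 2 := by
    intro i hi
    by_cases h : i = k + 1
    · rw [h, hlast]; omega
    · have := (hmono i hi (k + 1) (by omega)).1 (by omega)
      omega
  have hd : ∀ g j, digit (k + 2) g j < k + 2 := fun g j => digit_lt (by omega) _ _
  choose x hx hxd using fun g => exists_digit_eq (b := N + 2) D (fun j => v (digit (k + 2) g j))
    fun j _ => hvlt _ (hd g j)
  set sel : ℕ → ℕ := fun g => g * (N + 2) ^ D + x g
  have hgroup : ∀ g, candGroup (N + 2) D (sel g) = g := by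
    intro g
    change (g * (N + 2) ^ D + x g) / (N + 2) ^ D = g
    rw [Nat.mul_comm, Nat.mul_add_div (by positivity), Nat.div_eq_of_lt (hx g), add_zero]
  have hval : ∀ g, ∀ j < D, candValue (N + 2) (sel g) j = v (digit (k + 2) g j) := by
    intro g j hj
    have hmod : sel g % (N + 2) ^ D = x g := by
      change (g * (N + 2) ^ D + x g) % (N + 2) ^ D = x g
      rw [Nat.mul_comm, Nat.mul_add_mod, Nat.mod_eq_of_lt (hx g)]
    rw [candValue, ← digit_mod_pow _ _ hj, hmod, hxd g j hj]
  refine ⟨sel, fun g hg => ⟨?_, hgroup g⟩, ?_, ?_⟩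
  · have := hx g
    calc sel g < (g + 1) * (N + 2) ^ D := by rw [add_mul, one_mul]; simp only [sel]; omega
      _ ≤ _ := Nat.mul_le_mul_right _ hg
  · intro g g' j hj j' hj'
    rw [candRank, candRank, hgroup, hgroup, hval g j hj, hval g' j' hj']
    exact hmono _ (hd ..) _ (hd ..)
  · intro pts hpts hN
    have hgap : ∀ p, ∃ i, p < N → i ≤ k ∧ v i ≤ p + 1 ∧ p + 1 < v (i + 1) := by
      intro p
      by_cases hp : p < N
      · obtain ⟨i, h⟩ := exists_consecutive (k := k) v (y := p + 1) (by omega) (by omega)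
        exact ⟨i, fun _ => h⟩
      · exact ⟨0, fun h => absurd h hp⟩
    choose gap hgap using hgap
    -- the group that mentions the two ranks on either side of every one of the points
    set L := pts.flatMap fun p => [gap p, gap p + 1]
    have hL : L.length ≤ D := by simp [L]; omega
    have hLlt : ∀ j, L.getD j 0 < k + 2 := by
      intro j
      by_cases hj : j < L.length
      · rw [List.getD_eq_getElem _ _ hj]
        obtain ⟨p, hp, h⟩ := List.mem_flatMap.1 (List.getElem_mem hj)
        have := hgap p (hN p hp)
        simp only [List.mem_cons, List.not_mem_nil, or_false] at h
        omega
      · rw [List.getD_eq_default _ _ (by omega)]; omega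
    obtain ⟨g, hg, hgd⟩ := exists_digit_eq (b := k + 2) D (fun j => L.getD j 0) fun j _ => hLlt j
    have hidx : ∀ i ∈ L, ∃ j < D, digit (k + 2) g j = i := by
      intro i hi
      obtain ⟨j, hj, rfl⟩ := List.mem_iff_getElem.1 hi
      exact ⟨j, by omega, by rw [hgd j (by omega), List.getD_eq_getElem _ _ hj]⟩
    refine ⟨g, hg, fun p hp => ?_⟩
    obtain ⟨h1, h2, h3⟩ := hgap p (hN p hp)
    obtain ⟨j, hj, hji⟩ := hidx (gap p) (List.mem_flatMap.2 ⟨p, hp, by simp⟩)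
    obtain ⟨j', hj', hji'⟩ := hidx (gap p + 1) (List.mem_flatMap.2 ⟨p, hp, by simp⟩)
    refine ⟨⟨j, hj, j', hj', ?_, ?_, ?_⟩, ?_⟩
    · rw [candRank, candRank, hgroup, hji, hji']
    · rwa [hval g j hj, hji]
    · rwa [hval g j' hj', hji']
    · rw [hmem]
      constructor
      · rintro ⟨l, hl, h4, h5⟩
        rw [candRank, hgroup] at h4
        rw [hval g l hl] at h5
        have h6 := (hmono _ (hd g l) (k + 1) (by omega)).2 (by have := hN p hp; omega)
        exact ⟨_, h4, by omega, h5⟩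
      · rintro ⟨i, h4, h5, h6⟩
        have h7 := (hmono i (by omega) (gap p + 1) (by omega)).2 (by omega)
        have h8 := (hmono i (by omega) (gap p) (by omega)).not.2 (by omega)
        have h9 : gap p = i := by omega
        refine ⟨j, hj, ?_, ?_⟩
        · rw [candRank, hgroup, hji]; omega
        · rw [hval g j hj, hji, h9, h6]

/-! ### Constraints on candidates -/

/-- The number of candidates, for `K` ranks, `b` values and `D` positions. -/
def candCount (K b D : ℕ) : ℕ := K ^ D * b ^ D

section

variable {r s : ℕ} {ar : Fin r → ℕ} {m₂ : ℕ}

/-- The number of positions of a candidate: the two ends of a gap for every atom with the relation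
variable, and one more, so that the number is positive. -/
def candLength (ψ : (wdLanguage s ar).BoundedFormula Empty m₂) : ℕ := 2 * qfCount ψ + 1

/-- If the candidate `e` is selected in its group, and `c` in the group of `e'`, then `e` and `c`
are compatible. As a condition on a single selected candidate `c`: it is another one from the group
of `e`, or it is the one from the group of `e'`, and compatible. -/
def RespectsChoice (K b D e e' c : ℕ) : Prop :=
  (candGroup b D c = candGroup b D e ∧ c ≠ e) ∨
    (candGroup b D c = candGroup b D e' ∧ CandCompat K b D e c)

/-- The matrix `ψ` holds for some extension of the tuple `u` of the values of the universal
variables, and the candidate `c` covers all the points that this depends on. -/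
def ForcesMatrix (R : Fin r → ℕ → Prop) (n k m₁ : ℕ)
    (ψ : (wdLanguage s ar).BoundedFormula Empty m₂) (u c : ℕ) : Prop :=
  ∃ u' < n ^ m₂, u' % n ^ m₁ = u ∧
    (∀ p ∈ qfPoints n (digit n u') ψ, CandCovers (k + 2) (n ^ s + 2) (candLength ψ) c p) ∧
    QFSat R (CandMember (k + 2) (n ^ s + 2) (candLength ψ) c) n (digit n u') ψ

/-- The candidate `c` satisfies the constraint `q`. With `P` the number of candidates, the
constraint `e * P + e'` with `e, e' < P` is about the choice of `e` and of a candidate in the group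
of `e'`, and the constraint `P * P + u` is about the tuple `u` of values of the universal variables.
-/
def CandSatisfies (R : Fin r → ℕ → Prop) (n k m₁ : ℕ)
    (ψ : (wdLanguage s ar).BoundedFormula Empty m₂) (q c : ℕ) : Prop :=
  (q < candCount (k + 2) (n ^ s + 2) (candLength ψ) *
      candCount (k + 2) (n ^ s + 2) (candLength ψ) ∧
    RespectsChoice (k + 2) (n ^ s + 2) (candLength ψ)
      (q / candCount (k + 2) (n ^ s + 2) (candLength ψ))
      (q % candCount (k + 2) (n ^ s + 2) (candLength ψ)) c) ∨
  (candCount (k + 2) (n ^ s + 2) (candLength ψ) *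
      candCount (k + 2) (n ^ s + 2) (candLength ψ) ≤ q ∧
    ForcesMatrix R n k m₁ ψ (q - candCount (k + 2) (n ^ s + 2) (candLength ψ) *
      candCount (k + 2) (n ^ s + 2) (candLength ψ)) c)

/-- The number of constraints. -/
def constraintCount (n k m₁ : ℕ) (ψ : (wdLanguage s ar).BoundedFormula Empty m₂) : ℕ :=
  candCount (k + 2) (n ^ s + 2) (candLength ψ) * candCount (k + 2) (n ^ s + 2) (candLength ψ) +
    n ^ m₁

variable {m₁ : ℕ} {ψ : (wdLanguage s ar).BoundedFormula Empty m₂} {n k : ℕ} {R : Fin r → ℕ → Prop}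

/-- The constraints `e * P + e'` force one candidate per group, since the constraint `e * P + e` can
only be satisfied within the group of `e`, and there are as many groups as selected candidates. -/
theorem exists_set_of_candSatisfies (hn : 0 < n) {ι : Type} [Fintype ι]
    (hι : Fintype.card ι = (k + 2) ^ candLength ψ) {σ : ι → ℕ}
    (hσ : ∀ i, σ i < candCount (k + 2) (n ^ s + 2) (candLength ψ))
    (h : ∀ q < constraintCount n k m₁ ψ, ∃ i, CandSatisfies R n k m₁ ψ q (σ i)) :
    ∃ S : Finset ℕ, S ⊆ Finset.range (n ^ s) ∧ S.card = k ∧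
      ∀ u < n ^ m₁, ∃ u' < n ^ m₂, u' % n ^ m₁ = u ∧ QFSat R (· ∈ S) n (digit n u') ψ := by
  simp only [CandSatisfies, RespectsChoice, ForcesMatrix, constraintCount] at h
  set D := candLength ψ with hD
  set b := n ^ s + 2
  have hb : 0 < b ^ D := by positivity
  set P := candCount (k + 2) b D with hP
  have hpair : ∀ c < P, ∀ e < P, ∃ i,
      (candGroup b D (σ i) = candGroup b D c ∧ σ i ≠ c) ∨
        (candGroup b D (σ i) = candGroup b D e ∧ CandCompat (k + 2) b D c (σ i)) := by
    intro c hc e he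
    have hlt : c * P + e < P * P := by nlinarith
    have h1 : (c * P + e) / P = c := by
      rw [Nat.mul_comm, Nat.mul_add_div (by omega), Nat.div_eq_of_lt he, add_zero]
    have h2 : (c * P + e) % P = e := by
      rw [Nat.mul_comm, Nat.mul_add_mod, Nat.mod_eq_of_lt he]
    obtain ⟨i, ⟨-, h3⟩ | ⟨h3, -⟩⟩ := h (c * P + e) (by omega)
    · rw [h1, h2] at h3
      exact ⟨i, h3⟩
    · omega
  have hgrp : ∀ c < P, candGroup b D c < (k + 2) ^ D := fun c hc =>
    Nat.div_lt_of_lt_mul (by rw [Nat.mul_comm]; exact hc)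
  have hsurj : Function.Surjective fun i => (⟨candGroup b D (σ i), hgrp _ (hσ i)⟩ :
      Fin ((k + 2) ^ D)) := by
    rintro ⟨g, hg⟩
    have h1 : candGroup b D (g * b ^ D) = g := Nat.mul_div_cancel _ hb
    have h2 : g * b ^ D < P := Nat.mul_lt_mul_of_pos_right hg hb
    obtain ⟨i, ⟨h3, -⟩ | ⟨h3, -⟩⟩ := hpair _ h2 _ h2
    all_goals exact ⟨i, Fin.ext (h3.trans h1)⟩
  have hinj := ((Fintype.bijective_iff_surjective_and_card _).2 ⟨hsurj, by simp [hι]⟩).1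
  have hinj' : ∀ i i', candGroup b D (σ i) = candGroup b D (σ i') → σ i = σ i' :=
    fun i i' h => congrArg σ (hinj (Fin.ext h))
  have hsel : ∀ g, ∃ c, g < (k + 2) ^ D → candGroup b D c = g ∧ ∃ i, σ i = c := by
    intro g
    by_cases hg : g < (k + 2) ^ D
    · obtain ⟨i, hi⟩ := hsurj ⟨g, hg⟩
      exact ⟨σ i, fun _ => ⟨congrArg Fin.val hi, i, rfl⟩⟩
    · exact ⟨0, fun h => absurd h hg⟩
  choose sel hsel using hsel
  obtain ⟨S, hS, hk, hS'⟩ := exists_set_of_candidates (N := n ^ s) (k := k) (D := D)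
    (by simp [hD, candLength]) sel (fun g hg => (hsel g hg).1) (by
      intro g hg g' hg'
      obtain ⟨h1, i, hi⟩ := hsel g hg
      obtain ⟨h1', i', hi'⟩ := hsel g' hg'
      obtain ⟨l, ⟨h2, h3⟩ | ⟨h2, h3⟩⟩ := hpair (σ i) (hσ i) (σ i') (hσ i')
      · exact absurd (hinj' _ _ h2) h3
      · rw [← hi, ← hi', ← hinj' _ _ h2]
        exact h3)
  refine ⟨S, hS, hk, fun u hu => ?_⟩
  obtain ⟨i, ⟨h1, -⟩ | ⟨-, u', hu', h2, h3, h4⟩⟩ := h (P * P + u) (by omega)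
  · omega
  · refine ⟨u', hu', by omega, (qfSat_congr R n _ ψ fun p hp => ?_).1 h4⟩
    have hg := hgrp _ (hσ i)
    obtain ⟨h5, i', h6⟩ := hsel _ hg
    have h7 : sel (candGroup b D (σ i)) = σ i := by
      rw [← h6] at h5 ⊢
      exact hinj' _ _ h5
    have h8 := hS' _ hg p (lt_of_mem_qfPoints (fun i => digit_lt hn _ _) ψ hp)
    rw [h7] at h8
    exact h8 (h3 p hp)

/-- The candidates that describe a set satisfy all the constraints. -/
theorem exists_candSatisfies_of_set (hn : 0 < n) {S : Finset ℕ} (hS : S ⊆ Finset.range (n ^ s))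
    (hk : S.card = k)
    (h : ∀ u < n ^ m₁, ∃ u' < n ^ m₂, u' % n ^ m₁ = u ∧ QFSat R (· ∈ S) n (digit n u') ψ) :
    ∃ σ : Fin ((k + 2) ^ candLength ψ) → ℕ,
      (∀ i, σ i < candCount (k + 2) (n ^ s + 2) (candLength ψ)) ∧
      ∀ q < constraintCount n k m₁ ψ, ∃ i, CandSatisfies R n k m₁ ψ q (σ i) := by
  obtain ⟨sel, h1, h2, h3⟩ := exists_candidates_of_set (D := candLength ψ) hS hk
  refine ⟨fun i => sel i, fun i => (h1 i i.2).1, fun q hq => ?_⟩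
  simp only [CandSatisfies, RespectsChoice, ForcesMatrix]
  rw [constraintCount] at hq
  set D := candLength ψ with hD
  set b := n ^ s + 2
  set P := candCount (k + 2) b D with hP
  have hgrp : ∀ c < P, candGroup b D c < (k + 2) ^ D := fun c hc =>
    Nat.div_lt_of_lt_mul (by rw [Nat.mul_comm]; exact hc)
  by_cases hqP : q < P * P
  · have hc : q / P < P := Nat.div_lt_of_lt_mul hqP
    have he : q % P < P := Nat.mod_lt _ (by rw [hP, candCount]; positivity)
    by_cases heq : sel (candGroup b D (q / P)) = q / P
    · refine ⟨⟨_, hgrp _ he⟩, .inl ⟨hqP, .inr ⟨(h1 _ (hgrp _ he)).2, ?_⟩⟩⟩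
      have := h2 (candGroup b D (q / P)) (candGroup b D (q % P))
      rwa [heq] at this
    · exact ⟨⟨_, hgrp _ hc⟩, .inl ⟨hqP, .inl ⟨(h1 _ (hgrp _ hc)).2, heq⟩⟩⟩
  · obtain ⟨u', hu', h4, h5⟩ := h (q - P * P) (by omega)
    obtain ⟨g, hg, h6⟩ := h3 (qfPoints n (digit n u') ψ)
      (by rw [length_qfPoints, hD, candLength]; omega)
      (fun p hp => lt_of_mem_qfPoints (fun i => digit_lt hn _ _) ψ hp)
    exact ⟨⟨g, hg⟩, .inr ⟨by omega, u', hu', h4, fun p hp => (h6 p hp).1,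
      (qfSat_congr R n _ ψ fun p hp => (h6 p hp).2).2 h5⟩⟩

/-- Weighted definability for a formula in `Π₂` is a hitting set problem: to select a number of
candidates that depends on the parameter only, such that every constraint is satisfied by one of
them. -/
theorem QuantPrefix.exists_candSatisfies {φ : (wdLanguage s ar).Sentence}
    (h : QuantPrefix true 2 φ) :
    ∃ (m₁ m₂ : ℕ) (ψ : (wdLanguage s ar).BoundedFormula Empty m₂),
      ∀ (A : WDInstance ar) (R : Fin r → ℕ → Prop),
        (∀ i a, R i (finFunctionFinEquiv a) ↔ A.rel i a = true) →
        ((weightedDefinability φ).Yes A ↔ ∃ σ : Fin ((A.k + 2) ^ candLength ψ) → ℕ,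
          (∀ i, σ i < candCount (A.k + 2) (A.n ^ s + 2) (candLength ψ)) ∧
          ∀ q < constraintCount A.n A.k m₁ ψ, ∃ i, CandSatisfies R A.n A.k m₁ ψ q (σ i)) := by
  classical
  obtain ⟨m₁, m₂, ψ, hψ⟩ := h.exists_qfSat
  refine ⟨m₁, m₂, ψ, fun A R hR => ⟨?_, ?_⟩⟩
  · rintro ⟨S, hS, hφ⟩
    have hinj : Function.Injective fun a : Fin s → Fin A.n => (finFunctionFinEquiv a : ℕ) :=
      Fin.val_injective.comp finFunctionFinEquiv.injective
    refine exists_candSatisfies_of_set A.n_pos (S := S.image fun a => (finFunctionFinEquiv a : ℕ))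
      ?_ ((Finset.card_image_of_injective S hinj).trans hS)
      ((hψ A S R _ hR fun a => ?_).1 hφ)
    · intro p hp
      obtain ⟨a, -, rfl⟩ := Finset.mem_image.1 hp
      exact Finset.mem_range.2 (finFunctionFinEquiv a).2
    · exact hinj.mem_finset_image
  · rintro ⟨σ, hσ, hq⟩
    obtain ⟨S, hS, hk, hall⟩ := exists_set_of_candSatisfies A.n_pos (Fintype.card_fin _) hσ hq
    refine ⟨Finset.univ.filter fun a => (finFunctionFinEquiv a : ℕ) ∈ S, ?_,
      (hψ A _ R _ hR fun a => by simp).2 hall⟩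
    rw [← hk]
    refine Finset.card_bij (fun a _ => (finFunctionFinEquiv a : ℕ)) (by simp) (fun a _ a' _ h => ?_)
      fun p hp => ?_
    · exact finFunctionFinEquiv.injective (Fin.ext h)
    · have he : (finFunctionFinEquiv (finFunctionFinEquiv.symm
          (⟨p, Finset.mem_range.1 (hS hp)⟩ : Fin (A.n ^ s))) : ℕ) = p := by
        rw [Equiv.apply_symm_apply]
      refine ⟨_, Finset.mem_filter.2 ⟨Finset.mem_univ _, ?_⟩, he⟩
      rwa [he]

end

/-! ### Sink location and dominating sets -/

section

variable {n : ℕ} (G : SimpleGraph (Fin n))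

open Classical in
/-- The network on a graph with unit transit times, unit capacities and unit supplies. -/
noncomputable def unitNetwork : DynamicNetwork where
  n := n
  graph := G
  cap e := if e ∈ G.edgeSet then 1 else 0
  time e := if e ∈ G.edgeSet then 1 else 0
  adj_iff u v := by
    rw [← SimpleGraph.mem_edgeSet]
    split_ifs with h <;> simp [h]
  cap_eq_zero u v h := if_neg h
  supply _ := 1

theorem unitNetwork_isUnit : (unitNetwork G).IsUnit := fun _ _ h => ⟨if_pos h, if_pos h⟩

end

namespace DynamicNetwork

variable {N : DynamicNetwork}

theorem IsUnit.time_le (hN : N.IsUnit) (u v : Fin N.n) : N.time s(u, v) ≤ 1 := by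
  by_cases h : N.graph.Adj u v
  · exact (hN u v h).1.le
  · have := (N.adj_iff u v).not.1 h
    omega

/-- A vertex without a sink sends its unit to a neighbour; as it cannot forward a
unit that it receives, the units go to neighbours with a sink. -/
theorem IsUnit.exists_dominating_of_routing (hN : N.IsUnit) (hs : ∀ v, N.supply v = 1) {k : ℕ}
    (X : Fin k → N.Position) (ρ : N.Routing X 1) :
    ∃ d : Fin k → Fin N.n, ∀ v, ∃ j, d j = v ∨ N.graph.Adj v (d j) := by
  have htime : ∀ j, (X j).du + (X j).dv = 1 := fun j =>
    (X j).add_eq.trans ((hN _ _ (X j).adj).1)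
  refine ⟨fun j => if (X j).du = 0 then (X j).u else (X j).v, fun v => ?_⟩
  have hsink : ∀ v, N.SinkAt X v →
      ∃ j, (if (X j).du = 0 then (X j).u else (X j).v) = v := by
    rintro v ⟨w, j, ⟨h1, h2, h3⟩ | ⟨h1, h2, h3⟩⟩
    · exact ⟨j, by rw [if_pos h3, h1]⟩
    · have := htime j
      exact ⟨j, by rw [if_neg (by omega), h1]⟩
  by_cases hv : N.SinkAt X v
  · obtain ⟨j, hj⟩ := hsink v hv
    exact ⟨j, .inl hj⟩
  have hin : ∀ v w : Fin N.n, N.time s(w, v) - 1 = 0 := fun v w => by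
    have := hN.time_le w v
    omega
  have hcons : ∀ v : Fin N.n, ρ.stock v 1 + ∑ w : Fin N.n, ρ.flow v w 0 0 =
      1 + ∑ w : Fin N.n, ρ.flow w v 0 0 := by
    intro v
    have h1 := ρ.conservation v 0
    have h2 : ρ.stock v 0 = 1 := (ρ.stock_zero v).trans (hs v)
    rw [h2] at h1
    refine h1.trans ?_
    congr 1
    exact Finset.sum_congr rfl fun w _ => by rw [hin]
  have h1 := hcons v
  rw [ρ.finished v hv] at h1
  obtain ⟨w, -, hw⟩ := Finset.exists_ne_zero_of_sum_ne_zero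
    (show ∑ w : Fin N.n, ρ.flow v w 0 0 ≠ 0 by omega)
  have hadj : N.graph.Adj v w := (ρ.support v w 0 0 hw).1
  by_cases hw' : N.SinkAt X w
  · obtain ⟨j, hj⟩ := hsink w hw'
    exact ⟨j, .inr (by dsimp only; rwa [hj])⟩
  · exfalso
    have h2 := hcons w
    have h3 : ∑ w' : Fin N.n, ρ.flow w w' 0 0 ≤ ρ.stock w 0 := ρ.departures_le w 0
    have h4 : ρ.stock w 0 = 1 := (ρ.stock_zero w).trans (hs w)
    have h5 : ρ.flow v w 0 0 ≤ ∑ v' : Fin N.n, ρ.flow v' w 0 0 :=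
      Finset.single_le_sum (f := fun v' : Fin N.n => ρ.flow v' w 0 0) (fun _ _ => Nat.zero_le _)
        (Finset.mem_univ v)
    rw [ρ.finished w hw'] at h2
    omega

/-- From a dominating set, every vertex outside sends its unit to a neighbour in the set. The
vertices of the set have neighbours because only points of edges are positions. -/
theorem IsUnit.exists_routing_of_dominating (hN : N.IsUnit) (hs : ∀ v, N.supply v = 1) {k : ℕ}
    (d : Fin k → Fin N.n) (hd : ∀ j, ∃ w, N.graph.Adj (d j) w)
    (h : ∀ v, ∃ j, d j = v ∨ N.graph.Adj v (d j)) :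
    ∃ X : Fin k → N.Position, Nonempty (N.Routing X 1) := by
  classical
  choose nb hnb using hd
  choose tgt htgt using h
  have hin : ∀ v w : Fin N.n, N.time s(w, v) - 1 = 0 := fun v w => by
    have := hN.time_le w v
    omega
  let X : Fin k → N.Position := fun j =>
    { u := d j, v := nb j, adj := hnb j, du := 0, dv := 1
      add_eq := ((hN _ _ (hnb j)).1).symm }
  let flow : Fin N.n → Fin N.n → ℕ → ℕ → ℕ := fun v w e t =>
    if e = 0 ∧ t = 0 ∧ (∀ j, d j ≠ v) ∧ w = d (tgt v) then 1 else 0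
  have hflow : ∀ v w e t, flow v w e t ≠ 0 →
      e = 0 ∧ t = 0 ∧ (∀ j, d j ≠ v) ∧ w = d (tgt v) := by
    intro v w e t h
    by_contra h'
    exact h (if_neg h')
  have hadj : ∀ v w e t, flow v w e t ≠ 0 → N.graph.Adj v w := by
    intro v w e t h
    obtain ⟨-, -, h1, rfl⟩ := hflow v w e t h
    exact (htgt v).resolve_left (h1 _)
  have hout : ∀ v, ∑ w, flow v w 0 0 = if ∀ j, d j ≠ v then 1 else 0 := by
    intro v
    by_cases hv : ∀ j, d j ≠ v <;> simp [flow, hv]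
  have hlate : ∀ v w e t, flow v w e (t + 1) = 0 := fun v w e t => if_neg (by simp)
  let stock : Fin N.n → ℕ → ℕ := fun v t =>
    if t = 0 then 1 else 1 + ∑ w, flow w v 0 0 - ∑ w, flow v w 0 0
  refine ⟨X, ⟨{
    flow := flow
    stock := stock
    support := fun v w e t h => ?_
    capacity := fun v w e t => ?_
    one_way := fun v w e e' t _ => ?_
    inner_le := fun v w e t h => ?_
    inner_eq := fun v w e t h => ?_
    inner_zero := fun v w e => if_neg (by simp)
    stock_zero := fun v => (hs v).symm
    departures_le := fun v t => ?_
    conservation := fun v t => ?_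
    finished := fun v hv => ?_ }⟩⟩
  · have h1 := hadj v w e t h
    obtain ⟨rfl, rfl, -, -⟩ := hflow v w e t h
    exact ⟨h1, by rw [(hN _ _ h1).1]; omega, by omega⟩
  · by_cases h : flow v w e t = 0
    · rw [h]; exact Nat.zero_le _
    · rw [(hN _ _ (hadj v w e t h)).2]
      simp only [flow]
      split_ifs <;> omega
  · by_contra! h
    obtain ⟨-, -, -, h1⟩ := hflow v w e t h.1
    exact (hflow w v e' t h.2).2.2.1 _ h1.symm
  · have := hN.time_le v w; omega
  · have := hN.time_le v w; omega
  · rcases t with _ | t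
    · change ∑ w, flow v w 0 0 ≤ 1
      rw [hout]
      split_ifs <;> omega
    · simp [hlate]
  · have h1 : ∑ w : Fin N.n, flow w v (N.time s(w, v) - 1) t = ∑ w, flow w v 0 t :=
      Finset.sum_congr rfl fun w _ => by rw [hin]
    refine Eq.trans ?_ (congrArg (stock v t + ·) h1.symm)
    rcases t with _ | t
    · have h2 : ∑ w, flow v w 0 0 ≤ 1 := by rw [hout]; split_ifs <;> omega
      simp only [stock, if_pos, zero_add, one_ne_zero, if_false]
      omega
    · simp [hlate, stock]
  · have hv' : ∀ j, d j ≠ v := fun j hj => hv ⟨nb j, j, .inl ⟨hj, rfl, rfl⟩⟩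
    have h1 : ∑ w, flow w v 0 0 = 0 := Finset.sum_eq_zero fun w _ => by
      by_contra h
      exact hv' _ (hflow w v 0 0 h).2.2.2.symm
    simp [stock, h1, hout, hv']

end DynamicNetwork

section

variable {P Q κ : ℕ} {Hit : ℕ → ℕ → Prop}

/-- The adjacency of a graph whose dominating sets of size `κ` are the selections of `κ` of the
candidates `0, …, P - 1` that hit all the constraints `0, …, Q - 1`. The vertices below `P`
are the candidates, pairwise adjacent, and `P + c * Q + q` is the copy `c` of the constraint `q`,
adjacent to the candidates that hit it. -/
def ConstraintAdj (P Q : ℕ) (Hit : ℕ → ℕ → Prop) (v w : ℕ) : Prop :=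
  (v < P ∧ w < P ∧ v ≠ w) ∨ (v < P ∧ P ≤ w ∧ Hit ((w - P) % Q) v) ∨
    (w < P ∧ P ≤ v ∧ Hit ((v - P) % Q) w)

/-- The graph of candidates and constraints, with `κ + 1` copies of every constraint, one of which
is not itself among `κ` chosen vertices. -/
def constraintGraph (P Q κ : ℕ) (Hit : ℕ → ℕ → Prop) : SimpleGraph (Fin (P + (κ + 1) * Q)) where
  Adj v w := ConstraintAdj P Q Hit v w
  symm := ⟨fun v w h => by
    rcases h with ⟨h1, h2, h3⟩ | h | h
    · exact .inl ⟨h2, h1, h3.symm⟩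
    · exact .inr (.inr h)
    · exact .inr (.inl h)⟩
  loopless := ⟨fun v h => by
    rcases h with ⟨-, -, h⟩ | ⟨h, h', -⟩ | ⟨h, h', -⟩
    · exact h rfl
    all_goals omega⟩

/-- Some copy of every constraint is not chosen itself, so a chosen candidate dominates it. -/
theorem exists_hitting_of_dominating {d : Fin κ → Fin (P + (κ + 1) * Q)}
    (h : ∀ v, ∃ j, d j = v ∨ (constraintGraph P Q κ Hit).Adj v (d j)) (hP : 0 < P) :
    ∃ σ : Fin κ → ℕ, (∀ i, σ i < P) ∧ ∀ q < Q, ∃ i, Hit q (σ i) := by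
  refine ⟨fun i => if (d i : ℕ) < P then d i else 0, fun i => ?_, fun q hq => ?_⟩
  · dsimp only
    split_ifs with h <;> assumption
  · have hlt : ∀ c : Fin (κ + 1), P + (c * Q + q) < P + (κ + 1) * Q := fun c => by
      have := Nat.mul_le_mul_right Q (show (c : ℕ) + 1 ≤ κ + 1 by omega)
      rw [add_mul (c : ℕ), one_mul] at this
      omega
    have hcopy : ∃ c : Fin (κ + 1), ∀ j, d j ≠ ⟨P + (c * Q + q), hlt c⟩ := by
      by_contra! hall
      choose j hj using hall
      obtain ⟨c, c', hne, heq⟩ := Fintype.exists_ne_map_eq_of_card_lt j (by simp)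
      have h1 := (hj c).symm.trans (heq ▸ hj c')
      simp only [Fin.mk.injEq] at h1
      exact hne (Fin.ext (Nat.eq_of_mul_eq_mul_right (by omega : 0 < Q) (by omega)))
    obtain ⟨c, hc⟩ := hcopy
    obtain ⟨j, hj | hj⟩ := h ⟨P + (c * Q + q), hlt c⟩
    · exact absurd hj (hc j)
    · rcases hj with ⟨h1, -, -⟩ | ⟨h1, -, -⟩ | ⟨h1, -, h2⟩
      · dsimp only at h1; omega
      · dsimp only at h1; omega
      · refine ⟨j, ?_⟩
        simp only [if_pos h1]
        simpa [Nat.mod_eq_of_lt hq] using h2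

theorem exists_dominating_of_hitting {σ : Fin κ → ℕ} (hσ : ∀ i, σ i < P)
    (h : ∀ q < Q, ∃ i, Hit q (σ i)) (hP : 2 ≤ P) (hκ : 0 < κ) :
    ∃ d : Fin κ → Fin (P + (κ + 1) * Q), (∀ j, ∃ w, (constraintGraph P Q κ Hit).Adj (d j) w) ∧
      ∀ v, ∃ j, d j = v ∨ (constraintGraph P Q κ Hit).Adj v (d j) := by
  refine ⟨fun j => ⟨σ j, (hσ j).trans_le (Nat.le_add_right _ _)⟩, fun j => ?_, fun v => ?_⟩
  · by_cases hj : σ j = 0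
    · exact ⟨⟨1, by omega⟩, .inl ⟨hσ j, hP, by simp [hj]⟩⟩
    · exact ⟨⟨0, by omega⟩, .inl ⟨hσ j, by simp; omega, hj⟩⟩
  · by_cases hv : (v : ℕ) < P
    · refine ⟨⟨0, hκ⟩, ?_⟩
      by_cases hne : σ ⟨0, hκ⟩ = v
      · exact .inl (Fin.ext hne)
      · exact .inr (.inl ⟨hv, hσ _, fun h => hne h.symm⟩)
    · have hQ : 0 < Q := by
        rcases Nat.eq_zero_or_pos Q with rfl | hQ
        · have := v.2; omega
        · exact hQ
      obtain ⟨i, hi⟩ := h ((v - P) % Q) (Nat.mod_lt _ hQ)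
      exact ⟨i, .inr (.inr (.inr ⟨hσ i, by omega, hi⟩))⟩

/-- The instance of sink location with the graph of candidates and constraints, `κ` sinks and the
deadline `1`. -/
noncomputable def constraintInstance (P Q κ : ℕ) (Hit : ℕ → ℕ → Prop) : SinkInstance where
  net := unitNetwork (constraintGraph P Q κ Hit)
  k := κ
  T := 1

/-- Sink location is the hitting set problem. There have to be two candidates, because an isolated
vertex is not a point of an edge. -/
theorem yes_constraintInstance (hP : 2 ≤ P) (hκ : 0 < κ) :
    sinkLocation.Yes (constraintInstance P Q κ Hit) ↔
      ∃ σ : Fin κ → ℕ, (∀ i, σ i < P) ∧ ∀ q < Q, ∃ i, Hit q (σ i) := by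
  constructor
  · rintro ⟨X, ⟨ρ⟩⟩
    obtain ⟨d, hd⟩ := (unitNetwork_isUnit _).exists_dominating_of_routing (fun _ => rfl) X ρ
    exact exists_hitting_of_dominating hd (by omega)
  · rintro ⟨σ, hσ, h⟩
    obtain ⟨d, hd, hd'⟩ := exists_dominating_of_hitting hσ h hP hκ
    exact (unitNetwork_isUnit _).exists_routing_of_dominating (fun _ => rfl) d hd hd'

end

/-! ### Writing down the instance -/

theorem List.map_range_append {α : Type} (a b : ℕ) (f g : ℕ → α) :
    (List.range a).map f ++ (List.range b).map g =
      (List.range (a + b)).map fun i => if i < a then f i else g (i - a) := by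
  rw [List.range_add, List.map_append, List.map_map]
  congr 1
  · exact List.map_congr_left fun i hi => (if_pos (List.mem_range.1 hi)).symm
  · exact List.map_congr_left fun i _ => by simp

theorem List.flatMap_range_map_range {α : Type} (n m : ℕ) (g : ℕ → ℕ → α) :
    ((List.range n).flatMap fun u => (List.range m).map (g u)) =
      (List.range (n * m)).map fun j => g (j / m) (j % m) := by
  induction n with
  | zero => simp
  | succ n ih =>
    rw [List.range_succ, List.flatMap_append, ih, Nat.succ_mul, List.range_add, List.map_append,
      List.flatMap_singleton, List.map_map]
    congr 1
    refine List.map_congr_left fun i hi => ?_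
    have hi := List.mem_range.1 hi
    simp only [Function.comp_apply]
    rw [Nat.mul_comm, Nat.mul_add_div (by omega), Nat.div_eq_of_lt hi, Nat.mul_add_mod,
      Nat.mod_eq_of_lt hi, add_zero]

theorem unaryNats_eq_map (m : ℕ) :
    unaryNats m = (List.range (m + 1)).map fun i => if i < m then 1 else 0 := by
  rw [unaryNats, List.range_succ, List.map_append, List.map_singleton, if_neg (lt_irrefl m)]
  congr 1
  refine (List.eq_replicate_iff.2 ⟨by simp, fun x hx => ?_⟩).symm
  obtain ⟨i, hi, rfl⟩ := List.mem_map.1 hx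
  exact if_pos (List.mem_range.1 hi)

open Classical in
/-- The numbers that describe the network of a graph on `{0, …, n - 1}`, with `κ` sinks and the
deadline `1`: all of them are `0` or `1`. -/
noncomputable def graphBit (n κ : ℕ) (adj : ℕ → ℕ → Prop) (i : ℕ) : ℕ :=
  if i < n + 1 then if i < n then 1 else 0
  else if i - (n + 1) < κ + 1 then if i - (n + 1) < κ then 1 else 0
  else if i - (n + 1) - (κ + 1) < n + 1 then 1
  else if adj ((i - (n + 1) - (κ + 1) - (n + 1)) / (n * 2))
    ((i - (n + 1) - (κ + 1) - (n + 1)) % (n * 2) / 2) then 1 else 0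

theorem graphBit_le (n κ : ℕ) (adj : ℕ → ℕ → Prop) (i : ℕ) : graphBit n κ adj i ≤ 1 := by
  unfold graphBit
  split_ifs <;> omega

/-- The number of numbers that describe the network. -/
def graphLength (n κ : ℕ) : ℕ := n + 1 + (κ + 1 + (n + 1 + n * (n * 2)))

theorem nats_eq_map_graphBit {n κ : ℕ} (G : SimpleGraph (Fin n)) (adj : ℕ → ℕ → Prop)
    (hG : ∀ u v : Fin n, G.Adj u v ↔ adj u v) :
    SinkInstance.nats ⟨unitNetwork G, κ, 1⟩ =
      (List.range (graphLength n κ)).map (graphBit n κ adj) := by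
  classical
  have hsupply : (1 :: List.ofFn fun _ : Fin n => 1) = (List.range (n + 1)).map fun _ => 1 := by
    simp [List.ofFn_const, List.map_const', List.replicate_succ]
  have hrow : ∀ a : ℕ → ℕ, ((List.range n).flatMap fun v => [a v, a v]) =
      (List.range (n * 2)).map fun j => a (j / 2) := fun a =>
    List.flatMap_range_map_range n 2 fun u _ => a u
  have hcoe : ∀ F : ℕ → List ℕ,
      (List.range n).flatMap F = (List.finRange n).flatMap fun u : Fin n => F u := fun F => by
    rw [← List.map_coe_finRange_eq_range, List.flatMap_map]
  have hentry : ∀ u v : Fin n, [(unitNetwork G).cap s(u, v), (unitNetwork G).time s(u, v)] =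
      [if adj u v then 1 else 0, if adj u v then 1 else 0] := by
    intro u v
    by_cases h : G.Adj u v
    · rw [if_pos ((hG u v).1 h), (unitNetwork_isUnit G u v h).1, (unitNetwork_isUnit G u v h).2]
    · have h1 : (unitNetwork G).time s(u, v) = 0 := if_neg h
      have h2 : (unitNetwork G).cap s(u, v) = 0 := if_neg h
      rw [if_neg (fun h' => h ((hG u v).2 h')), h1, h2]
  have hmat : ∀ F : Fin n → Fin n → List ℕ,
      (∀ u v : Fin n, F u v = [if adj u v then 1 else 0, if adj u v then 1 else 0]) →
      ((List.finRange n).flatMap fun u => (List.finRange n).flatMap fun v => F u v) =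
        (List.range (n * (n * 2))).map fun j =>
          if adj (j / (n * 2)) (j % (n * 2) / 2) then 1 else 0 := by
    intro F hF
    rw [← List.flatMap_range_map_range n (n * 2) fun u j => if adj u (j / 2) then 1 else 0]
    simp only [hF]
    rw [hcoe]
    refine List.flatMap_congr fun u _ => ?_
    rw [← hrow fun v => if adj u v then 1 else 0, hcoe]
  refine (congrArg (fun l => unaryNats n ++ (unaryNats κ ++
    ((1 :: List.ofFn fun _ : Fin n => 1) ++ l))) (hmat _ hentry)).trans ?_
  rw [hsupply, unaryNats_eq_map, unaryNats_eq_map]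
  simp only [List.map_range_append]
  rfl

/-! ### The reduction is computable in polynomial time -/

section

variable {K b q c c' p : List (Option Bool) → Env → ℕ}

theorem Def.candGroup (hb : Def b) (hc : Def c) (D : ℕ) :
    Def fun w env => _root_.candGroup (b w env) D (c w env) := hc.div (hb.pow D)

theorem Def.candRank (hK : Def K) (hb : Def b) (hc : Def c) (D j : ℕ) :
    Def fun w env => _root_.candRank (K w env) (b w env) D (c w env) j :=
  .digit hK (.candGroup hb hc D) j

theorem Def.candValue (hb : Def b) (hc : Def c) (j : ℕ) :
    Def fun w env => _root_.candValue (b w env) (c w env) j := .digit hb hc j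

theorem Def.candCount (hK : Def K) (hb : Def b) (D : ℕ) :
    Def fun w env => _root_.candCount (K w env) (b w env) D := (hK.pow D).mul (hb.pow D)

theorem DefPred.candCompat (hK : Def K) (hb : Def b) (hc : Def c) (hc' : Def c') (D : ℕ) :
    DefPred fun w env => CandCompat (K w env) (b w env) D (c w env) (c' w env) :=
  forall_lt_const D fun j => forall_lt_const D fun j' =>
    .iff (.lt (.candRank hK hb hc D j) (.candRank hK hb hc' D j'))
      (.lt (.candValue hb hc j) (.candValue hb hc' j'))

theorem DefPred.candCovers (hK : Def K) (hb : Def b) (hc : Def c) (hp : Def p) (D : ℕ) :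
    DefPred fun w env => CandCovers (K w env) (b w env) D (c w env) (p w env) :=
  exists_lt_const D fun j => exists_lt_const D fun j' =>
    .and (.eq (.candRank hK hb hc D j') (.add (.candRank hK hb hc D j) (.const 1)))
      (.and (.le (.candValue hb hc j) (.add hp (.const 1)))
        (.lt (.add hp (.const 1)) (.candValue hb hc j')))

theorem DefPred.candMember (hK : Def K) (hb : Def b) (hc : Def c) (hp : Def p) (D : ℕ) :
    DefPred fun w env => CandMember (K w env) (b w env) D (c w env) (p w env) :=
  exists_lt_const D fun j => .and (.le (.const 1) (.candRank hK hb hc D j))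
    (.eq (.candValue hb hc j) (.add hp (.const 1)))

variable {r s : ℕ} {ar : Fin r → ℕ} {m₂ : ℕ} (m₁ : ℕ)
  (ψ : (wdLanguage s ar).BoundedFormula Empty m₂)

theorem Def.wordRanks : Def fun w _ => _root_.wordParam w + 2 := .add .wordParam (.const 2)

theorem Def.wordValues (s : ℕ) : Def fun w _ => _root_.wordSize w ^ s + 2 :=
  .add (.pow .wordSize s) (.const 2)

theorem Def.wordCandCount : Def fun w _ =>
    _root_.candCount (_root_.wordParam w + 2) (_root_.wordSize w ^ s + 2) (candLength ψ) :=
  .candCount .wordRanks (.wordValues s) _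

theorem Def.wordConstraintCount : Def fun w _ =>
    constraintCount (_root_.wordSize w) (_root_.wordParam w) m₁ ψ :=
  .add (.mul (.wordCandCount ψ) (.wordCandCount ψ)) (.pow .wordSize m₁)

theorem DefPred.candSatisfies (hq : Def q) (hc : Def c) : DefPred fun w env =>
    CandSatisfies (WordRel ar w) (wordSize w) (wordParam w) m₁ ψ (q w env) (c w env) := by
  have hP := Def.wordCandCount ψ
  have hK := Def.wordRanks
  have hb := Def.wordValues s
  refine .or (.and (.lt hq (.mul hP hP)) (.or
    (.and (.eq (.candGroup hb hc _) (.candGroup hb (.div hq hP) _)) (.ne hc (.div hq hP)))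
    (.and (.eq (.candGroup hb hc _) (.candGroup hb (.mod hq hP) _))
      (.candCompat hK hb (.div hq hP) hc _)))) (.and (.le (.mul hP hP) hq) ?_)
  have hE : ∀ i, Def fun w env => digit (wordSize w) (env 0) i := fun i =>
    .digit .wordSize (.var 0) i
  refine .exists_lt (.pow .wordSize m₂) (P := fun w env u' =>
    u' % wordSize w ^ m₁ = q w env - _ * _ ∧ (∀ p ∈ qfPoints (wordSize w) (digit _ u') ψ, _) ∧
      QFSat (WordRel ar w) _ (wordSize w) (digit _ u') ψ) ?_
  refine .and (.eq (.mod (.var 0) (.pow .wordSize m₁)) (.sub hq.tail (.mul hP hP))) (.and ?_ ?_)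
  · exact .forall_qfPoints hE (X := fun w env p => CandCovers (wordParam w + 2)
      (wordSize w ^ s + 2) (candLength ψ) (c w env.tail) p)
      (fun f hf => .candCovers hK hb hc.tail hf _) ψ
  · exact .qfSat hE (X := fun w env p => CandMember (wordParam w + 2)
      (wordSize w ^ s + 2) (candLength ψ) (c w env.tail) p)
      (fun f hf => .candMember hK hb hc.tail hf _) ψ

theorem Def.wordSinks (D : ℕ) : Def fun w _ => (_root_.wordParam w + 2) ^ D := .pow .wordRanks _

theorem Def.wordVertices : Def fun w _ =>
    _root_.candCount (_root_.wordParam w + 2) (_root_.wordSize w ^ s + 2) (candLength ψ) +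
      ((_root_.wordParam w + 2) ^ candLength ψ + 1) *
        constraintCount (_root_.wordSize w) (_root_.wordParam w) m₁ ψ :=
  .add (.wordCandCount ψ) (.mul (.add (.wordSinks _) (.const 1)) (.wordConstraintCount m₁ ψ))

theorem DefPred.constraintAdj (hc : Def c) (hc' : Def c') : DefPred fun w env =>
    ConstraintAdj (candCount (wordParam w + 2) (wordSize w ^ s + 2) (candLength ψ))
      (constraintCount (wordSize w) (wordParam w) m₁ ψ)
      (CandSatisfies (WordRel ar w) (wordSize w) (wordParam w) m₁ ψ) (c w env) (c' w env) := by
  have hP := Def.wordCandCount ψ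
  have hQ := Def.wordConstraintCount m₁ ψ
  exact .or (.and (.lt hc hP) (.and (.lt hc' hP) (.ne hc hc')))
    (.or (.and (.lt hc hP) (.and (.le hP hc') (.candSatisfies m₁ ψ (.mod (.sub hc' hP) hQ) hc)))
      (.and (.lt hc' hP) (.and (.le hP hc) (.candSatisfies m₁ ψ (.mod (.sub hc hP) hQ) hc'))))

theorem Def.graphBit {n κ i : List (Option Bool) → Env → ℕ}
    {adj : List (Option Bool) → Env → ℕ → ℕ → Prop} (hn : Def n) (hκ : Def κ)
    (hadj : ∀ f g, Def f → Def g → DefPred fun w env => adj w env (f w env) (g w env))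
    (hi : Def i) : Def fun w env => _root_.graphBit (n w env) (κ w env) (adj w env) (i w env) := by
  classical
  have h1 := hi.sub (hn.add (const 1))
  have h2 := h1.sub (hκ.add (const 1))
  have h3 := h2.sub (hn.add (const 1))
  have h4 := hn.mul (const 2)
  exact .ite (.lt hi (hn.add (const 1))) (.ite (.lt hi hn) (const 1) (const 0))
    (.ite (.lt h1 (hκ.add (const 1))) (.ite (.lt h1 hκ) (const 1) (const 0))
      (.ite (.lt h2 (hn.add (const 1))) (const 1)
        (.ite (hadj _ _ (h3.div h4) ((h3.mod h4).div (const 2))) (const 1) (const 0))))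

theorem Def.graphLength {n κ : List (Option Bool) → Env → ℕ} (hn : Def n) (hκ : Def κ) :
    Def fun w env => _root_.graphLength (n w env) (κ w env) :=
  .add (.add hn (const 1)) (.add (.add hκ (const 1)) (.add (.add hn (const 1))
    (.mul hn (.mul hn (const 2)))))

/-- The instance of sink location for an instance of weighted definability. -/
noncomputable def candidateInstance (A : WDInstance ar) : SinkInstance :=
  constraintInstance (candCount (A.k + 2) (A.n ^ s + 2) (candLength ψ))
    (constraintCount A.n A.k m₁ ψ) ((A.k + 2) ^ candLength ψ)
    (CandSatisfies (WordRel ar (encodeNats A.nats)) A.n A.k m₁ ψ)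

theorem exists_machine_candidateInstance :
    ∃ (M : Turing.TM2ComputableAux (Option Bool) (Option Bool)) (p : Polynomial ℕ),
      ∀ A : WDInstance ar, Nonempty (Turing.TM2OutputsInTime M.tm
        ((encodeNats A.nats).reverse.map M.inputAlphabet.symm)
        (some ((encodeNats (candidateInstance m₁ ψ A).nats).map M.outputAlphabet.symm))
        (p.eval (encodeNats A.nats).length)) := by
  obtain ⟨l, hl⟩ := Def.graphLength (.wordVertices m₁ ψ) (.wordSinks (candLength ψ))
  obtain ⟨b, hb⟩ := Def.graphBit (.wordVertices m₁ ψ) (.wordSinks (candLength ψ))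
    (fun f g hf hg => .constraintAdj m₁ ψ hf hg) (.var 0)
  obtain ⟨M, p, h⟩ := Ex.exists_machine_bits l b
  refine ⟨M, p, fun A => ?_⟩
  convert h (encodeNats A.nats) using 6
  rw [hl]
  simp only [Ex.bits, hb, A.wordSize_encode, A.wordParam_encode]
  refine (nats_eq_map_graphBit _ (ConstraintAdj _ _ _) fun u v => Iff.rfl).trans
    (List.map_congr_left fun i _ => ?_)
  split_ifs with h0
  · exact h0
  · exact le_antisymm (graphBit_le _ _ _ _) (Nat.pos_of_ne_zero h0)

end

/-! ### Hardness -/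

theorem isHardFor_two_unitSinkLocation : IsHardFor (WClass 2) unitSinkLocation := by
  rintro Q ⟨r, s, ar, φ, hφ, hQ⟩
  obtain ⟨m₁, m₂, ψ, hψ⟩ := hφ.exists_candSatisfies
  obtain ⟨M, p, hM⟩ := exists_machine_candidateInstance m₁ ψ
  have : Inhabited (weightedDefinability φ).Letter := inferInstanceAs (Inhabited (Option Bool))
  have : Fintype (weightedDefinability φ).Letter := inferInstanceAs (Fintype (Option Bool))
  refine hQ.trans_of_polyTime (R := unitSinkLocation)
    (fun A => ⟨candidateInstance m₁ ψ A, unitNetwork_isUnit _⟩) (fun A => ?_) M p hM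
    (fun κ => (κ + 2) ^ candLength ψ) ?_ (fun a b h => by dsimp only; gcongr) fun A => le_rfl
  · refine (hψ A _ A.wordRel_encode).trans (yes_constraintInstance ?_ (by positivity)).symm
    have h1 : A.k + 2 ≤ (A.k + 2) ^ candLength ψ := Nat.le_self_pow (by simp [candLength]) _
    have h2 : 0 < (A.n ^ s + 2) ^ candLength ψ := by positivity
    rw [candCount]
    nlinarith
  · exact ((primrec_pow_const _).comp (Primrec.nat_add.comp Primrec.id (Primrec.const 2))).to_comp

theorem WClass_one_subset_two : WClass 1 ⊆ WClass 2 := by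
  rintro Q ⟨r, s, ar, φ, hφ, hQ⟩
  exact ⟨r, s, ar, φ, hφ.two_of_one, hQ⟩

/-- Restricted instances are written in the same way. -/
theorem FPTReducible.of_restrict {Q P : ParamProblem} {S : P.Inst → Prop}
    (h : FPTReducible Q (P.restrict S)) : FPTReducible Q P := by
  obtain ⟨f, hf, hM, hg⟩ := h
  exact ⟨fun x => (f x).1, hf, hM, hg⟩

theorem mainTheorem2 :
    (IsHardFor (WClass 2) sinkLocation ∧ IsHardFor (WClass 1) sinkLocation) ∧
      (IsHardFor (WClass 2) unitSinkLocation ∧ IsHardFor (WClass 1) unitSinkLocation) := by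
  have h := isHardFor_two_unitSinkLocation
  exact ⟨⟨fun Q hQ => (h Q hQ).of_restrict,
    fun Q hQ => (h Q (WClass_one_subset_two hQ)).of_restrict⟩, h,
    fun Q hQ => h Q (WClass_one_subset_two hQ)⟩
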